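/- **Setting.** Let $m,n\ge 0$ with $m+n$ even and positive, and put $N=m+n+1$. Let $M_1,M_2$ be disjoint, closed (compact, without boundary), oriented smooth submanifolds of $\mathbb{R}^{N+1}=\mathbb{R}^{m+n+2}$ of dimensions $m$ and $n$, with local coordinates $\mathbf x(s_1,\dots,s_m)$ and $\mathbf y(t_1,\dots,t_n)$. Integrals over $M_1$, $M_2$ are written in local coordinates (summed over charts with a subordinate partition of unity, with the sign given by the orientation). For maps $\mathbf x,\mathbf y$ of $M_1,M_2$ into an oriented $N$-dimensional Euclidean space, with disjoint images, the Gauss linking integral is $$\mathrm{Lk}=\frac{(-1)^{m+1}}{\mathrm{vol}(\mathbb S^{N-1})}\int_{M_1\times M_2}\frac{\det\big(\mathbf x-\mathbf y,\tfrac{\partial\mathbf x}{\partial s_1},\dots,\tfrac{\partial\mathbf x}{\partial s_m},\tfrac{\partial\mathbf y}{\partial t_1},\dots,\tfrac{\partial\mathbf y}{\partial t_n}\big)}{\|\mathbf x-\mathbf y\|^N}\,ds\,dt .$$ At a point of $M_1\times M_2$ let $A=(\mathbf a_1,\dots,\mathbf a_N)$ with $\mathbf a_i=\partial\mathbf x/\partial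 s_i$ for $1\le i\le m$, $\mathbf a_{m+j}=\partial\mathbf y/\partial t_j$ for $1\le j\le n$, and $\mathbf a_N=\mathbf y-\mathbf x$; let $A'=(\mathbf a'_1,\dots,\mathbf a'_N)$ be the corresponding vectors at a second point $(s',t')$. For $A,A'\in(\mathbb R^{N+1})^N$ put $$I(A,A')=\frac1{(2\pi)^{(N+1)/2}}\int_{\mathbb R^{N+1}}\frac{\det(\mathbf a_1,\dots,\mathbf a_N,\tfrac{v}{\|v\|})}{\|\mathrm{proj}_{v^\perp}\mathbf a_N\|^N}\,\frac{\det(\mathbf a'_1,\dots,\mathbf a'_N,\tfrac{v}{\|v\|})}{\|\mathrm{proj}_{v^\perp}\mathbf a'_N\|^N}\,e^{-\|v\|^2/2}\,dv ,$$ and let $[\mathbf c_1:\dots:\mathbf c_N]_i=\sum_{j_1,\dots,j_N}\epsilon_{ij_1\dots j_N}c_{1j_1}\cdots c_{Nj_N}$ be the generalized cross product in $\mathbb R^{N+1}$. For $a,b\in\mathbb R$ put $$w_{a,b}(v)=\frac{(2\pi)^{-(N+1)/2}\,\|v\|^{2(m+n)}e^{-\|v\|^2/2}}{\big((bv_1-av_2)^2+v_3^2+\dots+v_{N+1}^2\big)^{N/2}\big((bv_1+av_2)^2+v_3^2+\dots+v_{N+1}^2\big)^{N/2}},\qquad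 I_{i,i}(a,b)=\int_{\mathbb R^{N+1}}w_{a,b}(v)\,v_i^2\,dv .$$ For $\varepsilon>0$ let $I^{\varepsilon}_{i,i}(a,b)$ be the same integral restricted to the region where both $(bv_1-av_2)^2+v_3^2+\dots+v_{N+1}^2$ and $(bv_1+av_2)^2+v_3^2+\dots+v_{N+1}^2$ are at least $\varepsilon\|v\|^2$. **Theorem.** 1. For almost every linear hyperplane $U\subset\mathbb R^{N+1}$, with respect to the normalized rotation-invariant measure on $Gr(N+1,N)$, the orthogonal projections of $M_1$ and $M_2$ to $U$ have disjoint images and the Gauss integral $\mathrm{Lk}_U$ of the projections converges absolutely. The average of $\mathrm{Lk}_U^2$ over all $U$ is finite, the integral on the right below converges absolutely, and $$\langle\mathrm{Lk}^2\rangle=\frac1{\mathrm{vol}(\mathbb S^{N-1})^2}\int_{(M_1\times M_2)^2}I\big(A(s,t),A'(s',t')\big)\,ds\,dt\,ds'\,dt' .$$ For almost every pair of points of $M_1\times M_2$, either $\mathbf a_N,\mathbf a'_N$ are linearly independent or the integrand defining $I(A,A')$ vanishes identically. 2. Let $A,A'\in(\mathbb R^{N+1})^N$ with $\mathbf a_N,\mathbf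 a'_N$ linearly independent. Put $\mathbf q=\mathbf a_N/\|\mathbf a_N\|$, $\mathbf q'=\mathbf a'_N/\|\mathbf a'_N\|$, and let $\mathbf b_1,\dots,\mathbf b_{N+1}$ be an orthonormal basis with $\mathbf b_1=\frac{\mathbf q+\mathbf q'}{\|\mathbf q+\mathbf q'\|}$ and $\mathbf b_2=\frac{\mathbf q-\mathbf q'}{\|\mathbf q-\mathbf q'\|}$. Let $a=\mathbf b_1\cdot\mathbf q$, $b=\mathbf b_2\cdot\mathbf q$. Write $\mathbf A=[\mathbf a_1:\dots:\mathbf a_N]$, $\mathbf A'=[\mathbf a'_1:\dots:\mathbf a'_N]$, $$X=([\mathbf b_2:\mathbf b_3:\dots:\mathbf b_{N+1}]\cdot\mathbf A)([\mathbf b_2:\mathbf b_3:\dots:\mathbf b_{N+1}]\cdot\mathbf A'),\qquad Y=([\mathbf b_1:\mathbf b_3:\dots:\mathbf b_{N+1}]\cdot\mathbf A)([\mathbf b_1:\mathbf b_3:\dots:\mathbf b_{N+1}]\cdot\mathbf A').$$ Then the integral $I(A,A')$ converges absolutely, the integrals $I_{i,i}(a,b)$ with $3\le i\le N+1$ converge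 and are all equal to $I_{3,3}(a,b)$, and $$I(A,A')\,\|\mathbf a_N\|^N\|\mathbf a'_N\|^N=\big\{I_{1,1}(a,b)\,X+I_{2,2}(a,b)\,Y\big\}+I_{3,3}(a,b)\sum_{i=3}^{N+1}(\mathbf b_i\cdot\mathbf A)(\mathbf b_i\cdot\mathbf A').$$ Here the expression in braces, whose two summands contain divergent integrals, stands for the single absolutely convergent integral $\int w_{a,b}(v)\,(v_1^2X+v_2^2Y)\,dv$. Equivalently, all $I^{\varepsilon}_{i,i}(a,b)$ converge absolutely for $\varepsilon>0$, and $$I(A,A')\,\|\mathbf a_N\|^N\|\mathbf a'_N\|^N=\lim_{\varepsilon\to0^+}\Big(I^{\varepsilon}_{1,1}(a,b)\,X+I^{\varepsilon}_{2,2}(a,b)\,Y+I_{3,3}(a,b)\sum_{i=3}^{N+1}(\mathbf b_i\cdot\mathbf A)(\mathbf b_i\cdot\mathbf A')\Big).$$ For fixed $m+n$, $I_{3,3}$ is a function of $a$ and $b$ only. -/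

import Mathlib

open MeasureTheory Set Filter Topology Manifold
open scoped ContDiff RealInnerProductSpace

noncomputable section

namespace GaussLink

/-! ### Oriented closed manifolds and integration in local coordinates -/

/-- The Euclidean space `ℝᵈ`. -/
abbrev Euc (d : ℕ) : Type := EuclideanSpace ℝ (Fin d)

/-- An orientation of an `m`-manifold `M`, described in the preferred charts: `sign c p` is `+1` or
`-1` according to whether the chart at `c` preserves or reverses orientation at the point `p` of its
domain. It is locally constant on the domain of the chart, and for two charts the signs differ by
the sign of the Jacobian determinant of the coordinate change. (For `m = 0` this is an arbitrary
assignment of signs to the points.) -/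
structure ManifoldOrientation (m : ℕ) (M : Type*) [TopologicalSpace M]
    [ChartedSpace (Euc m) M] where
  sign : M → M → ℝ
  sign_eq : ∀ c p, p ∈ (chartAt (Euc m) c).source → sign c p = 1 ∨ sign c p = -1
  continuousOn_sign : ∀ c, ContinuousOn (sign c) (chartAt (Euc m) c).source
  compatible : ∀ c c' p, p ∈ (chartAt (Euc m) c).source → p ∈ (chartAt (Euc m) c').source →
    0 < sign c p * sign c' p *
      (fderiv ℝ (chartAt (Euc m) c' ∘ (chartAt (Euc m) c).symm) (chartAt (Euc m) c p)).det

/-- Finitely many preferred charts of `M`, with a smooth partition of unity subordinate to their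
domains. On a closed oriented manifold, the integral over `M` of an expression in local coordinates
`s₁, …, s_m` is the sum over these charts, each weighted by its function of the partition of
unity and by the orientation sign of the chart. -/
structure ChartPartition (m : ℕ) (M : Type*) [TopologicalSpace M] [ChartedSpace (Euc m) M] where
  ι : Type
  [fintype : Fintype ι]
  center : ι → M
  rho : SmoothPartitionOfUnity ι (𝓡 m) M univ
  subordinate : rho.IsSubordinate fun i => (chartAt (Euc m) (center i)).source

attribute [instance] ChartPartition.fintype

/-- Closed manifolds have such a system of charts. -/
theorem nonempty_chartPartition (m : ℕ) (M : Type*) [TopologicalSpace M] [CompactSpace M]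
    [T2Space M] [ChartedSpace (Euc m) M] [IsManifold (𝓡 m) ∞ M] :
    Nonempty (ChartPartition m M) := by
  obtain ⟨t, ht⟩ := isCompact_univ.elim_finite_subcover
    (fun c : M => (chartAt (Euc m) c).source) (fun c => (chartAt (Euc m) c).open_source)
    (fun p _ => mem_iUnion.2 ⟨p, mem_chart_source _ p⟩)
  let e : Fin t.card ≃ t := t.equivFin.symm
  obtain ⟨f, hf⟩ := SmoothPartitionOfUnity.exists_isSubordinate (𝓡 m) (s := (univ : Set M))
    isClosed_univ (fun i : Fin t.card => (chartAt (Euc m) (e i : M)).source)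
    (fun i => (chartAt (Euc m) (e i : M)).open_source) (fun p _ => by
      obtain ⟨c, hc, hp⟩ := mem_iUnion₂.1 (ht (mem_univ p))
      exact mem_iUnion.2 ⟨e.symm ⟨c, hc⟩, by simpa using hp⟩)
  exact ⟨⟨Fin t.card, fun i => e i, f, hf⟩⟩

section Coordinates

variable {m : ℕ} {M : Type*} [TopologicalSpace M] [ChartedSpace (Euc m) M]
  {F : Type*} [NormedAddCommGroup F] [NormedSpace ℝ F]

/-- The coordinate domain in `ℝᵐ` of the `i`-th chart. -/
def coordDomain (P : ChartPartition m M) (i : P.ι) : Set (Euc m) :=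
  (chartAt (Euc m) (P.center i)).target

/-- The map `x : M → F` in the local coordinates of the `i`-th chart, `s ↦ x(s₁, …, s_m)`. -/
def coordMap (P : ChartPartition m M) (i : P.ι) (x : M → F) : Euc m → F :=
  x ∘ (chartAt (Euc m) (P.center i)).symm

/-- The partial derivatives `∂x/∂s₁, …, ∂x/∂s_m` in the local coordinates of the `i`-th chart. -/
def coordDeriv (P : ChartPartition m M) (i : P.ι) (x : M → F) (s : Euc m) : Fin m → F :=
  fun k => fderiv ℝ (coordMap P i x) s (EuclideanSpace.single k 1)

/-- The weight of the `i`-th chart at the point with coordinates `s`: partition of unity times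
orientation sign. -/
def coordWeight (o : ManifoldOrientation m M) (P : ChartPartition m M) (i : P.ι) (s : Euc m) : ℝ :=
  P.rho i ((chartAt (Euc m) (P.center i)).symm s) *
    o.sign (P.center i) ((chartAt (Euc m) (P.center i)).symm s)

end Coordinates

/-! ### The Gauss linking integral in an oriented Euclidean space of dimension `m + n + 1` -/

/-- The total `d`-dimensional volume of the unit sphere of `ℝᵈ⁺¹`. -/
def sphereVolume (d : ℕ) : ℝ :=
  (volume : Measure (Euc (d + 1))).toSphere.real univ

section Gauss

variable {m n : ℕ}
  {M₁ : Type*} [TopologicalSpace M₁] [ChartedSpace (Euc m) M₁]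
  {M₂ : Type*} [TopologicalSpace M₂] [ChartedSpace (Euc n) M₂]
  {F : Type*} [NormedAddCommGroup F] [InnerProductSpace ℝ F]
  [Fact (Module.finrank ℝ F = m + n + 1)]

/-- The Gauss integrand in the charts `i`, `j`:
`det (x - y, ∂x/∂s₁, …, ∂x/∂s_m, ∂y/∂t₁, …, ∂y/∂t_n) / ‖x - y‖ ^ (m + n + 1)`, weighted. -/
def gaussIntegrand (o₁ : ManifoldOrientation m M₁) (P₁ : ChartPartition m M₁)
    (o₂ : ManifoldOrientation n M₂) (P₂ : ChartPartition n M₂)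
    (oF : Orientation ℝ F (Fin (m + n + 1))) (x : M₁ → F) (y : M₂ → F)
    (i : P₁.ι) (j : P₂.ι) (z : Euc m × Euc n) : ℝ :=
  coordWeight o₁ P₁ i z.1 * coordWeight o₂ P₂ j z.2 *
    (oF.volumeForm (Fin.cons (α := fun _ => F) (coordMap P₁ i x z.1 - coordMap P₂ j y z.2)
        (Fin.append (coordDeriv P₁ i x z.1) (coordDeriv P₂ j y z.2))) /
      ‖coordMap P₁ i x z.1 - coordMap P₂ j y z.2‖ ^ (m + n + 1))

/-- The Gauss linking integral `Lk` of `x : M₁ → F` and `y : M₂ → F`, `dim F = m + n + 1`. -/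
def gaussLinking (o₁ : ManifoldOrientation m M₁) (P₁ : ChartPartition m M₁)
    (o₂ : ManifoldOrientation n M₂) (P₂ : ChartPartition n M₂)
    (oF : Orientation ℝ F (Fin (m + n + 1))) (x : M₁ → F) (y : M₂ → F) : ℝ :=
  (-1) ^ (m + 1) / sphereVolume (m + n) *
    ∑ i, ∑ j, ∫ z in coordDomain P₁ i ×ˢ coordDomain P₂ j,
      gaussIntegrand o₁ P₁ o₂ P₂ oF x y i j z

end Gauss

/-! ### Random hyperplanes -/

/-- The Grassmannian of linear hyperplanes (codimension-one subspaces) of `ℝᵏ⁺²`. -/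
def Hyperplane (k : ℕ) : Type :=
  {U : Submodule ℝ (Euc (k + 2)) // Module.finrank ℝ U = k + 1}

instance (k : ℕ) (U : Hyperplane k) : Fact (Module.finrank ℝ U.1 = k + 1) := ⟨U.2⟩

/-- The hyperplane orthogonal to a unit vector. -/
def normalHyperplane (k : ℕ) (v : Metric.sphere (0 : Euc (k + 2)) 1) : Hyperplane k :=
  ⟨(ℝ ∙ (v : Euc (k + 2)))ᗮ, by
    have : Fact (Module.finrank ℝ (Euc (k + 2)) = (k + 1) + 1) := ⟨by simp⟩
    exact Submodule.finrank_orthogonal_span_singleton (ne_zero_of_mem_unit_sphere v)⟩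

/-- The Grassmannian of hyperplanes is the quotient of the unit sphere by the antipodal map; it
carries the quotient of the Borel `σ`-algebra of the sphere. -/
instance (k : ℕ) : MeasurableSpace (Hyperplane k) :=
  MeasurableSpace.map (normalHyperplane k) inferInstance

theorem measurable_normalHyperplane (k : ℕ) : Measurable (normalHyperplane k) :=
  measurable_iff_le_map.2 le_rfl

/-- The normalized rotation-invariant measure on the Grassmannian of hyperplanes: the image of the
normalized surface measure of the unit sphere under `v ↦ v^⊥`. -/
def hyperplaneMeasure (k : ℕ) : Measure (Hyperplane k) :=
  ((((volume : Measure (Euc (k + 2))).toSphere univ)⁻¹) •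
    (volume : Measure (Euc (k + 2))).toSphere).map (normalHyperplane k)

instance (k : ℕ) : IsProbabilityMeasure (hyperplaneMeasure k) := by
  constructor
  rw [hyperplaneMeasure, Measure.map_apply (measurable_normalHyperplane k) MeasurableSet.univ]
  simp only [preimage_univ, Measure.smul_apply, smul_eq_mul]
  refine ENNReal.inv_mul_cancel ?_ (measure_ne_top _ _)
  rw [Ne, Measure.measure_univ_eq_zero, Measure.toSphere_eq_zero_iff_finrank]
  simp

/-- Orthogonal projection to the hyperplane `U`. -/
def hyperplaneProj {k : ℕ} (U : Hyperplane k) : Euc (k + 2) → U.1 :=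
  fun w => U.1.orthogonalProjectionOnto w

/-! ### The kernel of the averaged squared linking number -/

/-- The determinant of the matrix with columns `w 0, …, w (d - 1)`. -/
def detCols {d : ℕ} (w : Fin d → Euc d) : ℝ :=
  (Matrix.of fun r c => w c r).det

/-- The unit vector in the direction of `a`. -/
def dir {d : ℕ} (a : Euc d) : Euc d := ‖a‖⁻¹ • a

/-- The last vector `a_N` of `A = (a₁, …, a_N)`, where `N = k + 1`. -/
def lastCol {k : ℕ} (A : Fin (k + 1) → Euc (k + 2)) : Euc (k + 2) := A (Fin.last k)

/-- `det (a₁, …, a_N, v / ‖v‖) / ‖proj_{v^⊥} a_N‖ ^ N`, with `N = k + 1`. -/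
def kernelFactor {k : ℕ} (A : Fin (k + 1) → Euc (k + 2)) (v : Euc (k + 2)) : ℝ :=
  detCols (Fin.snoc (α := fun _ => Euc (k + 2)) A (dir v)) /
    ‖(ℝ ∙ v)ᗮ.orthogonalProjectionOnto (lastCol A)‖ ^ (k + 1)

/-- The standard Gaussian density `(2π)^{-d/2} exp (-‖v‖² / 2)` on `ℝᵈ`. -/
def gaussDensity {d : ℕ} (v : Euc d) : ℝ :=
  (2 * Real.pi) ^ (-(d : ℝ) / 2) * Real.exp (-‖v‖ ^ 2 / 2)

/-- The kernel `I(A, A')`: the Gaussian average over `v ∈ ℝᵏ⁺²` of the product of the two Gauss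
integrands projected to `v^⊥`. -/
def kernel {k : ℕ} (A A' : Fin (k + 1) → Euc (k + 2)) : ℝ :=
  ∫ v : Euc (k + 2), kernelFactor A v * kernelFactor A' v * gaussDensity v

/-- The generalized cross product `[a₁ : … : a_N]` of `N = k + 1` vectors of `ℝᵏ⁺²`. Its `i`-th
component is `∑ ε_{i j₁ … j_N} a_{1 j₁} ⋯ a_{N j_N}`, that is, the determinant with rows
`e_i, a₁, …, a_N`. -/
def cross {k : ℕ} (a : Fin (k + 1) → Euc (k + 2)) : Euc (k + 2) :=
  WithLp.toLp 2 fun i =>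
    (Matrix.of fun r c =>
      Fin.cons (α := fun _ => Euc (k + 2)) (EuclideanSpace.single i (1 : ℝ)) a r c).det

/-- `(b v₁ - a v₂)² + v₃² + … + v_{k+2}²`. -/
def quadForm {k : ℕ} (a b : ℝ) (v : Euc (k + 2)) : ℝ :=
  (b * v 0 - a * v 1) ^ 2 + ∑ j : Fin k, v j.succ.succ ^ 2

/-- The common weight of the moment integrals, `N = k + 1`: the Gaussian density times
`‖v‖^{2k} / (((b v₁ - a v₂)² + v₃² + …)^{N/2} ((b v₁ + a v₂)² + v₃² + …)^{N/2})`. -/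
def momentWeight {k : ℕ} (a b : ℝ) (v : Euc (k + 2)) : ℝ :=
  ‖v‖ ^ (2 * k) /
      (quadForm a b v ^ (((k : ℝ) + 1) / 2) * quadForm (-a) b v ^ (((k : ℝ) + 1) / 2)) *
    gaussDensity v

/-- The moment integral `I_{i,i}(a, b)` over `ℝᵏ⁺²`. -/
def moment {k : ℕ} (a b : ℝ) (i : Fin (k + 2)) : ℝ :=
  ∫ v : Euc (k + 2), momentWeight a b v * v i ^ 2

/-- The region outside the cones of aperture `ε` around the two singular lines of the weight. -/
def truncRegion (k : ℕ) (a b ε : ℝ) : Set (Euc (k + 2)) :=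
  {v | ε * ‖v‖ ^ 2 ≤ quadForm a b v ∧ ε * ‖v‖ ^ 2 ≤ quadForm (-a) b v}

/-- The truncated moment integral `I^ε_{i,i}(a, b)`. -/
def truncMoment {k : ℕ} (ε a b : ℝ) (i : Fin (k + 2)) : ℝ :=
  ∫ v in truncRegion k a b ε, momentWeight a b v * v i ^ 2

/-- `I_{1,1}(a, b) X + I_{2,2}(a, b) Y` written as a single integral. -/
def pairMoment (k : ℕ) (a b X Y : ℝ) : ℝ :=
  ∫ v : Euc (k + 2), momentWeight a b v * (v 0 ^ 2 * X + v 1 ^ 2 * Y)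

/-- The product `([c₁ : … : c_N] · [a₁ : … : a_N]) ([c₁ : … : c_N] · [a'₁ : … : a'_N])`. -/
def crossPairing {k : ℕ} (c A A' : Fin (k + 1) → Euc (k + 2)) : ℝ :=
  ⟪cross c, cross A⟫ * ⟪cross c, cross A'⟫

/-- `∑_{i ≥ 3} (b_i · [a₁ : … : a_N]) (b_i · [a'₁ : … : a'_N])`. -/
def restPairing {k : ℕ} (b : Fin (k + 2) → Euc (k + 2)) (A A' : Fin (k + 1) → Euc (k + 2)) : ℝ :=
  ∑ j : Fin k, ⟪b j.succ.succ, cross A⟫ * ⟪b j.succ.succ, cross A'⟫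

/-! ### The integral over the configuration space -/

section Configuration

variable {m n : ℕ}
  {M₁ : Type*} [TopologicalSpace M₁] [ChartedSpace (Euc m) M₁]
  {M₂ : Type*} [TopologicalSpace M₂] [ChartedSpace (Euc n) M₂]

/-- `A = (∂x/∂s₁, …, ∂x/∂s_m, ∂y/∂t₁, …, ∂y/∂t_n, y - x)` in the charts `i`, `j`. -/
def configCols (P₁ : ChartPartition m M₁) (P₂ : ChartPartition n M₂)
    (x : M₁ → Euc (m + n + 2)) (y : M₂ → Euc (m + n + 2))
    (i : P₁.ι) (j : P₂.ι) (z : Euc m × Euc n) : Fin (m + n + 1) → Euc (m + n + 2) :=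
  Fin.snoc (α := fun _ => Euc (m + n + 2))
    (Fin.append (coordDeriv P₁ i x z.1) (coordDeriv P₂ j y z.2))
    (coordMap P₂ j y z.2 - coordMap P₁ i x z.1)

/-- The coordinate domain in `(ℝᵐ × ℝⁿ)²` of a quadruple of charts of `(M₁ × M₂)²`. -/
def configDomain (P₁ : ChartPartition m M₁) (P₂ : ChartPartition n M₂)
    (i : P₁.ι) (j : P₂.ι) (i' : P₁.ι) (j' : P₂.ι) :
    Set ((Euc m × Euc n) × (Euc m × Euc n)) :=
  (coordDomain P₁ i ×ˢ coordDomain P₂ j) ×ˢ (coordDomain P₁ i' ×ˢ coordDomain P₂ j')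

/-- The weighted kernel `I(A(s, t), A(s', t'))` in a quadruple of charts of `(M₁ × M₂)²`. -/
def configIntegrand (o₁ : ManifoldOrientation m M₁) (P₁ : ChartPartition m M₁)
    (o₂ : ManifoldOrientation n M₂) (P₂ : ChartPartition n M₂)
    (x : M₁ → Euc (m + n + 2)) (y : M₂ → Euc (m + n + 2))
    (i : P₁.ι) (j : P₂.ι) (i' : P₁.ι) (j' : P₂.ι)
    (z : (Euc m × Euc n) × (Euc m × Euc n)) : ℝ :=
  coordWeight o₁ P₁ i z.1.1 * coordWeight o₂ P₂ j z.1.2 *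
    (coordWeight o₁ P₁ i' z.2.1 * coordWeight o₂ P₂ j' z.2.2) *
    kernel (configCols P₁ P₂ x y i j z.1) (configCols P₁ P₂ x y i' j' z.2)

end Configuration

end GaussLink

end

/-! Write k = m + n, so that N = k + 1 and the ambient space has dimension k + 2. On projected
vectors a volume form of v^⊥ is, up to sign, the determinant with v added as a further vector. So
the Gauss integrand of the projections to v^⊥ is `kernelFactor` of A at v, up to a sign that depends
only on v and the orientation. Squaring removes the sign, and Lk² becomes a double integral over two
copies of M₁ × M₂. The direction of a Gaussian vector is uniform on the sphere, so averaging over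
hyperplanes is a Gaussian integral in v, and Fubini gives the formula. The real issue is absolute
convergence of the triple integral.

Since the cross product of A is orthogonal to a_N, one has |kernelFactor A v| ≤ J · sin∠(a_N,
v)^(-k), where J is the area density of the direction map (s, t) ↦ a_N/‖a_N‖
(`ofReal_abs_kernelFactor_le`). The Gaussian average of two such powers is at most a constant times
sin∠(a_N, a'_N)^(-(k - 1/2)) (`exists_lintegral_sine_mul_sine_le`). It remains to bound, uniformly
in the pole w, the integral of J · sin∠(a_N, w)^(-s) for s < k.

This would be immediate if the multiplicities involved were bounded, but a smooth map may have
fibres of unbounded size. The remedy is `exists_card_fiber_le`: for every δ > 0, a smooth map of ℝᵈ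
has locally O(ε^(-δ)) preimages at which the Jacobian is at least ε. On small cells the map is
C¹-close to a Taylor polynomial, and generic fibres of polynomial maps are bounded in terms of the
degree. Summing over dyadic ranges of the Jacobian, |det|^(1+q) pushes forward to a measure of
bounded density for every q > 0. This is applied to the cone map (z, t, τ) ↦ t F(z) + τ eᵢ of ℝᵏ⁺²,
whose Jacobian is t^k times the i-th component of the cross product. The distance to the plane
spanned by w and eᵢ has locally integrable powers of order above -k, and the extra exponent q is
absorbed by x ≤ 1 + x^(1+q) (`exists_setLIntegral_norm_cross_le`).

The same bound shows that, for a fixed a'_N, the points with nonzero cross product and a_N parallel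
to a'_N form a null set. The projections are disjoint for almost every v because the cone over the
differences x - y has dimension at most k + 1.

For the form of the kernel, v is written in the basis b. The two denominators become distances to
two lines in the plane of b₁ and b₂. Orthogonality of the cross products to a_N and a'_N makes the
(v₁, v₂)-part of the numerator a multiple of (b v₁ - a v₂)(b v₁ + a v₂). It vanishes on both lines,
so the combined integral converges. All mixed terms are odd in some v_i with i ≥ 3 and integrate to
zero (`kernel_mul_norm_pow_eq`). -/

noncomputable section

namespace GaussLink

open scoped ENNReal NNReal

/-! ### Generic fibres of polynomial maps -/

section Polynomial

open MvPolynomial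

variable {d K : ℕ}

/-- Powers of the components of a polynomial map of `ℝᵈ`, together with powers of one coordinate,
satisfy a linear relation of bounded degree. -/
theorem exists_polynomial_relation (p : Fin d → MvPolynomial (Fin d) ℝ)
    (hp : ∀ j, (p j).totalDegree ≤ K) (i : Fin d) :
    ∃ c : (Fin d → Fin ((d * K + 1) ^ d + 1)) × Fin ((d * K + 1) ^ d + 1) → ℝ, c ≠ 0 ∧
      ∑ a, c a • ((∏ j, p j ^ (a.1 j : ℕ)) * X i ^ (a.2 : ℕ)) = 0 := by
  -- Dimension count: there are (e+1)^(d+1) products, all of degree at most D, hence supported on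
  -- (D+1)^d monomials. Since D + 1 ≤ (dK+1)(e+1), the latter number is at most e(e+1)^d, which is
  -- smaller.
  set e := (d * K + 1) ^ d with he
  set D := d * (e * K) + e with hD
  let q : (Fin d → Fin (e + 1)) × Fin (e + 1) → MvPolynomial (Fin d) ℝ :=
    fun a => (∏ j, p j ^ (a.1 j : ℕ)) * X i ^ (a.2 : ℕ)
  let T : ((Fin d → Fin (e + 1)) × Fin (e + 1) → ℝ) →ₗ[ℝ] MvPolynomial (Fin d) ℝ :=
    Fintype.linearCombination ℝ q
  let L : ((Fin d → Fin (e + 1)) × Fin (e + 1) → ℝ) →ₗ[ℝ] ((Fin d → Fin (D + 1)) → ℝ) :=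
    (LinearMap.pi fun γ : Fin d → Fin (D + 1) =>
      lcoeff ℝ (Finsupp.equivFunOnFinite.symm fun j => (γ j : ℕ))) ∘ₗ T
  have hlt : Module.finrank ℝ ((Fin d → Fin (D + 1)) → ℝ) <
      Module.finrank ℝ ((Fin d → Fin (e + 1)) × Fin (e + 1) → ℝ) := by
    simp only [Module.finrank_fintype_fun_eq_card, Fintype.card_fun, Fintype.card_fin,
      Fintype.card_prod]
    have h1 : D + 1 ≤ (d * K + 1) * (e + 1) := by rw [hD]; nlinarith [Nat.zero_le (d * K)]
    calc (D + 1) ^ d ≤ ((d * K + 1) * (e + 1)) ^ d := Nat.pow_le_pow_left h1 d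
      _ = (e + 1) ^ d * e := by rw [mul_pow, mul_comm]
      _ < (e + 1) ^ d * (e + 1) := by gcongr; omega
  obtain ⟨c, hc, hc0⟩ := (LinearMap.ker L).ne_bot_iff.1 (LinearMap.ker_ne_bot_of_finrank_lt hlt)
  refine ⟨c, hc0, ?_⟩
  have hT : T c = ∑ a, c a • q a := Fintype.linearCombination_apply _ _ _
  change ∑ a, c a • q a = 0
  rw [← hT]
  have hq : ∀ a, (q a).totalDegree ≤ D := fun a => by
    refine (totalDegree_mul _ _).trans (add_le_add ?_ ?_)
    · refine (totalDegree_finsetProd _ _).trans ?_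
      calc ∑ j, (p j ^ (a.1 j : ℕ)).totalDegree ≤ ∑ _j : Fin d, e * K := by
            refine Finset.sum_le_sum fun j _ => (totalDegree_pow _ _).trans ?_
            exact Nat.mul_le_mul (Nat.lt_succ_iff.1 (a.1 j).2) (hp j)
        _ = d * (e * K) := by simp
    · refine (totalDegree_pow _ _).trans ?_
      rw [totalDegree_X, mul_one]
      exact Nat.lt_succ_iff.1 a.2.2
  have hTd : (T c).totalDegree ≤ D := by
    rw [hT]
    refine (totalDegree_finsetSum _ _).trans (Finset.sup_le fun a _ => ?_)
    exact (totalDegree_smul_le _ _).trans (hq a)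
  ext γ
  rw [coeff_zero]
  by_cases hγ : ∀ j, γ j < D + 1
  · have := congrFun hc fun j => ⟨γ j, hγ j⟩
    simp only [L, LinearMap.comp_apply, LinearMap.pi_apply, lcoeff_apply, Pi.zero_apply] at this
    convert this using 2
    ext j; simp
  · push Not at hγ
    obtain ⟨j, hj⟩ := hγ
    refine coeff_eq_zero_of_totalDegree_lt (lt_of_le_of_lt hTd ?_)
    have : j ∈ γ.support := by rw [Finsupp.mem_support_iff]; omega
    exact lt_of_lt_of_le (by omega) (Finset.single_le_sum (fun _ _ => Nat.zero_le _) this)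

/-- An open set contains a product of intervals, and a polynomial that vanishes on a product of
infinite sets is zero. -/
theorem exists_mem_eval_ne_zero {σ : Type*} [Fintype σ] {p : MvPolynomial σ ℝ} (hp : p ≠ 0)
    {U : Set (σ → ℝ)} (hU : IsOpen U) (hne : U.Nonempty) : ∃ w ∈ U, eval w p ≠ 0 := by
  obtain ⟨u, hu⟩ := hne
  obtain ⟨ε, hε, hball⟩ := Metric.isOpen_iff.1 hU u hu
  by_contra! h
  refine hp (funext_set (fun i => Metric.ball (u i) ε)
    (fun i => ?_) fun w hw => ?_)
  · rw [Real.ball_eq_Ioo]; exact Ioo_infinite (by linarith)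
  · rw [map_zero]
    refine h w (hball ?_)
    rw [ball_pi _ hε]
    exact hw

/-- A polynomial map of `ℝᵈ` of bounded degree has boundedly many preimages over a generic
point. -/
theorem exists_forall_card_fiber_le (d K : ℕ) : ∃ b : ℕ, ∀ p : Fin d → MvPolynomial (Fin d) ℝ,
    (∀ j, (p j).totalDegree ≤ K) → ∀ U : Set (Fin d → ℝ), IsOpen U → U.Nonempty →
    ∃ w ∈ U, ∀ t : Finset (Fin d → ℝ), (∀ z ∈ t, ∀ j, eval z (p j) = w j) → t.card ≤ b := by
  refine ⟨((d * K + 1) ^ d) ^ d, fun p hp U hU hne => ?_⟩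
  set e := (d * K + 1) ^ d with he
  choose c hc0 hc using exists_polynomial_relation p hp
  have hβ : ∀ i, ∃ β : Fin (e + 1), ∃ α, c i (α, β) ≠ 0 := fun i => by
    obtain ⟨⟨α, β⟩, h⟩ := Function.ne_iff.1 (hc0 i)
    exact ⟨β, α, h⟩
  choose β hβ using hβ
  -- `C i β` is the coefficient of the β-th power of the i-th coordinate in the i-th relation, as a
  -- polynomial in the values of p. The point w is chosen so that one coefficient of each relation
  -- survives there.
  let C : Fin d → Fin (e + 1) → MvPolynomial (Fin d) ℝ := fun i β =>
    ∑ α : Fin d → Fin (e + 1), monomial (Finsupp.equivFunOnFinite.symm fun j => (α j : ℕ))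
      (c i (α, β))
  have hC : ∀ i, C i (β i) ≠ 0 := fun i => by
    obtain ⟨α, hα⟩ := hβ i
    refine ne_zero_iff.2 ⟨Finsupp.equivFunOnFinite.symm fun j => (α j : ℕ), ?_⟩
    have : ∀ α' : Fin d → Fin (e + 1),
        (Finsupp.equivFunOnFinite.symm fun j => (α' j : ℕ)) =
          Finsupp.equivFunOnFinite.symm (fun j => (α j : ℕ)) ↔ α' = α := fun α' => by
      rw [Equiv.apply_eq_iff_eq]
      exact ⟨fun h => funext fun j => Fin.ext (congrFun h j), fun h => by rw [h]⟩
    simpa [C, coeff_sum, coeff_monomial, this] using hα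
  obtain ⟨w, hwU, hw⟩ := exists_mem_eval_ne_zero
    (Finset.prod_ne_zero_iff.2 fun i (_ : i ∈ Finset.univ) => hC i) hU hne
  refine ⟨w, hwU, fun t ht => ?_⟩
  rw [map_prod] at hw
  have hw' := Finset.prod_ne_zero_iff.1 hw
  -- At w the i-th relation becomes a nonzero univariate polynomial of degree at most e that has the
  -- i-th coordinate of every point of the fibre as a root. The fibre therefore lies in a box of at
  -- most e^d points.
  let Q : Fin d → Polynomial ℝ := fun i =>
    ∑ β : Fin (e + 1), Polynomial.monomial (β : ℕ) (eval w (C i β))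
  have hQ0 : ∀ i, Q i ≠ 0 := fun i h => by
    have := congrArg (fun q => Polynomial.coeff q (β i : ℕ)) h
    simp only [Q, Polynomial.finsetSum_coeff, Polynomial.coeff_monomial, Polynomial.coeff_zero,
      Fin.val_inj, Finset.sum_ite_eq', Finset.mem_univ, if_true] at this
    exact hw' i (Finset.mem_univ i) this
  have hQd : ∀ i, (Q i).natDegree ≤ e := fun i =>
    Polynomial.natDegree_sum_le_of_forall_le _ _ fun β _ =>
      (Polynomial.natDegree_monomial_le _).trans (Nat.lt_succ_iff.1 β.2)
  have hsub : t ⊆ Fintype.piFinset fun i => (Q i).roots.toFinset := fun z hz => by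
    rw [Fintype.mem_piFinset]
    intro i
    rw [Multiset.mem_toFinset, Polynomial.mem_roots (hQ0 i), Polynomial.IsRoot.def]
    have := congrArg (eval z) (hc i)
    rw [map_zero, map_sum, Fintype.sum_prod_type_right] at this
    rw [← this]
    simp only [Q, Polynomial.eval_finsetSum, Polynomial.eval_monomial, C, map_sum, eval_monomial,
      smul_eval, map_mul, map_prod, map_pow, eval_X]
    refine Finset.sum_congr rfl fun β _ => Finset.sum_congr rfl fun α _ => ?_
    rw [mul_assoc]
    congr 2
    rw [Finsupp.prod_fintype _ _ (by simp)]
    exact Finset.prod_congr rfl fun j _ => by rw [ht z hz j]; simp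
  refine (Finset.card_le_card hsub).trans ?_
  rw [Fintype.card_piFinset]
  calc ∏ i, (Q i).roots.toFinset.card ≤ ∏ _i : Fin d, e := by
        refine Finset.prod_le_prod' fun i _ => ?_
        exact (Multiset.toFinset_card_le _).trans ((Polynomial.card_roots' _).trans (hQd i))
    _ = e ^ d := by simp

end Polynomial

/-! ### Taylor approximation -/

section Taylor

variable {E F : Type*} [NormedAddCommGroup E] [NormedSpace ℝ E] [NormedAddCommGroup F]
  [NormedSpace ℝ F]

/-- The Taylor polynomial of order `n` of `f` at `c`. -/
def taylorMap (f : E → F) (n : ℕ) (c : E) (z : E) : F :=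
  ∑ k ∈ Finset.range (n + 1), (k.factorial : ℝ)⁻¹ • iteratedFDeriv ℝ k f c fun _ => z - c

theorem taylorMap_self (f : E → F) (n : ℕ) (c : E) : taylorMap f n c c = f c := by
  rw [taylorMap, Finset.sum_eq_single_of_mem 0 (by simp)]
  · simp
  · intro k _ hk
    have : NeZero k := ⟨hk⟩
    rw [(iteratedFDeriv ℝ k f c).map_coord_zero (0 : Fin k) (by simp), smul_zero]

/-- The Taylor remainder of order `n` is Lipschitz with constant `O(h ^ n)` on a ball of radius
`h`. -/
theorem norm_taylorMap_sub_le [CompleteSpace F] {f : E → F} {n : ℕ} {c : E} {h M : ℝ}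
    (hf : ∀ z ∈ Metric.closedBall c h, ContDiffAt ℝ (n + 1) f z) (hh0 : 0 ≤ h) (hh : h ≤ 1)
    (hM0 : 0 ≤ M)
    (hM : ∀ z ∈ Metric.closedBall c h, ‖iteratedFDeriv ℝ (n + 1) f z‖ ≤ M)
    (hL : ∀ z ∈ Metric.closedBall c h, ∀ z' ∈ Metric.closedBall c h,
      ‖iteratedFDeriv ℝ (n + 1) f z - iteratedFDeriv ℝ (n + 1) f z'‖ ≤ M * ‖z - z'‖)
    {z z' : E} (hz : z ∈ Metric.closedBall c h) (hz' : z' ∈ Metric.closedBall c h) :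
    ‖(taylorMap f n c z - f z) - (taylorMap f n c z' - f z')‖ ≤
      M * (n + 2) * h ^ n * ‖z - z'‖ := by
  let φ : E → ℝ → F := fun y t =>
    (1 - t) ^ n • iteratedFDeriv ℝ (n + 1) f (c + t • (y - c)) fun _ => y - c
  have hmem : ∀ y ∈ Metric.closedBall c h, ∀ t ∈ Icc (0 : ℝ) 1,
      c + t • (y - c) ∈ Metric.closedBall c h := fun y hy t ht => by
    rw [mem_closedBall_iff_norm] at hy ⊢
    rw [add_sub_cancel_left, norm_smul, Real.norm_of_nonneg ht.1]
    nlinarith [ht.2, norm_nonneg (y - c)]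
  have hrem : ∀ y ∈ Metric.closedBall c h,
      taylorMap f n c y - f y = -((n.factorial : ℝ)⁻¹ • ∫ t in (0 : ℝ)..1, φ y t) := fun y hy => by
    have := map_add_eq_sum_add_integral_iteratedFDeriv (x := c) (y := y - c) (n := n) (f := f)
      fun t ht => hf _ (hmem y hy t ht)
    rw [add_sub_cancel] at this
    rw [taylorMap, this]
    simp only [φ]
    abel
  have hcont : ∀ y ∈ Metric.closedBall c h, IntervalIntegrable (φ y) volume 0 1 := fun y hy => by
    refine ContinuousOn.intervalIntegrable ?_
    rw [uIcc_of_le zero_le_one]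
    refine ContinuousOn.smul (by fun_prop) ?_
    have : ContinuousOn (fun t : ℝ => iteratedFDeriv ℝ (n + 1) f (c + t • (y - c))) (Icc 0 1) := by
      intro t ht
      refine ContinuousAt.continuousWithinAt ?_
      have h1 := (hf _ (hmem y hy t ht)).continuousAt_iteratedFDeriv (k := n + 1) (by norm_cast)
      exact h1.comp (f := fun t : ℝ => c + t • (y - c)) (by fun_prop)
    exact ((ContinuousMultilinearMap.apply ℝ (fun _ : Fin (n + 1) => E) F
      (fun _ => y - c)).continuous.comp_continuousOn this)
  rw [hrem z hz, hrem z' hz', neg_sub_neg, ← smul_sub,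
    ← intervalIntegral.integral_sub (hcont z' hz') (hcont z hz), norm_smul]
  -- Passing from z to z' changes the point where the derivative is taken, which costs M h^(n+1) ‖z
  -- - z'‖ by the Lipschitz bound, and its n + 1 equal arguments, which costs M (n+1) h^n ‖z - z'‖.
  -- As h ≤ 1, the total is M (n+2) h^n ‖z - z'‖.
  have hbound : ∀ t ∈ uIoc (0 : ℝ) 1, ‖φ z' t - φ z t‖ ≤ M * (n + 2) * h ^ n * ‖z - z'‖ := by
    intro t ht
    rw [uIoc_of_le zero_le_one] at ht
    have ht' : t ∈ Icc (0 : ℝ) 1 := Ioc_subset_Icc_self ht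
    rw [← smul_sub, norm_smul, Real.norm_of_nonneg (pow_nonneg (by linarith [ht.2]) _)]
    have hle1 : (1 - t) ^ n ≤ 1 := pow_le_one₀ (by linarith [ht.2]) (by linarith [ht.1])
    have hzn := mem_closedBall_iff_norm.1 hz
    have hzn' := mem_closedBall_iff_norm.1 hz'
    set A := iteratedFDeriv ℝ (n + 1) f (c + t • (z - c)) with hA
    set A' := iteratedFDeriv ℝ (n + 1) f (c + t • (z' - c)) with hA'
    have e1 : ‖(A' - A) fun _ => z' - c‖ ≤ M * ‖z - z'‖ * h ^ (n + 1) := by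
      refine ((A' - A).le_opNorm _).trans ?_
      rw [Finset.prod_const, Finset.card_univ, Fintype.card_fin]
      gcongr
      refine (hL _ (hmem z' hz' t ht') _ (hmem z hz t ht')).trans ?_
      gcongr
      rw [add_sub_add_left_eq_sub, ← smul_sub, sub_sub_sub_cancel_right, norm_smul,
        Real.norm_of_nonneg ht'.1, norm_sub_rev]
      exact mul_le_of_le_one_left (norm_nonneg _) ht'.2
    have e2 : ‖(A fun _ => z' - c) - A fun _ => z - c‖ ≤ M * ((n + 1) * h ^ n * ‖z - z'‖) := by
      refine (A.norm_image_sub_le _ _).trans ?_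
      rw [Fintype.card_fin]
      have e3 : ‖(fun _ : Fin (n + 1) => z' - c) - fun _ => z - c‖ = ‖z - z'‖ := by
        rw [show ((fun _ : Fin (n + 1) => z' - c) - fun _ => z - c) = fun _ => z' - z by
          ext; simp, pi_norm_const, norm_sub_rev]
      rw [e3, pi_norm_const, pi_norm_const, Nat.add_sub_cancel]
      have := hM _ (hmem z hz t ht')
      rw [← hA] at this
      have e6 : max ‖z' - c‖ ‖z - c‖ ^ n ≤ h ^ n :=
        pow_le_pow_left₀ (le_max_of_le_left (norm_nonneg _)) (max_le hzn' hzn) n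
      push_cast
      calc ‖A‖ * (n + 1) * max ‖z' - c‖ ‖z - c‖ ^ n * ‖z - z'‖
          ≤ M * (n + 1) * h ^ n * ‖z - z'‖ := by gcongr
        _ = M * ((n + 1) * h ^ n * ‖z - z'‖) := by ring
    have e4 : (A' fun _ => z' - c) - (A fun _ => z - c) =
        ((A' - A) fun _ => z' - c) + ((A fun _ => z' - c) - A fun _ => z - c) := by
      simp
    have e5 : ‖(A' fun _ => z' - c) - (A fun _ => z - c)‖ ≤ M * (n + 2) * h ^ n * ‖z - z'‖ := by
      rw [e4]
      refine (norm_add_le_of_le e1 e2).trans ?_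
      have : h ^ (n + 1) ≤ h ^ n := pow_le_pow_of_le_one hh0 hh (Nat.le_succ n)
      have h6 : M * ‖z - z'‖ * h ^ (n + 1) ≤ M * ‖z - z'‖ * h ^ n := by gcongr
      linarith
    exact (mul_le_of_le_one_left (norm_nonneg _) hle1).trans e5
  have hint := intervalIntegral.norm_integral_le_of_norm_le_const hbound
  rw [sub_zero, abs_one, mul_one] at hint
  have hfac : ‖((n.factorial : ℝ))⁻¹‖ ≤ 1 := by
    rw [norm_inv, Real.norm_natCast]
    exact inv_le_one_of_one_le₀ (by exact_mod_cast n.factorial_pos)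
  exact (mul_le_of_le_one_left (norm_nonneg _) hfac).trans hint

/-- The Taylor polynomial is a polynomial in coordinates. -/
theorem exists_taylorMap_eq_eval {d d' : ℕ} (f : (Fin d → ℝ) → Fin d' → ℝ) (n : ℕ)
    (c : Fin d → ℝ) : ∃ p : Fin d' → MvPolynomial (Fin d) ℝ, (∀ j, (p j).totalDegree ≤ n) ∧
      ∀ z j, taylorMap f n c z j = MvPolynomial.eval z (p j) := by
  let q : ∀ k, Fin d' → MvPolynomial (Fin d) ℝ := fun k j =>
    ∑ r : Fin k → Fin d, MvPolynomial.C (iteratedFDeriv ℝ k f c (fun i => Pi.single (r i) 1) j) *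
      ∏ i, (MvPolynomial.X (r i) - MvPolynomial.C (c (r i)))
  refine ⟨fun j => ∑ k ∈ Finset.range (n + 1), MvPolynomial.C ((k.factorial : ℝ)⁻¹) * q k j,
    fun j => ?_, fun z j => ?_⟩
  · refine (MvPolynomial.totalDegree_finsetSum _ _).trans (Finset.sup_le fun k hk => ?_)
    refine (MvPolynomial.totalDegree_mul _ _).trans ?_
    rw [MvPolynomial.totalDegree_C, zero_add]
    refine (MvPolynomial.totalDegree_finsetSum _ _).trans (Finset.sup_le fun r _ => ?_)
    refine (MvPolynomial.totalDegree_mul _ _).trans ?_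
    rw [MvPolynomial.totalDegree_C, zero_add]
    refine (MvPolynomial.totalDegree_finsetProd _ _).trans ?_
    calc ∑ i, (MvPolynomial.X (r i) - MvPolynomial.C (c (r i)) :
          MvPolynomial (Fin d) ℝ).totalDegree ≤ ∑ _i : Fin k, 1 := by
          refine Finset.sum_le_sum fun i _ => (MvPolynomial.totalDegree_sub _ _).trans ?_
          rw [MvPolynomial.totalDegree_X, MvPolynomial.totalDegree_C]
          simp
      _ ≤ n := by simpa using Nat.lt_succ_iff.1 (Finset.mem_range.1 hk)
  · simp only [taylorMap, Finset.sum_apply, Pi.smul_apply, smul_eq_mul, map_sum, map_mul,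
      MvPolynomial.eval_C, q, map_prod, map_sub, MvPolynomial.eval_X]
    refine Finset.sum_congr rfl fun k _ => ?_
    congr 1
    have hz : z - c = ∑ a, (z a - c a) • (Pi.single a (1 : ℝ) : Fin d → ℝ) := by
      ext i; simp [Finset.sum_apply, Pi.single_apply]
    rw [hz, (iteratedFDeriv ℝ k f c).map_sum, Finset.sum_apply]
    refine Finset.sum_congr rfl fun r _ => ?_
    rw [(iteratedFDeriv ℝ k f c).map_smul_univ, Pi.smul_apply, smul_eq_mul, mul_comm]

end Taylor

/-! ### Counting nondegenerate preimages of smooth maps -/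

section Counting

variable {d : ℕ}

/-- A lower bound for a linear map in terms of its determinant. -/
theorem exists_det_mul_norm_le (d : ℕ) (M : ℝ) : ∃ C ≥ 1, ∀ T : (Fin d → ℝ) →L[ℝ] (Fin d → ℝ),
    ‖T‖ ≤ M → ∀ v, |T.det| * ‖v‖ ≤ C * ‖T v‖ := by
  -- The adjugate satisfies adj(T) T = det T, and it is bounded on the ball of radius M by
  -- compactness.
  let adj : ((Fin d → ℝ) →L[ℝ] (Fin d → ℝ)) → ((Fin d → ℝ) →L[ℝ] (Fin d → ℝ)) := fun T =>
    LinearMap.toContinuousLinearMap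
      (Matrix.toLin' (LinearMap.toMatrix' (T : (Fin d → ℝ) →ₗ[ℝ] (Fin d → ℝ))).adjugate)
  have hadj : Continuous adj := by
    have h1 : Continuous fun T : (Fin d → ℝ) →L[ℝ] (Fin d → ℝ) =>
        LinearMap.toMatrix' (T : (Fin d → ℝ) →ₗ[ℝ] (Fin d → ℝ)) := by
      refine continuous_matrix fun i j => ?_
      simp only [LinearMap.toMatrix'_apply]
      exact (continuous_apply i).comp (ContinuousLinearMap.apply ℝ (Fin d → ℝ) _).continuous
    have h2 : Continuous fun A : Matrix (Fin d) (Fin d) ℝ =>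
        LinearMap.toContinuousLinearMap (Matrix.toLin' A) :=
      LinearMap.continuous_of_finiteDimensional
        ((LinearMap.toContinuousLinearMap.toLinearMap ∘ₗ Matrix.toLin'.toLinearMap :
          Matrix (Fin d) (Fin d) ℝ →ₗ[ℝ] ((Fin d → ℝ) →L[ℝ] (Fin d → ℝ))))
    exact h2.comp h1.matrix_adjugate
  obtain ⟨C, hC⟩ := (isCompact_closedBall (0 : (Fin d → ℝ) →L[ℝ] (Fin d → ℝ)) M).exists_bound_of_continuousOn
    hadj.continuousOn
  refine ⟨max C 1, le_max_right _ _, fun T hT v => ?_⟩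
  have key : adj T (T v) = T.det • v := by
    have : T v = Matrix.toLin' (LinearMap.toMatrix' (T : (Fin d → ℝ) →ₗ[ℝ] (Fin d → ℝ))) v := by
      rw [Matrix.toLin'_toMatrix']; rfl
    rw [this]
    simp only [adj, LinearMap.coe_toContinuousLinearMap', Matrix.toLin'_apply, Matrix.mulVec_mulVec,
      Matrix.adjugate_mul, Matrix.smul_mulVec, Matrix.one_mulVec, LinearMap.det_toMatrix']
  have := (adj T).le_opNorm (T v)
  rw [key, norm_smul, Real.norm_eq_abs] at this
  refine this.trans ?_
  gcongr
  exact (hC T (by simpa using hT)).trans (le_max_left _ _)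

/-- If a smooth map is `C¹`-close to a polynomial map near nondegenerate points of one of its
fibres, then there are boundedly many of these. -/
theorem card_le_of_approx_polynomial {K b : ℕ}
    (hb : ∀ p : Fin d → MvPolynomial (Fin d) ℝ,
      (∀ j, (p j).totalDegree ≤ K) → ∀ U : Set (Fin d → ℝ), IsOpen U → U.Nonempty →
      ∃ w ∈ U, ∀ t : Finset (Fin d → ℝ), (∀ z ∈ t, ∀ j, MvPolynomial.eval z (p j) = w j) →
        t.card ≤ b)
    {f P : (Fin d → ℝ) → Fin d → ℝ} {p : Fin d → MvPolynomial (Fin d) ℝ}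
    (hp : ∀ j, (p j).totalDegree ≤ K) (hP : ∀ z j, P z j = MvPolynomial.eval z (p j))
    {l r : ℝ} (hl : 0 < l) (hr : 0 < r) {u : Fin d → ℝ} {t : Finset (Fin d → ℝ)}
    (A : (Fin d → ℝ) → (Fin d → ℝ) →L[ℝ] (Fin d → ℝ))
    (hA : ∀ z ∈ t, ∀ v, l * ‖v‖ ≤ ‖A z v‖) (hu : ∀ z ∈ t, f z = u)
    (hfA : ∀ z ∈ t, ∀ x ∈ Metric.closedBall z (2 * r), ∀ y ∈ Metric.closedBall z (2 * r),
      ‖f x - f y - A z (x - y)‖ ≤ l / 8 * ‖x - y‖)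
    (hPf : ∀ z ∈ t, ∀ x ∈ Metric.closedBall z r, ∀ y ∈ Metric.closedBall z r,
      ‖(P x - f x) - (P y - f y)‖ ≤ l / 8 * ‖x - y‖)
    (hPf0 : ∀ z ∈ t, ‖P z - f z‖ ≤ l * r / 4) : t.card ≤ b := by
  -- A generic value w of P is chosen close to u. Near every z in t the map P is a perturbation of
  -- the invertible A z by at most l/4, so it attains w within distance r of z. Thus the fibre of P
  -- over w is at least as large as t, once these solutions are known to be distinct.
  obtain ⟨w, hw, hcard⟩ := hb p hp (Metric.ball u (l * r / 4)) Metric.isOpen_ball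
    ⟨u, Metric.mem_ball_self (by positivity)⟩
  have hpre : ∀ z ∈ t, ∃ ζ ∈ Metric.closedBall z r, P ζ = w := by
    intro z hz
    have hinj : Function.Injective (A z) := by
      rw [injective_iff_map_eq_zero]
      intro v hv
      have := hA z hz v
      rw [hv, norm_zero] at this
      exact norm_le_zero_iff.1 (by nlinarith [norm_nonneg v])
    let e := LinearEquiv.ofInjectiveEndo (A z : (Fin d → ℝ) →ₗ[ℝ] (Fin d → ℝ)) hinj
    have he : ∀ y, A z (e.symm y) = y := fun y => e.apply_symm_apply y
    let g : (A z).NonlinearRightInverse :=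
      { toFun := e.symm
        nnnorm := ⟨l⁻¹, by positivity⟩
        bound' := fun y => by
          have := hA z hz (e.symm y)
          rw [he] at this
          change ‖e.symm y‖ ≤ l⁻¹ * ‖y‖
          rw [inv_mul_eq_div, le_div_iff₀ hl]
          linarith
        right_inv' := he }
    have happ : ApproximatesLinearOn P (A z) (Metric.closedBall z r) ⟨l / 4, by positivity⟩ := by
      intro x hx y hy
      have hsub : Metric.closedBall z r ⊆ Metric.closedBall z (2 * r) :=
        Metric.closedBall_subset_closedBall (by linarith)
      have h1 := hfA z hz x (hsub hx) y (hsub hy)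
      have h2 := hPf z hz x hx y hy
      have : P x - P y - A z (x - y) =
          (f x - f y - A z (x - y)) + ((P x - f x) - (P y - f y)) := by abel
      rw [this]
      refine (norm_add_le_of_le h1 h2).trans (le_of_eq ?_)
      change _ = l / 4 * ‖x - y‖
      ring
    obtain ⟨ζ, hζ, hPζ⟩ := happ.surjOn_closedBall_of_nonlinearRightInverse g hr.le Subset.rfl
      (show w ∈ _ by
        rw [mem_closedBall_iff_norm]
        change ‖w - P z‖ ≤ ((l⁻¹)⁻¹ - l / 4) * r
        rw [inv_inv]
        have h1 := (mem_ball_iff_norm.1 hw).le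
        have h2 := hPf0 z hz
        rw [hu z hz, norm_sub_rev] at h2
        have : w - P z = (w - u) + (u - P z) := by abel
        rw [this]
        refine (norm_add_le_of_le h1 h2).trans ?_
        nlinarith [mul_pos hl hr])
    exact ⟨ζ, hζ, hPζ⟩
  choose! ζ hζ hPζ using hpre
  -- If two points of t shared a solution they would be within 2r of each other, where f is
  -- injective; but f takes the same value u at both.
  have hinj : Set.InjOn ζ t := by
    intro z hz z' hz' hzz
    by_contra hne
    have hdist : ‖z' - z‖ ≤ 2 * r := by
      have h1 := mem_closedBall_iff_norm.1 (hζ z hz)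
      have h2 := mem_closedBall_iff_norm.1 (hζ z' hz')
      rw [← hzz, norm_sub_rev] at h2
      have : z' - z = (z' - ζ z) + (ζ z - z) := by abel
      rw [this]
      exact (norm_add_le_of_le h2 h1).trans (by linarith)
    have h1 := hfA z hz z' (mem_closedBall_iff_norm.2 hdist) z
      (Metric.mem_closedBall_self (by linarith))
    rw [hu z hz, hu z' hz', sub_self, zero_sub, norm_neg] at h1
    have h2 := hA z hz (z' - z)
    have h3 : 0 < ‖z' - z‖ := norm_pos_iff.2 (sub_ne_zero.2 (Ne.symm hne))
    nlinarith [mul_pos hl h3]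
  rw [← Finset.card_image_of_injOn hinj]
  refine hcard _ fun x hx j => ?_
  obtain ⟨z, hz, rfl⟩ := Finset.mem_image.1 hx
  rw [← hP, hPζ z hz]

/-- A finite set in a cube has few points if it has few points in each small cube. -/
theorem card_le_of_card_cell_le {z₀ : Fin d → ℝ} {ρ h : ℝ} (hρ : 0 ≤ ρ) (hh : 0 < h) (hh1 : h ≤ 1)
    {b : ℕ} {t : Finset (Fin d → ℝ)} (ht : ∀ z ∈ t, z ∈ Metric.closedBall z₀ ρ)
    (hcell : ∀ s ⊆ t, (∀ z ∈ s, ∀ z' ∈ s, ‖z - z'‖ ≤ h) → s.card ≤ b) :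
    (t.card : ℝ) ≤ b * ((2 * ρ + 2) / h) ^ d := by
  let q : (Fin d → ℝ) → Fin d → ℤ := fun z i => ⌊z i / h⌋
  have h1 : t.card ≤ b * (t.image q).card := by
    refine Finset.card_le_mul_card_image _ _ fun a _ => hcell _ (Finset.filter_subset _ _) ?_
    intro z hz z' hz'
    rw [pi_norm_le_iff_of_nonneg hh.le]
    intro i
    have e1 := congrFun (Finset.mem_filter.1 hz).2 i
    have e2 := congrFun (Finset.mem_filter.1 hz').2 i
    have := Int.abs_sub_lt_one_of_floor_eq_floor (e1.trans e2.symm)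
    rw [← sub_div, abs_div, abs_of_pos hh, div_lt_one hh] at this
    exact this.le
  have h2 : t.image q ⊆ Fintype.piFinset fun i =>
      Finset.Icc ⌊(z₀ i - ρ) / h⌋ ⌊(z₀ i + ρ) / h⌋ := by
    intro a ha
    obtain ⟨z, hz, rfl⟩ := Finset.mem_image.1 ha
    rw [Fintype.mem_piFinset]
    intro i
    have h3 := (norm_le_pi_norm (z - z₀) i).trans (mem_closedBall_iff_norm.1 (ht z hz))
    rw [Pi.sub_apply, Real.norm_eq_abs, abs_le] at h3
    rw [Finset.mem_Icc]
    constructor <;> refine Int.floor_le_floor ?_ <;> gcongr <;> linarith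
  have h3 : ((t.image q).card : ℝ) ≤ ((2 * ρ + 2) / h) ^ d := by
    have h4 : ((t.image q).card : ℝ) ≤
        ∏ i : Fin d, ((Finset.Icc ⌊(z₀ i - ρ) / h⌋ ⌊(z₀ i + ρ) / h⌋).card : ℝ) := by
      rw [← Nat.cast_prod, ← Fintype.card_piFinset]
      exact_mod_cast Finset.card_le_card h2
    refine h4.trans ?_
    calc _ ≤ ∏ _i : Fin d, (2 * ρ + 2) / h := by
          refine Finset.prod_le_prod (fun _ _ => Nat.cast_nonneg _) fun i _ => ?_
          have hle : ⌊(z₀ i - ρ) / h⌋ ≤ ⌊(z₀ i + ρ) / h⌋ := Int.floor_le_floor (by gcongr; linarith)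
          have e3 : (((Finset.Icc ⌊(z₀ i - ρ) / h⌋ ⌊(z₀ i + ρ) / h⌋).card : ℤ) : ℝ) =
              ⌊(z₀ i + ρ) / h⌋ + 1 - ⌊(z₀ i - ρ) / h⌋ := by
            rw [Int.card_Icc, Int.toNat_of_nonneg (by omega)]
            push_cast; ring
          rw [Int.cast_natCast] at e3
          rw [e3]
          have e4 := Int.floor_le ((z₀ i + ρ) / h)
          have e5 := Int.sub_one_lt_floor ((z₀ i - ρ) / h)
          have e6 : (2 * ρ + 2) / h = (z₀ i + ρ) / h - (z₀ i - ρ) / h + 2 / h := by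
            field_simp; ring
          have e7 : 2 ≤ 2 / h := by rw [le_div_iff₀ hh]; linarith
          linarith
      _ = _ := by rw [Finset.prod_const, Finset.card_univ, Fintype.card_fin]
  calc (t.card : ℝ) ≤ b * (t.image q).card := by exact_mod_cast h1
    _ ≤ _ := by gcongr

/-- A smooth map has at most `C ε ^ (-δ)` preimages of any point at which the Jacobian determinant
is at least `ε`. -/
theorem exists_card_fiber_le {f : (Fin d → ℝ) → Fin d → ℝ} {Ω : Set (Fin d → ℝ)} (hΩ : IsOpen Ω)
    (hf : ContDiffOn ℝ ∞ f Ω) {z₀ : Fin d → ℝ} {ρ R : ℝ} (hρ : 0 ≤ ρ) (hρR : ρ < R)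
    (hR : Metric.closedBall z₀ R ⊆ Ω) {δ : ℝ} (hδ : 0 < δ) :
    ∃ C : ℝ, 0 ≤ C ∧ ∀ ε : ℝ, 0 < ε → ε ≤ 1 → ∀ (u : Fin d → ℝ) (t : Finset (Fin d → ℝ)),
      (∀ z ∈ t, z ∈ Metric.closedBall z₀ ρ ∧ f z = u ∧ ε ≤ |(fderiv ℝ f z).det|) →
      (t.card : ℝ) ≤ C * ε ^ (-δ) := by
  -- K is the order of the Taylor polynomial. The final count is of size ε^(-2d/K), which explains
  -- the condition 2d/δ ≤ K.
  obtain ⟨K, hK2, hKδ⟩ : ∃ K : ℕ, 2 ≤ K ∧ 2 * d / δ ≤ K := by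
    obtain ⟨K, hK⟩ := exists_nat_ge (2 * d / δ)
    exact ⟨max K 2, le_max_right _ _, hK.trans (by exact_mod_cast le_max_left _ _)⟩
  obtain ⟨b, hb⟩ := exists_forall_card_fiber_le d K
  have hfat : ∀ z ∈ Metric.closedBall z₀ R, ∀ j : ℕ, ContDiffAt ℝ j f z := fun z hz j =>
    ((hf z (hR hz)).contDiffAt (hΩ.mem_nhds (hR hz))).of_le (by exact_mod_cast le_top)
  have hbd : ∀ j : ℕ, ∃ M, ∀ z ∈ Metric.closedBall z₀ R, ‖iteratedFDeriv ℝ j f z‖ ≤ M := fun j => by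
    refine (isCompact_closedBall z₀ R).exists_bound_of_continuousOn fun z hz => ?_
    exact ((hfat z hz j).continuousAt_iteratedFDeriv (k := j) le_rfl).continuousWithinAt
  obtain ⟨M, hM1, hMb⟩ : ∃ M ≥ (1 : ℝ), ∀ z ∈ Metric.closedBall z₀ R,
      ‖iteratedFDeriv ℝ 1 f z‖ ≤ M ∧ ‖iteratedFDeriv ℝ 2 f z‖ ≤ M ∧
      ‖iteratedFDeriv ℝ (K + 1) f z‖ ≤ M ∧ ‖iteratedFDeriv ℝ (K + 2) f z‖ ≤ M := by
    obtain ⟨M1, h1⟩ := hbd 1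
    obtain ⟨M2, h2⟩ := hbd 2
    obtain ⟨M3, h3⟩ := hbd (K + 1)
    obtain ⟨M4, h4⟩ := hbd (K + 2)
    refine ⟨max 1 (max (max M1 M2) (max M3 M4)), le_max_left _ _, fun z hz => ⟨?_, ?_, ?_, ?_⟩⟩
    · exact (h1 z hz).trans (by simp)
    · exact (h2 z hz).trans (by simp)
    · exact (h3 z hz).trans (by simp)
    · exact (h4 z hz).trans (by simp)
  have hlip : ∀ j : ℕ, (∀ z ∈ Metric.closedBall z₀ R, ‖iteratedFDeriv ℝ (j + 1) f z‖ ≤ M) →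
      ∀ x ∈ Metric.closedBall z₀ R, ∀ y ∈ Metric.closedBall z₀ R,
      ‖iteratedFDeriv ℝ j f x - iteratedFDeriv ℝ j f y‖ ≤ M * ‖x - y‖ := fun j hj x hx y hy => by
    refine (convex_closedBall z₀ R).norm_image_sub_le_of_norm_fderiv_le (𝕜 := ℝ) (fun z hz => ?_)
      (fun z hz => ?_) hy hx
    · exact (hfat z hz (j + 1)).differentiableAt_iteratedFDeriv (by norm_cast; omega)
    · rw [norm_fderiv_iteratedFDeriv]; exact hj z hz
  have hlip1 : ∀ x ∈ Metric.closedBall z₀ R, ∀ y ∈ Metric.closedBall z₀ R,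
      ‖fderiv ℝ f x - fderiv ℝ f y‖ ≤ M * ‖x - y‖ := fun x hx y hy => by
    refine (convex_closedBall z₀ R).norm_image_sub_le_of_norm_fderiv_le (𝕜 := ℝ) (fun z hz => ?_)
      (fun z hz => ?_) hy hx
    · exact ((hfat z hz 2).fderiv_right (m := 1) (by norm_num)).differentiableAt (by norm_num)
    · have := (hMb z hz).2.1
      rwa [show (2 : ℕ) = 1 + 1 from rfl, ← norm_iteratedFDeriv_fderiv,
        show (1 : ℕ) = 0 + 1 from rfl, ← norm_iteratedFDeriv_fderiv, norm_iteratedFDeriv_zero]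
        at this
  obtain ⟨C₀, hC₀, hinv⟩ := exists_det_mul_norm_le d M
  set G : ℝ := 64 * M ^ 2 * (K + 2) * 2 ^ K with hG
  have hG1 : 0 < G := by positivity
  -- η is a small constant independent of ε: the bounds by 1 and R - ρ keep all the balls used below
  -- inside the ball of radius R, and η G ≤ 1 makes the Taylor error small enough.
  obtain ⟨η, hη0, hη1, hη2, hη3⟩ : ∃ η : ℝ, 0 < η ∧ 2 * η ≤ 1 ∧ 2 * η ≤ R - ρ ∧ η * G ≤ 1 := by
    refine ⟨min (min (1 / 2) ((R - ρ) / 2)) (1 / G), ?_, ?_, ?_, ?_⟩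
    · have : 0 < R - ρ := by linarith
      positivity
    · have := (min_le_left (min (1 / 2) ((R - ρ) / 2)) (1 / G)).trans (min_le_left _ _)
      linarith
    · have := (min_le_left (min (1 / 2) ((R - ρ) / 2)) (1 / G)).trans (min_le_right _ _)
      linarith
    · have := min_le_right (min (1 / 2) ((R - ρ) / 2)) (1 / G)
      rwa [le_div_iff₀ hG1] at this
  have hKpos : (0 : ℝ) < K := by exact_mod_cast (by omega : 0 < K)
  refine ⟨b * ((2 * ρ + 2) / η) ^ d * C₀ ^ δ, by positivity, fun ε hε hε1 u t ht => ?_⟩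
  -- At the points counted, the derivative expands lengths by at least l. With cells of size h = η
  -- l^(2/K) the Taylor error is of order h^K = η^K l². It is compared with l r / 4, where r is
  -- proportional to l, so the two match. The number of cells is of order h^(-d), that is l^(-2d/K).
  set l := ε / C₀ with hl
  have hl0 : 0 < l := by positivity
  have hl1 : l ≤ 1 := by rw [hl, div_le_one (by linarith)]; linarith
  set h := η * l ^ (2 / K : ℝ) with hh
  have hh0 : 0 < h := by positivity
  have hlK : l ^ (2 / K : ℝ) ≤ 1 := Real.rpow_le_one hl0.le hl1 (by positivity)
  have hhη : h ≤ η := mul_le_of_le_one_right hη0.le hlK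
  have hlh : l ≤ l ^ (2 / K : ℝ) := by
    conv_lhs => rw [← Real.rpow_one l]
    refine Real.rpow_le_rpow_of_exponent_ge hl0 hl1 ?_
    rw [div_le_one hKpos]
    exact_mod_cast hK2
  have hhK : h ^ K = η ^ K * l ^ 2 := by
    rw [hh, mul_pow, ← Real.rpow_natCast (l ^ (2 / K : ℝ)) K, ← Real.rpow_mul hl0.le,
      div_mul_cancel₀ _ hKpos.ne']
    norm_num
  set r := η / (16 * M) * l with hr
  have hr0 : 0 < r := by positivity
  have hrh : r ≤ h := by
    rw [hr, hh]
    have : η / (16 * M) ≤ η := div_le_self hη0.le (by linarith)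
    gcongr
  have hcard := card_le_of_card_cell_le hρ hh0 (by linarith) (fun z hz => (ht z hz).1)
    (b := b) (t := t) fun s hst hs => by
    rcases s.eq_empty_or_nonempty with rfl | ⟨c, hc⟩
    · simp
    have hcρ := (ht c (hst hc)).1
    have hballR : ∀ z ∈ Metric.closedBall z₀ ρ, ∀ a ≤ R - ρ,
        Metric.closedBall z a ⊆ Metric.closedBall z₀ R := fun z hz a ha =>
      Metric.closedBall_subset_closedBall' (by rw [Metric.mem_closedBall] at hz; linarith)
    have h2hR := hballR c hcρ (2 * h) (by linarith)
    obtain ⟨p, hp, hpe⟩ := exists_taylorMap_eq_eval f K c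
    have htay : ∀ x ∈ Metric.closedBall c (2 * h), ∀ y ∈ Metric.closedBall c (2 * h),
        ‖(taylorMap f K c x - f x) - (taylorMap f K c y - f y)‖ ≤
          M * (K + 2) * (2 * h) ^ K * ‖x - y‖ := fun x hx y hy =>
      norm_taylorMap_sub_le (fun z hz => by exact_mod_cast hfat z (h2hR hz) (K + 1))
        (by linarith) (by linarith) (by linarith) (fun z hz => (hMb z (h2hR hz)).2.2.1)
        (fun z hz z' hz' => hlip (K + 1) (fun z hz => (hMb z hz).2.2.2) z (h2hR hz) z' (h2hR hz'))
        hx hy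
    have hsmall : M * (K + 2) * (2 * h) ^ K ≤ l * r / 4 := by
      rw [mul_pow, hhK, hr]
      have e1 : η ^ K ≤ η ^ 2 := pow_le_pow_of_le_one hη0.le (by linarith) hK2
      have e2 : M * (K + 2) * (2 ^ K * (η ^ K * l ^ 2)) ≤
          M * (K + 2) * (2 ^ K * (η ^ 2 * l ^ 2)) := by gcongr
      refine e2.trans ?_
      have e3 : l * (η / (16 * M) * l) / 4 = η * l ^ 2 / (64 * M) := by field_simp; ring
      rw [e3, le_div_iff₀ (by linarith)]
      calc M * (K + 2) * (2 ^ K * (η ^ 2 * l ^ 2)) * (64 * M) = (η * G) * (η * l ^ 2) := by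
            rw [hG]; ring
        _ ≤ 1 * (η * l ^ 2) := by gcongr
        _ = η * l ^ 2 := one_mul _
    have hr2 : l * r / 4 ≤ l / 8 := by
      have : r ≤ 1 / 2 := by linarith
      nlinarith
    have hsub : ∀ z ∈ s, Metric.closedBall z r ⊆ Metric.closedBall c (2 * h) := fun z hz =>
      Metric.closedBall_subset_closedBall' (by
        rw [dist_eq_norm]
        have := hs z hz c hc
        linarith)
    refine card_le_of_approx_polynomial hb hp hpe hl0 hr0 (u := u) (fderiv ℝ f)
      (fun z hz v => ?_) (fun z hz => (ht z (hst hz)).2.1) (fun z hz x hx y hy => ?_)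
      (fun z hz x hx y hy => ?_) (fun z hz => ?_)
    · have hzR := hballR z (ht z (hst hz)).1 0 (by linarith) (Metric.mem_closedBall_self le_rfl)
      have e1 := hinv (fderiv ℝ f z) (by
        have := (hMb z hzR).1
        rwa [show (1 : ℕ) = 0 + 1 from rfl, ← norm_iteratedFDeriv_fderiv, norm_iteratedFDeriv_zero]
          at this) v
      have e2 := (ht z (hst hz)).2.2
      rw [hl, div_mul_eq_mul_div, div_le_iff₀ (by linarith)]
      calc ε * ‖v‖ ≤ |(fderiv ℝ f z).det| * ‖v‖ := by gcongr
        _ ≤ _ := by linarith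
    · have hz2 := hballR z (ht z (hst hz)).1 (2 * r) (by linarith)
      have hzR := hz2 (Metric.mem_closedBall_self (by linarith))
      refine (convex_closedBall z (2 * r)).norm_image_sub_le_of_norm_fderiv_le' (𝕜 := ℝ)
        (fun x hx => (hfat x (hz2 hx) 1).differentiableAt (by norm_num)) (fun x hx => ?_) hy hx
      refine (hlip1 x (hz2 hx) z hzR).trans ?_
      calc M * ‖x - z‖ ≤ M * (2 * r) := by gcongr; exact mem_closedBall_iff_norm.1 hx
        _ = η * (l / 8) := by rw [hr]; field_simp; ring
        _ ≤ l / 8 := mul_le_of_le_one_left (by linarith) (by linarith)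
    · refine (htay x (hsub z hz hx) y (hsub z hz hy)).trans ?_
      have := hsmall.trans hr2
      gcongr
    · have e1 := htay z (hsub z hz (Metric.mem_closedBall_self hr0.le)) c
        (Metric.mem_closedBall_self (by linarith))
      rw [taylorMap_self, sub_self, sub_zero] at e1
      refine e1.trans ?_
      have e2 : ‖z - c‖ ≤ 1 := (hs z hz c hc).trans (by linarith)
      have e3 : 0 ≤ M * (K + 2) * (2 * h) ^ K := by positivity
      nlinarith
  refine hcard.trans ?_
  have e1 : ((2 * ρ + 2) / h) ^ d = ((2 * ρ + 2) / η) ^ d * l ^ (-(2 * d / K) : ℝ) := by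
    rw [hh, ← div_div, div_pow _ (l ^ (2 / K : ℝ)), Real.rpow_neg hl0.le, ← div_eq_mul_inv]
    congr 1
    rw [← Real.rpow_natCast, ← Real.rpow_mul hl0.le]
    congr 1
    ring
  rw [e1, mul_assoc, mul_assoc]
  have e2 : l ^ (-(2 * d / K) : ℝ) ≤ l ^ (-δ) := by
    refine Real.rpow_le_rpow_of_exponent_ge hl0 hl1 (neg_le_neg ?_)
    rw [div_le_iff₀ hδ] at hKδ
    rw [div_le_iff₀ hKpos]
    linarith
  have e3 : l ^ (-δ) = C₀ ^ δ * ε ^ (-δ) := by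
    rw [hl, Real.div_rpow hε.le (by linarith), Real.rpow_neg (by linarith : (0 : ℝ) ≤ C₀),
      div_inv_eq_mul, mul_comm]
  rw [← e3]
  gcongr

end Counting

/-! ### Change of variables with multiplicities -/

section Multiplicity


/-- Change of variables for a map whose fibres have at most `T` points. -/
theorem setLIntegral_det_mul_comp_le {E : Type*} [NormedAddCommGroup E] [NormedSpace ℝ E]
    [FiniteDimensional ℝ E] [MeasurableSpace E] [BorelSpace E] (μ : Measure E)
    [μ.IsAddHaarMeasure] {f : E → E} {f' : E → E →L[ℝ] E} {S : Set E} (hS : MeasurableSet S)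
    (hf : ∀ z ∈ S, HasFDerivWithinAt f (f' z) S z) (hdet : ∀ z ∈ S, (f' z).det ≠ 0) {T : ℝ}
    (hT : ∀ (u : E) (t : Finset E), (∀ z ∈ t, z ∈ S ∧ f z = u) → (t.card : ℝ) ≤ T)
    {h : E → ℝ≥0∞} (hh : Measurable h) :
    ∫⁻ z in S, ENNReal.ofReal |(f' z).det| * h (f z) ∂μ ≤ ENNReal.ofReal T * ∫⁻ u, h u ∂μ := by
  -- A map that approximates an invertible linear map to within half of the reciprocal norm of its
  -- inverse is injective. Hence S splits into countably many pieces on which f is injective and the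
  -- usual change of variables applies.
  have hδ : ∀ A : E →L[ℝ] E, ∃ δ : ℝ≥0, δ ≠ 0 ∧ (A.det ≠ 0 → ∀ (g : E → E) (s : Set E),
      ApproximatesLinearOn g A s δ → InjOn g s) := by
    intro A
    by_cases hA : A.det = 0
    · exact ⟨1, one_ne_zero, fun h => absurd hA h⟩
    let B := A.toContinuousLinearEquivOfDetNeZero hA
    rcases subsingleton_or_nontrivial E with hE | hE
    · exact ⟨1, one_ne_zero, fun _ g s _ => fun x _ y _ _ => Subsingleton.elim x y⟩
    have hpos : 0 < ‖(B.symm : E →L[ℝ] E)‖₊⁻¹ := by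
      rw [inv_pos]; exact B.nnnorm_symm_pos
    refine ⟨‖(B.symm : E →L[ℝ] E)‖₊⁻¹ / 2, (half_pos hpos).ne', fun _ g s hg => ?_⟩
    have hg' : ApproximatesLinearOn g (B : E →L[ℝ] E) s (‖(B.symm : E →L[ℝ] E)‖₊⁻¹ / 2) := hg
    exact hg'.injOn (Or.inr (half_lt_self hpos))
  choose δ hδ0 hδ using hδ
  obtain ⟨t, A, hdisj, hmeas, hcover, happ, hA⟩ :=
    exists_partition_approximatesLinearOn_of_hasFDerivWithinAt f S f' hf δ hδ0
  rcases S.eq_empty_or_nonempty with rfl | hne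
  · simp
  have hinj : ∀ n, InjOn f (S ∩ t n) := fun n => by
    obtain ⟨y, hy, hAy⟩ := hA hne n
    exact hδ (A n) (by rw [hAy]; exact hdet y hy) f _ (happ n)
  have hSn : ∀ n, MeasurableSet (S ∩ t n) := fun n => hS.inter (hmeas n)
  have hfn : ∀ n, ∀ z ∈ S ∩ t n, HasFDerivWithinAt f (f' z) (S ∩ t n) z := fun n z hz =>
    (hf z hz.1).mono inter_subset_left
  have himg : ∀ n, MeasurableSet (f '' (S ∩ t n)) := fun n =>
    measurable_image_of_fderivWithin (hSn n) (hfn n) (hinj n)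
  have hSU : S = ⋃ n, S ∩ t n := by rw [← inter_iUnion, inter_eq_left.2 hcover]
  have hd : Pairwise (Function.onFun Disjoint fun n => S ∩ t n) := fun i j hij =>
    (hdisj hij).mono inter_subset_right inter_subset_right
  calc ∫⁻ z in S, ENNReal.ofReal |(f' z).det| * h (f z) ∂μ
      = ∑' n, ∫⁻ z in S ∩ t n, ENNReal.ofReal |(f' z).det| * h (f z) ∂μ := by
        conv_lhs => rw [hSU]
        exact lintegral_iUnion hSn hd _
    _ = ∑' n, ∫⁻ u, (f '' (S ∩ t n)).indicator h u ∂μ := by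
        refine tsum_congr fun n => ?_
        rw [lintegral_indicator (himg n),
          lintegral_image_eq_lintegral_abs_det_fderiv_mul μ (hSn n) (hfn n) (hinj n)]
    _ = ∫⁻ u, ∑' n, (f '' (S ∩ t n)).indicator h u ∂μ :=
        (lintegral_tsum fun n => (hh.indicator (himg n)).aemeasurable).symm
    _ ≤ ∫⁻ u, ENNReal.ofReal T * h u ∂μ := by
        refine lintegral_mono fun u => ?_
        -- The sum of the indicators counts the pieces whose image contains u. Disjoint pieces give
        -- different preimages of u, so at most T of them occur.
        rw [ENNReal.tsum_eq_iSup_sum]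
        refine iSup_le fun F => ?_
        classical
        simp only [indicator_apply]
        rw [← Finset.sum_filter, Finset.sum_const, nsmul_eq_mul]
        gcongr
        set G := F.filter fun n => u ∈ f '' (S ∩ t n)
        have hG : ∀ n ∈ G, ∃ z, z ∈ S ∩ t n ∧ f z = u := fun n hn => (Finset.mem_filter.1 hn).2
        choose! z hz hzu using hG
        have hzinj : InjOn z G := fun i hi j hj hij => by
          by_contra hne'
          exact (hdisj hne').le_bot ⟨(hz i hi).2, hij ▸ (hz j hj).2⟩
        have := hT u (G.image z) fun x hx => by
          obtain ⟨n, hn, rfl⟩ := Finset.mem_image.1 hx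
          exact ⟨(hz n hn).1, hzu n hn⟩
        rw [Finset.card_image_of_injOn hzinj] at this
        rw [← ENNReal.ofReal_natCast]
        exact ENNReal.ofReal_le_ofReal this
    _ = ENNReal.ofReal T * ∫⁻ u, h u ∂μ := lintegral_const_mul _ hh

/-- For a smooth map `f` of `ℝᵈ`, the local push-forward of `|det Df| ^ (1 + q)` has bounded
density. -/
theorem exists_setLIntegral_det_rpow_le {d : ℕ} {f : (Fin d → ℝ) → Fin d → ℝ}
    {Ω : Set (Fin d → ℝ)} (hΩ : IsOpen Ω) (hf : ContDiffOn ℝ ∞ f Ω) {z₀ : Fin d → ℝ} {ρ R : ℝ}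
    (hρ : 0 ≤ ρ) (hρR : ρ < R) (hR : Metric.closedBall z₀ R ⊆ Ω) {q : ℝ} (hq : 0 < q) :
    ∃ C : ℝ≥0, ∀ h : (Fin d → ℝ) → ℝ≥0∞, Measurable h →
      ∫⁻ z in Metric.closedBall z₀ ρ, ENNReal.ofReal (|(fderiv ℝ f z).det| ^ (1 + q)) * h (f z) ≤
        C * ∫⁻ u, h u := by
  obtain ⟨C, hC0, hC⟩ := exists_card_fiber_le hΩ hf hρ hρR hR (half_pos hq)
  have hsub : Metric.closedBall z₀ ρ ⊆ Ω :=
    (Metric.closedBall_subset_closedBall hρR.le).trans hR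
  have hcd : ContinuousOn (fun z => |(fderiv ℝ f z).det|) (Metric.closedBall z₀ ρ) := by
    have h1 : ContinuousOn (fderiv ℝ f) Ω := hf.continuousOn_fderiv_of_isOpen hΩ (by simp)
    exact (ContinuousLinearMap.continuous_det.comp_continuousOn (h1.mono hsub)).abs
  obtain ⟨D, hD1, hD⟩ : ∃ D ≥ (1 : ℝ), ∀ z ∈ Metric.closedBall z₀ ρ, |(fderiv ℝ f z).det| ≤ D := by
    obtain ⟨D, hD⟩ := (isCompact_closedBall z₀ ρ).exists_bound_of_continuousOn hcd
    refine ⟨max D 1, le_max_right _ _, fun z hz => ?_⟩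
    have := hD z hz
    rw [Real.norm_eq_abs, abs_abs] at this
    exact this.trans (le_max_left _ _)
  have hmdet : Measurable fun z => |(fderiv ℝ f z).det| :=
    (ContinuousLinearMap.continuous_det.measurable.comp (measurable_fderiv ℝ f)).abs
  -- Dyadic layers of the Jacobian. On the j-th layer the fibres have at most C 2^(jq/2) points,
  -- since the counting lemma is used with δ = q/2, while the extra factor |det|^q is at most (2D)^q
  -- 2^(-jq). The product decays like 2^(-jq/2), a geometric series. Where the Jacobian vanishes the
  -- integrand is zero.
  let S : ℕ → Set (Fin d → ℝ) := fun j => Metric.closedBall z₀ ρ ∩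
    {z | (1 / 2 : ℝ) ^ j < |(fderiv ℝ f z).det| ∧
      |(fderiv ℝ f z).det| ≤ 2 * D * (1 / 2 : ℝ) ^ j}
  have hSm : ∀ j, MeasurableSet (S j) := fun j =>
    Metric.isClosed_closedBall.measurableSet.inter
      ((measurableSet_lt measurable_const hmdet).inter (measurableSet_le hmdet measurable_const))
  let x : ℝ := (1 / 2 : ℝ) ^ (q / 2)
  have hx0 : 0 < x := by positivity
  have hx1 : x < 1 := Real.rpow_lt_one (by norm_num) (by norm_num) (by positivity)
  let a : ℕ → ℝ := fun j => (2 * D) ^ q * C * x ^ j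
  have ha : Summable a := (summable_geometric_of_lt_one hx0.le hx1).mul_left _
  have ha0 : ∀ j, 0 ≤ a j := fun j => by positivity
  have hlayer : ∀ (h : (Fin d → ℝ) → ℝ≥0∞), Measurable h → ∀ j,
      ∫⁻ z in S j, ENNReal.ofReal (|(fderiv ℝ f z).det| ^ (1 + q)) * h (f z) ≤
        ENNReal.ofReal (a j) * ∫⁻ u, h u := by
    intro h hh j
    have hpos : (0 : ℝ) < (1 / 2) ^ j := by positivity
    calc ∫⁻ z in S j, ENNReal.ofReal (|(fderiv ℝ f z).det| ^ (1 + q)) * h (f z)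
        ≤ ∫⁻ z in S j, ENNReal.ofReal ((2 * D * (1 / 2) ^ j) ^ q) *
            (ENNReal.ofReal |(fderiv ℝ f z).det| * h (f z)) := by
          refine setLIntegral_mono' (hSm j) fun z hz => ?_
          rw [← mul_assoc, ← ENNReal.ofReal_mul (by positivity)]
          gcongr
          have h0 : 0 < |(fderiv ℝ f z).det| := hpos.trans hz.2.1
          rw [Real.rpow_add h0, Real.rpow_one, mul_comm]
          gcongr
          exact hz.2.2
      _ = ENNReal.ofReal ((2 * D * (1 / 2) ^ j) ^ q) *
            ∫⁻ z in S j, ENNReal.ofReal |(fderiv ℝ f z).det| * h (f z) :=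
          lintegral_const_mul' _ _ ENNReal.ofReal_ne_top
      _ ≤ ENNReal.ofReal ((2 * D * (1 / 2) ^ j) ^ q) *
            (ENNReal.ofReal (C * ((1 / 2 : ℝ) ^ j) ^ (-(q / 2))) * ∫⁻ u, h u) := by
          gcongr
          refine setLIntegral_det_mul_comp_le volume (hSm j) (f' := fderiv ℝ f) (fun z hz => ?_)
            (fun z hz => ?_) (fun u t ht => ?_) hh
          · exact (((hf z (hsub hz.1)).contDiffAt (hΩ.mem_nhds (hsub hz.1))).differentiableAt
              (by simp)).hasFDerivAt.hasFDerivWithinAt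
          · exact abs_pos.1 (hpos.trans hz.2.1)
          · exact hC _ hpos (pow_le_one₀ (by norm_num) (by norm_num)) u t fun z hz =>
              ⟨(ht z hz).1.1, (ht z hz).2, (ht z hz).1.2.1.le⟩
      _ = ENNReal.ofReal (a j) * ∫⁻ u, h u := by
          rw [← mul_assoc, ← ENNReal.ofReal_mul (by positivity)]
          congr 2
          have e1 : ((1 / 2 : ℝ) ^ j) ^ q * ((1 / 2 : ℝ) ^ j) ^ (-(q / 2)) = x ^ j := by
            rw [← Real.rpow_add hpos, ← Real.rpow_natCast, ← Real.rpow_natCast,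
              ← Real.rpow_mul (by norm_num), ← Real.rpow_mul (by norm_num)]
            congr 1; ring
          rw [Real.mul_rpow (by positivity) hpos.le]
          calc (2 * D) ^ q * ((1 / 2 : ℝ) ^ j) ^ q * (C * ((1 / 2 : ℝ) ^ j) ^ (-(q / 2)))
              = (2 * D) ^ q * C * (((1 / 2 : ℝ) ^ j) ^ q * ((1 / 2 : ℝ) ^ j) ^ (-(q / 2))) := by
                ring
            _ = a j := by rw [e1]
  refine ⟨⟨∑' j, a j, tsum_nonneg ha0⟩, fun h hh => ?_⟩
  have hcov : Metric.closedBall z₀ ρ ⊆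
      (Metric.closedBall z₀ ρ ∩ {z | |(fderiv ℝ f z).det| = 0}) ∪ ⋃ j, S j := by
    intro z hz
    rcases (abs_nonneg (fderiv ℝ f z).det).eq_or_lt with h0 | h0
    · exact Or.inl ⟨hz, h0.symm⟩
    refine Or.inr (mem_iUnion.2 ?_)
    have hex : ∃ j : ℕ, (1 / 2 : ℝ) ^ j < |(fderiv ℝ f z).det| :=
      exists_pow_lt_of_lt_one h0 (by norm_num)
    classical
    refine ⟨Nat.find hex, hz, Nat.find_spec hex, ?_⟩
    rcases Nat.eq_zero_or_pos (Nat.find hex) with hj | hj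
    · rw [hj, pow_zero, mul_one]
      have := hD z hz
      linarith
    · have h1 := not_lt.1 (Nat.find_min hex (Nat.sub_lt hj one_pos))
      have h2 : (1 / 2 : ℝ) ^ (Nat.find hex) = (1 / 2) ^ (Nat.find hex - 1) * (1 / 2) := by
        rw [← pow_succ, Nat.sub_add_cancel hj]
      rw [h2]
      have h3 : (0 : ℝ) < (1 / 2) ^ (Nat.find hex - 1) := by positivity
      nlinarith
  calc ∫⁻ z in Metric.closedBall z₀ ρ, ENNReal.ofReal (|(fderiv ℝ f z).det| ^ (1 + q)) * h (f z)
      ≤ ∫⁻ z in (Metric.closedBall z₀ ρ ∩ {z | |(fderiv ℝ f z).det| = 0}) ∪ ⋃ j, S j,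
          ENNReal.ofReal (|(fderiv ℝ f z).det| ^ (1 + q)) * h (f z) := lintegral_mono_set hcov
    _ ≤ (∫⁻ z in Metric.closedBall z₀ ρ ∩ {z | |(fderiv ℝ f z).det| = 0},
          ENNReal.ofReal (|(fderiv ℝ f z).det| ^ (1 + q)) * h (f z)) +
        ∫⁻ z in ⋃ j, S j, ENNReal.ofReal (|(fderiv ℝ f z).det| ^ (1 + q)) * h (f z) :=
        lintegral_union_le _ _ _
    _ ≤ 0 + ∑' j, ∫⁻ z in S j, ENNReal.ofReal (|(fderiv ℝ f z).det| ^ (1 + q)) * h (f z) := by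
        refine add_le_add (le_of_eq ?_) (lintegral_iUnion_le _ _)
        refine setLIntegral_eq_zero (Metric.isClosed_closedBall.measurableSet.inter
          (hmdet (measurableSet_singleton 0))) fun z hz => ?_
        have h0 : |(fderiv ℝ f z).det| = 0 := hz.2
        rw [h0, Real.zero_rpow (by linarith), ENNReal.ofReal_zero, zero_mul]
        rfl
    _ ≤ ∑' j, ENNReal.ofReal (a j) * ∫⁻ u, h u := by
        rw [zero_add]; exact ENNReal.tsum_le_tsum (hlayer h hh)
    _ = _ := by
        rw [ENNReal.tsum_mul_right, ← ENNReal.ofReal_tsum_of_nonneg ha0 ha]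
        congr 1
        exact ENNReal.ofReal_eq_coe_nnreal _

end Multiplicity

/-! ### Integrals of negative powers of the distance to a subspace -/

section Distance

theorem rpow_neg_le_rpow_neg {x y : ℝ≥0∞} {s : ℝ} (hs : 0 ≤ s) (h : x ≤ y) :
    y ^ (-s) ≤ x ^ (-s) := by
  rw [ENNReal.rpow_neg, ENNReal.rpow_neg]
  exact ENNReal.inv_le_inv.2 (ENNReal.rpow_le_rpow h hs)

/-- Integrability of `‖y‖ ^ (-s)`, `s < dim`, against a Gaussian. -/
theorem lintegral_norm_rpow_mul_exp_lt_top {j : ℕ} {c s : ℝ} (hc : 0 < c) (hs0 : 0 ≤ s)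
    (hs : s < j) :
    ∫⁻ y : Euc j, ENNReal.ofReal ‖y‖ ^ (-s) * ENNReal.ofReal (Real.exp (-c * ‖y‖ ^ 2)) < ⊤ := by
  have hj : 0 < j := by exact_mod_cast lt_of_le_of_lt hs0 hs
  have : Nonempty (Fin j) := ⟨⟨0, hj⟩⟩
  have hint : Integrable fun y : Euc j => ‖y‖ ^ (-s) * Real.exp (-c * ‖y‖ ^ 2) := by
    have h1 := (integrable_fun_norm_addHaar (volume : Measure (Euc j))
      (f := fun r : ℝ => r ^ (-s) * Real.exp (-c * r ^ 2))).2
    refine h1 ?_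
    have h2 : IntegrableOn (fun r : ℝ => r ^ ((j : ℝ) - 1 - s) * Real.exp (-c * r ^ 2)) (Ioi 0) :=
      integrableOn_rpow_mul_exp_neg_mul_sq hc (by linarith)
    refine h2.congr_fun (fun r hr => ?_) measurableSet_Ioi
    have hr' : (0 : ℝ) < r := hr
    rw [finrank_euclideanSpace_fin, smul_eq_mul, ← mul_assoc, ← Real.rpow_natCast,
      ← Real.rpow_add hr', Nat.cast_sub hj, Nat.cast_one, sub_eq_add_neg _ s]
  have h3 := hint.lintegral_lt_top
  refine lt_of_le_of_lt (le_of_eq (lintegral_congr_ae ?_)) h3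
  have hne : ∀ᵐ y : Euc j, y ≠ 0 := by
    have : volume ({0} : Set (Euc j)) = 0 := measure_singleton 0
    exact compl_mem_ae_iff.2 this
  filter_upwards [hne] with y hy
  have hy' : 0 < ‖y‖ := norm_pos_iff.2 hy
  rw [ENNReal.ofReal_mul (by positivity), ENNReal.ofReal_rpow_of_pos hy']

variable {E : Type*} [NormedAddCommGroup E] [InnerProductSpace ℝ E] [FiniteDimensional ℝ E]

/-- An orthonormal basis with a large part orthogonal to a small subspace. -/
theorem exists_orthonormalBasis_orthogonal {l j : ℕ} (hE : Module.finrank ℝ E = l + j)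
    (W : Submodule ℝ E) (hW : Module.finrank ℝ W ≤ l) :
    ∃ b : OrthonormalBasis (Fin l ⊕ Fin j) ℝ E, ∀ i, b (Sum.inr i) ∈ Wᗮ := by
  have h1 : j ≤ Module.finrank ℝ Wᗮ := by
    have := W.finrank_add_finrank_orthogonal
    omega
  let e := stdOrthonormalBasis ℝ Wᗮ
  let v : Fin l ⊕ Fin j → E := Sum.elim (fun _ => 0) fun i => (e (Fin.castLE h1 i) : E)
  have hv : Orthonormal ℝ ((range Sum.inr).domRestrict v) := by
    have h2 : Orthonormal ℝ fun i : Fin j => (e (Fin.castLE h1 i) : E) :=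
      (e.orthonormal.comp_linearIsometry Wᗮ.subtypeₗᵢ).comp _ (Fin.castLE_injective h1)
    rw [orthonormal_iff_ite] at h2 ⊢
    rintro ⟨_, i, rfl⟩ ⟨_, i', rfl⟩
    have h3 : ((⟨Sum.inr i, i, rfl⟩ : (range Sum.inr : Set (Fin l ⊕ Fin j))) =
        ⟨Sum.inr i', i', rfl⟩) ↔ i = i' :=
      ⟨fun h => Sum.inr_injective (congrArg Subtype.val h), fun h => by subst h; rfl⟩
    simp only [h3]
    exact h2 i i'
  obtain ⟨b, hb⟩ := hv.exists_orthonormalBasis_extension_of_card_eq (by simp [hE])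
  exact ⟨b, fun i => by rw [hb _ ⟨i, rfl⟩]; exact (e (Fin.castLE h1 i)).2⟩

/-- The Gaussian integral of a negative power of the distance to a subspace of dimension at most
`l` is bounded uniformly in the subspace. -/
theorem exists_lintegral_projection_rpow_le [MeasurableSpace E] [BorelSpace E] {l j : ℕ}
    (hE : Module.finrank ℝ E = l + j) {c s : ℝ} (hc : 0 < c) (hs0 : 0 ≤ s) (hs : s < j) :
    ∃ C : ℝ≥0, ∀ W : Submodule ℝ E, Module.finrank ℝ W ≤ l →
      ∫⁻ v, ENNReal.ofReal ‖Wᗮ.orthogonalProjectionOnto v‖ ^ (-s) *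
        ENNReal.ofReal (Real.exp (-c * ‖v‖ ^ 2)) ≤ C := by
  set I₁ := ∫⁻ x : Euc l, ENNReal.ofReal (Real.exp (-c * ‖x‖ ^ 2)) with hI₁
  set I₂ := ∫⁻ y : Euc j, ENNReal.ofReal ‖y‖ ^ (-s) * ENNReal.ofReal (Real.exp (-c * ‖y‖ ^ 2))
    with hI₂
  have h1 : I₁ ≠ ⊤ := by
    have : Integrable fun x : Euc l => Real.exp (-c * ‖x‖ ^ 2) := by
      have := GaussianFourier.integrable_cexp_neg_mul_sq_norm_add (V := Euc l) (b := (c : ℂ))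
        (by simpa using hc) 0 0
      have := this.norm
      refine this.congr (ae_of_all _ fun x => ?_)
      simp only [Complex.norm_exp, zero_mul, add_zero]
      norm_cast
    exact this.lintegral_lt_top.ne
  have h2 : I₂ ≠ ⊤ := (lintegral_norm_rpow_mul_exp_lt_top hc hs0 hs).ne
  refine ⟨(I₁ * I₂).toNNReal, fun W hW => ?_⟩
  rw [ENNReal.coe_toNNReal (ENNReal.mul_ne_top h1 h2)]
  -- The distance to W is at least the norm of the j coordinates along basis vectors orthogonal to
  -- W. Replacing it by that norm splits the integral into a product of two Gaussian integrals in
  -- which W no longer occurs.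
  obtain ⟨b, hb⟩ := exists_orthonormalBasis_orthogonal hE W hW
  let e : E ≃ₗᵢ[ℝ] WithLp 2 (Euc l × Euc j) :=
    b.repr.trans (PiLp.sumPiLpEquivProdLpPiLp 2 (fun _ => ℝ))
  let Φ : E → Euc l × Euc j := fun v => WithLp.ofLp (e v)
  have hΦ : MeasurePreserving Φ volume (volume.prod volume) :=
    (WithLp.volume_preserving_ofLp (Euc l) (Euc j)).comp e.measurePreserving
  have hn : ∀ v, ‖v‖ ^ 2 = ‖(Φ v).1‖ ^ 2 + ‖(Φ v).2‖ ^ 2 := fun v => by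
    rw [← e.norm_map v, WithLp.prod_norm_sq_eq_of_L2]
    rfl
  have hΦ2 : ∀ v i, (Φ v).2 i = ⟪b (Sum.inr i), v⟫ := fun v i => by
    rw [← b.repr_apply_apply]; rfl
  have hle : ∀ v, ‖(Φ v).2‖ ≤ ‖Wᗮ.orthogonalProjectionOnto v‖ := fun v => by
    rw [← sq_le_sq₀ (norm_nonneg _) (norm_nonneg _), EuclideanSpace.norm_sq_eq]
    have hon : Orthonormal ℝ fun i => b (Sum.inr i) := b.orthonormal.comp _ Sum.inr_injective
    have := hon.sum_inner_products_le (x := (Wᗮ.orthogonalProjectionOnto v : E))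
      (s := Finset.univ)
    refine le_trans (le_of_eq (Finset.sum_congr rfl fun i _ => ?_)) this
    rw [hΦ2]
    congr 2
    have := Wᗮ.inner_orthogonalProjectionOnto_eq_of_mem_left ⟨_, hb i⟩ v
    exact this.symm
  calc ∫⁻ v, ENNReal.ofReal ‖Wᗮ.orthogonalProjectionOnto v‖ ^ (-s) *
        ENNReal.ofReal (Real.exp (-c * ‖v‖ ^ 2))
      ≤ ∫⁻ v, (fun p : Euc l × Euc j => ENNReal.ofReal (Real.exp (-c * ‖p.1‖ ^ 2)) *
          (ENNReal.ofReal ‖p.2‖ ^ (-s) * ENNReal.ofReal (Real.exp (-c * ‖p.2‖ ^ 2)))) (Φ v) := by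
        refine lintegral_mono fun v => ?_
        simp only
        rw [hn v, mul_add, Real.exp_add, ENNReal.ofReal_mul (Real.exp_pos _).le, ← mul_assoc,
          mul_comm (ENNReal.ofReal _ ^ (-s)), mul_assoc]
        exact mul_le_mul' le_rfl (mul_le_mul' (rpow_neg_le_rpow_neg hs0
          (ENNReal.ofReal_le_ofReal (hle v))) le_rfl)
    _ = ∫⁻ p : Euc l × Euc j, ENNReal.ofReal (Real.exp (-c * ‖p.1‖ ^ 2)) *
          (ENNReal.ofReal ‖p.2‖ ^ (-s) * ENNReal.ofReal (Real.exp (-c * ‖p.2‖ ^ 2)))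
          ∂(volume.prod volume) := by
        rw [← hΦ.lintegral_comp]
        fun_prop
    _ = I₁ * I₂ := by
        rw [hI₁, hI₂]
        exact lintegral_prod_mul (f := fun x : Euc l => ENNReal.ofReal (Real.exp (-c * ‖x‖ ^ 2)))
          (g := fun y : Euc j =>
            ENNReal.ofReal ‖y‖ ^ (-s) * ENNReal.ofReal (Real.exp (-c * ‖y‖ ^ 2)))
          (by fun_prop) (by fun_prop)

end Distance

/-! ### The sine of the angle between two vectors -/

section Sine

variable {E : Type*} [NormedAddCommGroup E] [InnerProductSpace ℝ E]

/-- The sine of the angle between two vectors. -/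
def sine (w v : E) : ℝ := Real.sin (InnerProductGeometry.angle w v)

theorem sine_nonneg (w v : E) : 0 ≤ sine w v := InnerProductGeometry.sin_angle_nonneg w v

theorem sine_le_one (w v : E) : sine w v ≤ 1 := Real.sin_le_one _

theorem sine_comm (w v : E) : sine w v = sine v w := by
  rw [sine, InnerProductGeometry.angle_comm, sine]

theorem sine_sq_mul (w v : E) :
    sine w v ^ 2 * (‖w‖ ^ 2 * ‖v‖ ^ 2) = ‖w‖ ^ 2 * ‖v‖ ^ 2 - ⟪w, v⟫ ^ 2 := by
  have h1 := InnerProductGeometry.cos_angle_mul_norm_mul_norm w v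
  rw [← h1, sine, Real.sin_sq]
  ring

/-- The square of the norm of the projection along a vector. -/
theorem norm_sq_mul_norm_projection_sq (w v : E) :
    ‖v‖ ^ 2 * ‖(ℝ ∙ v)ᗮ.orthogonalProjectionOnto w‖ ^ 2 = ‖w‖ ^ 2 * ‖v‖ ^ 2 - ⟪w, v⟫ ^ 2 := by
  have h1 : ‖w‖ ^ 2 = ‖(ℝ ∙ v).starProjection w‖ ^ 2 +
      ‖(ℝ ∙ v)ᗮ.orthogonalProjectionOnto w‖ ^ 2 := by
    have := (ℝ ∙ v).norm_sq_eq_add_norm_sq_projection w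
    exact this
  rcases eq_or_ne v 0 with rfl | hv
  · simp
  have h2 : ‖v‖ ^ 2 * ‖(ℝ ∙ v).starProjection w‖ ^ 2 = ⟪w, v⟫ ^ 2 := by
    rw [Submodule.starProjection_singleton, norm_smul, mul_pow]
    have : ‖v‖ ≠ 0 := norm_ne_zero_iff.2 hv
    simp only [RCLike.ofReal_real_eq_id, id_eq, norm_div, norm_pow, Real.norm_eq_abs,
      div_pow, sq_abs]
    rw [real_inner_comm]
    field_simp
  rw [h1, add_mul, mul_comm _ (‖v‖ ^ 2), h2]
  ring

theorem norm_projection_eq {v : E} (hv : v ≠ 0) (w : E) :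
    ‖(ℝ ∙ v)ᗮ.orthogonalProjectionOnto w‖ = sine w v * ‖w‖ := by
  have hv' : 0 < ‖v‖ := norm_pos_iff.2 hv
  rw [← sq_eq_sq₀ (norm_nonneg _) (mul_nonneg (sine_nonneg _ _) (norm_nonneg _))]
  have h1 := norm_sq_mul_norm_projection_sq w v
  rw [← sine_sq_mul] at h1
  have : ‖v‖ ^ 2 ≠ 0 := by positivity
  apply mul_left_cancel₀ this
  rw [h1]; ring

/-- Split q' into its parts along v and orthogonal to v, and project both off q. It follows that the
larger of the two sines on the right is at least half of the sine of ∠(q, q'). -/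
theorem sine_le_sine_add_sine {q q' v : E} (hq : q ≠ 0) (hq' : q' ≠ 0) (hv : v ≠ 0) :
    sine q q' ≤ sine q v + sine q' v := by
  have hq1 : 0 < ‖q'‖ := norm_pos_iff.2 hq'
  have hv1 : 0 < ‖v‖ := norm_pos_iff.2 hv
  have h1 := norm_projection_eq hq q'
  have h2 := norm_projection_eq hq v
  have h3 := norm_projection_eq hv q'
  set P := (ℝ ∙ q)ᗮ.orthogonalProjectionOnto
  have hdec : q' = (⟪v, q'⟫ / ‖v‖ ^ 2) • v + ((ℝ ∙ v)ᗮ.orthogonalProjectionOnto q' : E) := by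
    have := (ℝ ∙ v).starProjection_add_starProjection_orthogonal q'
    rw [Submodule.starProjection_singleton] at this
    exact this.symm
  have h4 : ‖P q'‖ ≤ |⟪v, q'⟫| / ‖v‖ ^ 2 * ‖P v‖ + sine q' v * ‖q'‖ := by
    conv_lhs => rw [hdec]
    rw [map_add, map_smul]
    refine norm_add_le_of_le ?_ ?_
    · rw [norm_smul, Real.norm_eq_abs, abs_div, abs_of_pos (pow_pos hv1 2)]
    · rw [← h3]
      exact (ℝ ∙ q)ᗮ.norm_orthogonalProjectionOnto_apply_le _
  have h5 : |⟪v, q'⟫| / ‖v‖ ^ 2 * ‖P v‖ ≤ sine q v * ‖q'‖ := by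
    rw [h2, sine_comm v q, div_mul_eq_mul_div, div_le_iff₀ (pow_pos hv1 2)]
    have := abs_real_inner_le_norm v q'
    have h6 : 0 ≤ sine q v * ‖v‖ := mul_nonneg (sine_nonneg _ _) (norm_nonneg _)
    nlinarith
  have h7 : sine q q' * ‖q'‖ ≤ (sine q v + sine q' v) * ‖q'‖ := by
    rw [sine_comm q q', ← h1]; linarith
  exact le_of_mul_le_mul_right h7 hq1

theorem sine_pos_of_linearIndependent {q q' : E} (h : LinearIndependent ℝ ![q, q']) :
    0 < sine q q' := by
  refine (sine_nonneg _ _).lt_of_ne' fun h0 => ?_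
  rw [sine, InnerProductGeometry.sin_eq_zero_iff_angle_eq_zero_or_angle_eq_pi,
    InnerProductGeometry.angle_eq_zero_iff, InnerProductGeometry.angle_eq_pi_iff] at h0
  rw [LinearIndependent.pair_iff] at h
  rcases h0 with ⟨_, r, _, hr⟩ | ⟨_, r, _, hr⟩
  · have := h r (-1) (by rw [hr]; simp)
    norm_num at this
  · have := h r (-1) (by rw [hr]; simp)
    norm_num at this

theorem linearIndependent_of_sine_ne_zero {q q' : E} (hq : q ≠ 0) (hq' : q' ≠ 0)
    (h : sine q q' ≠ 0) : LinearIndependent ℝ ![q, q'] := by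
  rw [LinearIndependent.pair_iff' hq]
  rintro a rfl
  refine h ?_
  have ha : a ≠ 0 := by rintro rfl; simp at hq'
  rw [sine, InnerProductGeometry.sin_eq_zero_iff_angle_eq_zero_or_angle_eq_pi,
    InnerProductGeometry.angle_eq_zero_iff, InnerProductGeometry.angle_eq_pi_iff]
  rcases lt_or_gt_of_ne ha with h1 | h1
  · exact Or.inr ⟨hq, a, h1, rfl⟩
  · exact Or.inl ⟨hq, a, h1, rfl⟩

end Sine

/-! ### The standard Gaussian measure -/

section Gaussian

/-- The standard Gaussian measure on `ℝᵈ`. -/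
def gaussMeasure (d : ℕ) : Measure (Euc d) :=
  volume.withDensity fun v => ENNReal.ofReal (gaussDensity v)

theorem gaussDensity_pos {d : ℕ} (v : Euc d) : 0 < gaussDensity v := by
  unfold gaussDensity; positivity

theorem continuous_gaussDensity {d : ℕ} : Continuous (gaussDensity (d := d)) := by
  unfold gaussDensity; fun_prop

theorem measurable_ofReal_gaussDensity {d : ℕ} :
    Measurable fun v : Euc d => ENNReal.ofReal (gaussDensity v) :=
  continuous_gaussDensity.measurable.ennreal_ofReal

theorem integral_gaussDensity (d : ℕ) : ∫ v : Euc d, gaussDensity v = 1 := by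
  have h := GaussianFourier.integral_rexp_neg_mul_sq_norm (V := Euc d) (b := 1 / 2) (by norm_num)
  rw [finrank_euclideanSpace_fin] at h
  have h2 : ∀ v : Euc d, gaussDensity v =
      (2 * Real.pi) ^ (-(d : ℝ) / 2) * Real.exp (-(1 / 2) * ‖v‖ ^ 2) := fun v => by
    rw [gaussDensity]; congr 2; ring
  simp_rw [h2]
  rw [integral_const_mul, h, show Real.pi / (1 / 2) = 2 * Real.pi by ring,
    ← Real.rpow_add (by positivity)]
  rw [show -(d : ℝ) / 2 + d / 2 = 0 by ring, Real.rpow_zero]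

theorem integrable_gaussDensity (d : ℕ) : Integrable (gaussDensity (d := d)) := by
  by_contra h
  have := integral_gaussDensity d
  rw [integral_undef h] at this
  exact zero_ne_one this

instance (d : ℕ) : IsProbabilityMeasure (gaussMeasure d) := by
  constructor
  rw [gaussMeasure, withDensity_apply _ MeasurableSet.univ, Measure.restrict_univ,
    ← ofReal_integral_eq_lintegral_ofReal (integrable_gaussDensity d)
      (ae_of_all _ fun v => (gaussDensity_pos v).le), integral_gaussDensity, ENNReal.ofReal_one]

theorem lintegral_gaussMeasure {d : ℕ} {f : Euc d → ℝ≥0∞} (hf : Measurable f) :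
    ∫⁻ v, f v ∂gaussMeasure d = ∫⁻ v, f v * ENNReal.ofReal (gaussDensity v) := by
  rw [gaussMeasure, lintegral_withDensity_eq_lintegral_mul _ measurable_ofReal_gaussDensity hf]
  exact lintegral_congr fun v => mul_comm _ _

theorem integral_gaussMeasure {d : ℕ} (f : Euc d → ℝ) :
    ∫ v, f v ∂gaussMeasure d = ∫ v, f v * gaussDensity v := by
  rw [gaussMeasure, integral_withDensity_eq_integral_toReal_smul measurable_ofReal_gaussDensity
    (ae_of_all _ fun v => ENNReal.ofReal_lt_top)]
  refine integral_congr_ae (ae_of_all _ fun v => ?_)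
  simp only [ENNReal.toReal_ofReal (gaussDensity_pos v).le, smul_eq_mul]
  ring

theorem integrable_gaussMeasure_iff {d : ℕ} (f : Euc d → ℝ) :
    Integrable f (gaussMeasure d) ↔ Integrable fun v => f v * gaussDensity v := by
  rw [gaussMeasure, integrable_withDensity_iff measurable_ofReal_gaussDensity
    (ae_of_all _ fun v => ENNReal.ofReal_lt_top)]
  simp only [ENNReal.toReal_ofReal (gaussDensity_pos _).le]

theorem gaussMeasure_absolutelyContinuous (d : ℕ) : gaussMeasure d ≪ volume :=
  withDensity_absolutelyContinuous _ _

theorem measurable_sine {d : ℕ} : Measurable fun p : Euc d × Euc d => sine p.1 p.2 := by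
  have h : ∀ p : Euc d × Euc d, sine p.1 p.2 =
      Real.sin (Real.arccos (⟪p.1, p.2⟫ / (‖p.1‖ * ‖p.2‖))) := fun p => rfl
  simp_rw [h]
  exact Real.measurable_sin.comp (Real.continuous_arccos.measurable.comp (by fun_prop))

theorem measurable_sine_rpow {d : ℕ} (q : Euc d) (s : ℝ) :
    Measurable fun v => ENNReal.ofReal (sine q v) ^ s :=
  (Measurable.ennreal_ofReal
    (measurable_sine.comp (measurable_prodMk_left (x := q)))).pow_const s

/-- The sine of ∠(q, v) is the distance of v from the line of q divided by ‖v‖. The resulting power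
of ‖v‖ is absorbed by half of the Gaussian exponent, and the other half keeps the integral finite.
-/
theorem exists_rpow_le_exp (s : ℝ) (hs : 0 ≤ s) : ∃ C : ℝ, 0 ≤ C ∧ ∀ x : ℝ, 0 ≤ x →
    x ^ s ≤ C * Real.exp (x ^ 2 / 4) := by
  obtain ⟨n, hn⟩ := exists_nat_ge (s / 2)
  refine ⟨1 + n.factorial * 4 ^ n, by positivity, fun x hx => ?_⟩
  have h1 : x ^ s ≤ 1 + x ^ (2 * n) := by
    rcases le_total x 1 with h | h
    · have := Real.rpow_le_one hx h hs
      have : 0 ≤ x ^ (2 * n) := by positivity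
      linarith
    · have : x ^ s ≤ x ^ ((2 * n : ℕ) : ℝ) :=
        Real.rpow_le_rpow_of_exponent_le h (by push_cast; linarith)
      rw [Real.rpow_natCast] at this
      linarith
  have h2 := Real.pow_div_factorial_le_exp (x ^ 2 / 4) (by positivity) n
  rw [div_le_iff₀ (by positivity), div_pow, div_le_iff₀ (by positivity), ← pow_mul] at h2
  have h3 : 1 ≤ Real.exp (x ^ 2 / 4) := Real.one_le_exp (by positivity)
  calc x ^ s ≤ 1 + x ^ (2 * n) := h1
    _ ≤ Real.exp (x ^ 2 / 4) + Real.exp (x ^ 2 / 4) * n.factorial * 4 ^ n := add_le_add h3 h2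
    _ = _ := by ring

/-- The Gaussian average of `(sin ∠(q, v)) ^ (-s)` is bounded for `s` less than the dimension of
the sphere. -/
theorem exists_lintegral_sine_rpow_le (k : ℕ) {s : ℝ} (hs0 : 0 ≤ s) (hs : s < k + 1) :
    ∃ C : ℝ≥0, ∀ q : Euc (k + 2), q ≠ 0 →
      ∫⁻ v, ENNReal.ofReal (sine q v) ^ (-s) ∂gaussMeasure (k + 2) ≤ C := by
  obtain ⟨C, hC⟩ := exists_lintegral_projection_rpow_le (E := Euc (k + 2)) (l := 1) (j := k + 1)
    (by rw [finrank_euclideanSpace_fin]; omega) (c := 1 / 4) (by norm_num) hs0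
    (by push_cast; exact hs)
  obtain ⟨D, hD0, hD⟩ := exists_rpow_le_exp s hs0
  set G : ℝ := (2 * Real.pi) ^ (-((k + 2 : ℕ) : ℝ) / 2) with hG
  have hG0 : 0 < G := by positivity
  refine ⟨(D * G).toNNReal * C, fun q hq => ?_⟩
  rw [lintegral_gaussMeasure (measurable_sine_rpow q (-s))]
  have hne : ∀ᵐ v : Euc (k + 2), v ≠ 0 := by
    have : volume ({0} : Set (Euc (k + 2))) = 0 := measure_singleton 0
    exact compl_mem_ae_iff.2 this
  calc ∫⁻ v, ENNReal.ofReal (sine q v) ^ (-s) * ENNReal.ofReal (gaussDensity v)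
      ≤ ∫⁻ v, ENNReal.ofReal (D * G) *
          (ENNReal.ofReal ‖(ℝ ∙ q)ᗮ.orthogonalProjectionOnto v‖ ^ (-s) *
          ENNReal.ofReal (Real.exp (-(1 / 4) * ‖v‖ ^ 2))) := by
        refine lintegral_mono_ae ?_
        filter_upwards [hne] with v hv
        have hv' : 0 < ‖v‖ := norm_pos_iff.2 hv
        have e1 : ENNReal.ofReal (sine q v) ^ (-s) =
            ENNReal.ofReal ‖(ℝ ∙ q)ᗮ.orthogonalProjectionOnto v‖ ^ (-s) *
              ENNReal.ofReal (‖v‖ ^ s) := by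
          rw [norm_projection_eq hq, sine_comm v q, ENNReal.ofReal_mul (sine_nonneg _ _),
            ENNReal.mul_rpow_of_ne_top ENNReal.ofReal_ne_top ENNReal.ofReal_ne_top, mul_assoc,
            ← ENNReal.ofReal_rpow_of_pos hv', ← ENNReal.rpow_add _ _ (by simpa using hv)
              ENNReal.ofReal_ne_top, neg_add_cancel, ENNReal.rpow_zero, mul_one]
        rw [e1, mul_assoc, mul_left_comm (ENNReal.ofReal (D * G))]
        refine mul_le_mul' le_rfl ?_
        rw [← ENNReal.ofReal_mul (by positivity), ← ENNReal.ofReal_mul (by positivity)]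
        refine ENNReal.ofReal_le_ofReal ?_
        rw [gaussDensity, ← hG]
        calc ‖v‖ ^ s * (G * Real.exp (-‖v‖ ^ 2 / 2))
            ≤ D * Real.exp (‖v‖ ^ 2 / 4) * (G * Real.exp (-‖v‖ ^ 2 / 2)) := by
              gcongr; exact hD _ hv'.le
          _ = D * G * (Real.exp (‖v‖ ^ 2 / 4) * Real.exp (-‖v‖ ^ 2 / 2)) := by ring
          _ = D * G * Real.exp (-(1 / 4) * ‖v‖ ^ 2) := by
              rw [← Real.exp_add]; congr 2; ring
    _ = ENNReal.ofReal (D * G) * ∫⁻ v, (ENNReal.ofReal ‖(ℝ ∙ q)ᗮ.orthogonalProjectionOnto v‖ ^ (-s)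
          * ENNReal.ofReal (Real.exp (-(1 / 4) * ‖v‖ ^ 2))) :=
        lintegral_const_mul' _ _ ENNReal.ofReal_ne_top
    _ ≤ ENNReal.ofReal (D * G) * C := by
        gcongr
        exact hC _ (finrank_span_singleton hq).le
    _ = _ := by rw [ENNReal.coe_mul]; rfl

/-- The convolution estimate `∫ (sin ∠(q, v) sin ∠(q', v)) ^ (-k) ≲ (sin ∠(q, q')) ^ (1/2 - k)`. -/
theorem exists_lintegral_sine_mul_sine_le {k : ℕ} (hk : 1 ≤ k) :
    ∃ C : ℝ≥0, ∀ q q' : Euc (k + 2), q ≠ 0 → q' ≠ 0 →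
      ∫⁻ v, ENNReal.ofReal (sine q v) ^ (-(k : ℝ)) * ENNReal.ofReal (sine q' v) ^ (-(k : ℝ))
        ∂gaussMeasure (k + 2) ≤ C * ENNReal.ofReal (sine q q') ^ (-((k : ℝ) - 1 / 2)) := by
  have hk' : (1 : ℝ) ≤ k := by exact_mod_cast hk
  -- With a the smaller of the two sines, b the larger and c the sine of ∠(q, q'), one has b ≥ c/2
  -- and b ≥ a. Of the factor b^(-k), the part b^(-(k - 1/2)) is bounded through c and the remaining
  -- b^(-1/2) through a. What is left to integrate is a^(-(k + 1/2)), admissible because k + 1/2 < k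
  -- + 1. The exponent k - 1/2 of c stays below k, as the potential estimate requires.
  obtain ⟨C, hC⟩ := exists_lintegral_sine_rpow_le k (s := k + 1 / 2) (by linarith) (by linarith)
  refine ⟨2 ^ ((k : ℝ) - 1 / 2) * (C + C), fun q q' hq hq' => ?_⟩
  have key : ∀ a b c : ℝ≥0∞, c ≤ 2 * b → a ≤ b →
      a ^ (-(k : ℝ)) * b ^ (-(k : ℝ)) ≤
        2 ^ ((k : ℝ) - 1 / 2) * c ^ (-((k : ℝ) - 1 / 2)) * a ^ (-((k : ℝ) + 1 / 2)) := by
    intro a b c hcb hab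
    rcases eq_or_ne c 0 with rfl | hc
    · rcases eq_or_ne a ⊤ with rfl | ha
      · rw [top_le_iff.1 hab, ENNReal.top_rpow_of_neg (by linarith)]
        simp
      rw [ENNReal.zero_rpow_of_neg (by linarith), ENNReal.mul_top (by simp), ENNReal.top_mul]
      · exact le_top
      · rw [ENNReal.rpow_neg]
        exact ENNReal.inv_ne_zero.2 (ENNReal.rpow_ne_top_of_nonneg (by linarith) ha)
    have hb0 : b ≠ 0 := by rintro rfl; simp at hcb; exact hc hcb
    rcases eq_or_ne b ⊤ with rfl | hbt
    · rw [ENNReal.top_rpow_of_neg (by linarith)]; simp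
    rcases eq_or_ne a 0 with rfl | ha
    · rw [ENNReal.zero_rpow_of_neg (by linarith : -((k : ℝ) + 1 / 2) < 0), ENNReal.mul_top]
      · exact le_top
      · refine mul_ne_zero (by simp) ?_
        rw [ENNReal.rpow_neg]
        refine ENNReal.inv_ne_zero.2 (ENNReal.rpow_ne_top_of_nonneg (by linarith) ?_)
        exact ne_top_of_le_ne_top (ENNReal.mul_ne_top (by simp) hbt) hcb
    have hat : a ≠ ⊤ := ne_top_of_le_ne_top hbt hab
    have e1 : b ^ (-(k : ℝ)) ≤ b ^ (-((k : ℝ) - 1 / 2)) * a ^ (-(1 / 2 : ℝ)) := by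
      rw [show -(k : ℝ) = -((k : ℝ) - 1 / 2) + -(1 / 2) by ring, ENNReal.rpow_add _ _ hb0 hbt]
      exact mul_le_mul' le_rfl (rpow_neg_le_rpow_neg (by norm_num) hab)
    have e2 : b ^ (-((k : ℝ) - 1 / 2)) ≤
        2 ^ ((k : ℝ) - 1 / 2) * c ^ (-((k : ℝ) - 1 / 2)) := by
      have h1 := rpow_neg_le_rpow_neg (s := (k : ℝ) - 1 / 2) (by linarith) hcb
      rw [ENNReal.mul_rpow_of_ne_top (by simp) hbt] at h1
      calc b ^ (-((k : ℝ) - 1 / 2)) = 2 ^ ((k : ℝ) - 1 / 2) *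
            (2 ^ (-((k : ℝ) - 1 / 2)) * b ^ (-((k : ℝ) - 1 / 2))) := by
            rw [← mul_assoc, ← ENNReal.rpow_add _ _ (by simp) (by simp), add_neg_cancel,
              ENNReal.rpow_zero, one_mul]
        _ ≤ _ := mul_le_mul' le_rfl h1
    calc a ^ (-(k : ℝ)) * b ^ (-(k : ℝ))
        ≤ a ^ (-(k : ℝ)) * (2 ^ ((k : ℝ) - 1 / 2) * c ^ (-((k : ℝ) - 1 / 2)) *
          a ^ (-(1 / 2 : ℝ))) := mul_le_mul' le_rfl (e1.trans (mul_le_mul' e2 le_rfl))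
      _ = 2 ^ ((k : ℝ) - 1 / 2) * c ^ (-((k : ℝ) - 1 / 2)) *
          (a ^ (-(k : ℝ)) * a ^ (-(1 / 2 : ℝ))) := by ring
      _ = _ := by
          rw [← ENNReal.rpow_add _ _ ha hat]
          congr 2; ring
  have hne : ∀ᵐ v ∂gaussMeasure (k + 2), v ≠ 0 := by
    refine (gaussMeasure_absolutelyContinuous _).ae_le ?_
    have : volume ({0} : Set (Euc (k + 2))) = 0 := measure_singleton 0
    exact compl_mem_ae_iff.2 this
  set c := ENNReal.ofReal (sine q q') with hc
  calc ∫⁻ v, ENNReal.ofReal (sine q v) ^ (-(k : ℝ)) * ENNReal.ofReal (sine q' v) ^ (-(k : ℝ))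
        ∂gaussMeasure (k + 2)
      ≤ ∫⁻ v, 2 ^ ((k : ℝ) - 1 / 2) * c ^ (-((k : ℝ) - 1 / 2)) *
          (ENNReal.ofReal (sine q v) ^ (-((k : ℝ) + 1 / 2)) +
            ENNReal.ofReal (sine q' v) ^ (-((k : ℝ) + 1 / 2))) ∂gaussMeasure (k + 2) := by
        refine lintegral_mono_ae ?_
        filter_upwards [hne] with v hv
        have htri := ENNReal.ofReal_le_ofReal (sine_le_sine_add_sine hq hq' hv)
        rw [ENNReal.ofReal_add (sine_nonneg _ _) (sine_nonneg _ _), ← hc] at htri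
        rcases le_total (ENNReal.ofReal (sine q v)) (ENNReal.ofReal (sine q' v)) with h | h
        · refine (key _ _ c (htri.trans ?_) h).trans (mul_le_mul' le_rfl le_self_add)
          rw [two_mul]; gcongr
        · rw [mul_comm (ENNReal.ofReal (sine q v) ^ _)]
          refine (key _ _ c (htri.trans ?_) h).trans (mul_le_mul' le_rfl le_add_self)
          rw [two_mul]; gcongr
    _ = 2 ^ ((k : ℝ) - 1 / 2) * c ^ (-((k : ℝ) - 1 / 2)) *
          ((∫⁻ v, ENNReal.ofReal (sine q v) ^ (-((k : ℝ) + 1 / 2)) ∂gaussMeasure (k + 2)) +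
            ∫⁻ v, ENNReal.ofReal (sine q' v) ^ (-((k : ℝ) + 1 / 2)) ∂gaussMeasure (k + 2)) := by
        rw [← lintegral_add_left (measurable_sine_rpow q _)]
        exact lintegral_const_mul _ ((measurable_sine_rpow q _).add (measurable_sine_rpow q' _))
    _ ≤ 2 ^ ((k : ℝ) - 1 / 2) * c ^ (-((k : ℝ) - 1 / 2)) * (C + C) :=
        mul_le_mul' le_rfl (add_le_add (hC q hq) (hC q' hq'))
    _ = _ := by
        push_cast
        rw [ENNReal.coe_rpow_of_nonneg _ (by linarith : (0:ℝ) ≤ (k : ℝ) - 1 / 2)]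
        push_cast
        ring

end Gaussian

/-! ### The generalized cross product and the kernel factor -/

section Cross

variable {k : ℕ}

theorem inner_cross (a : Fin (k + 1) → Euc (k + 2)) (v : Euc (k + 2)) :
    ⟪cross a, v⟫ =
      (Matrix.of fun r c => Fin.cons (α := fun _ => Euc (k + 2)) v a r c).det := by
  simp only [PiLp.inner_apply, RCLike.inner_apply, conj_trivial, cross]
  simp_rw [Matrix.det_succ_row_zero (n := k + 1), Finset.mul_sum]
  rw [Finset.sum_comm]
  refine Finset.sum_congr rfl fun j _ => ?_
  rw [Finset.sum_eq_single j]
  · simp only [Matrix.of_apply, Fin.cons_zero, PiLp.single_apply, if_true, mul_one]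
    have : ∀ w : Euc (k + 2), (Matrix.of fun r c =>
        Fin.cons (α := fun _ => Euc (k + 2)) w a r c).submatrix Fin.succ j.succAbove =
        Matrix.of fun r c => a r (j.succAbove c) := fun w => by
      ext r c; simp
    rw [this, this]
    ring
  · intro i _ hij
    simp [hij.symm]
  · simp

theorem inner_cross_self (a : Fin (k + 1) → Euc (k + 2)) (j : Fin (k + 1)) :
    ⟪cross a, a j⟫ = 0 := by
  rw [inner_cross]
  refine Matrix.det_zero_of_row_eq (i := 0) (j := j.succ) (Fin.succ_ne_zero j).symm ?_
  ext c
  simp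

theorem detCols_snoc (a : Fin (k + 1) → Euc (k + 2)) (v : Euc (k + 2)) :
    detCols (Fin.snoc (α := fun _ => Euc (k + 2)) a v) = (-1) ^ (k + 1) * ⟪cross a, v⟫ := by
  rw [inner_cross, detCols, ← Matrix.det_transpose, Fin.snoc_eq_cons_rotate]
  have := Matrix.det_permute (finRotate (k + 2))
    (Matrix.of fun r c => Fin.cons (α := fun _ => Euc (k + 2)) v a r c)
  rw [sign_finRotate] at this
  push_cast at this
  rw [← this]
  rfl

theorem continuous_cross : Continuous (cross (k := k)) := by
  refine (PiLp.continuous_toLp 2 _).comp (continuous_pi fun i => ?_)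
  refine Continuous.matrix_det (continuous_matrix fun r c => ?_)
  refine Fin.cases ?_ (fun r => ?_) r
  · simpa using continuous_const
  · simp only [Matrix.of_apply, Fin.cons_succ]
    fun_prop

theorem norm_dir {d : ℕ} {v : Euc d} (hv : v ≠ 0) : ‖dir v‖ = 1 := by
  rw [dir, norm_smul, norm_inv, norm_norm, inv_mul_cancel₀ (norm_ne_zero_iff.2 hv)]

theorem dir_zero {d : ℕ} : dir (0 : Euc d) = 0 := by simp [dir]

theorem norm_smul_dir {d : ℕ} (v : Euc d) : ‖v‖ • dir v = v := by
  rcases eq_or_ne v 0 with rfl | hv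
  · simp
  · rw [dir, smul_smul, mul_inv_cancel₀ (norm_ne_zero_iff.2 hv), one_smul]

theorem measurable_dir {d : ℕ} : Measurable (dir (d := d)) := by
  unfold dir; fun_prop

/-- The subspace on the left varies with v; the explicit formula on the right, valid also for v = 0,
makes measurability in (w, v) jointly visible. -/
theorem norm_projection_eq_sqrt {d : ℕ} (w v : Euc d) :
    ‖(ℝ ∙ v)ᗮ.orthogonalProjectionOnto w‖ = √(‖w‖ ^ 2 - ⟪w, v⟫ ^ 2 / ‖v‖ ^ 2) := by
  rw [← Real.sqrt_sq (norm_nonneg ((ℝ ∙ v)ᗮ.orthogonalProjectionOnto w))]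
  congr 1
  rcases eq_or_ne v 0 with rfl | hv
  · have := (ℝ ∙ (0 : Euc d)).norm_sq_eq_add_norm_sq_projection w
    simpa using this.symm
  · have hv' : ‖v‖ ≠ 0 := norm_ne_zero_iff.2 hv
    have := norm_sq_mul_norm_projection_sq w v
    field_simp
    linarith

/-- The kernel factor in terms of the cross product and the angle with the last vector. -/
theorem kernelFactor_eq (A : Fin (k + 1) → Euc (k + 2)) {v : Euc (k + 2)} (hv : v ≠ 0) :
    kernelFactor A v = (-1) ^ (k + 1) * ⟪cross A, dir v⟫ /
      (sine (lastCol A) v * ‖lastCol A‖) ^ (k + 1) := by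
  rw [kernelFactor, detCols_snoc, norm_projection_eq hv]

/-- The cross product is orthogonal to a_N, so it only sees the component of the direction of v
orthogonal to a_N, whose length is the sine. This gains one power: the kernel factor is singular of
order k instead of k + 1. -/
theorem abs_inner_cross_dir_le (A : Fin (k + 1) → Euc (k + 2)) (hA : lastCol A ≠ 0)
    {v : Euc (k + 2)} (hv : v ≠ 0) :
    |⟪cross A, dir v⟫| ≤ ‖cross A‖ * sine (lastCol A) v := by
  set q := lastCol A with hq
  have h1 : ⟪cross A, q⟫ = 0 := inner_cross_self A _
  have h2 : dir v = (⟪q, dir v⟫ / ‖q‖ ^ 2) • q + ((ℝ ∙ q)ᗮ.orthogonalProjectionOnto (dir v) : Euc (k + 2)) := by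
    have := (ℝ ∙ q).starProjection_add_starProjection_orthogonal (dir v)
    rw [Submodule.starProjection_singleton] at this
    exact this.symm
  rw [h2, inner_add_right, inner_smul_right, h1, mul_zero, zero_add]
  refine (abs_real_inner_le_norm _ _).trans ?_
  gcongr
  have h3 := norm_projection_eq hA (dir v)
  rw [norm_dir hv, mul_one, sine_comm] at h3
  have h4 : sine q (dir v) = sine q v := by
    rw [sine, dir, InnerProductGeometry.angle_smul_right_of_pos _ _
      (inv_pos.2 (norm_pos_iff.2 hv)), sine]
  rw [← h4, ← h3]
  rfl

/-- The kernel factor is bounded by the Jacobian of the direction map times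
`(sin ∠(a_N, v)) ^ (-k)`. -/
theorem ofReal_abs_kernelFactor_le (A : Fin (k + 1) → Euc (k + 2)) (v : Euc (k + 2)) :
    ENNReal.ofReal |kernelFactor A v| ≤
      ENNReal.ofReal (‖cross A‖ * (‖lastCol A‖ ^ (k + 1))⁻¹) *
        ENNReal.ofReal (sine (lastCol A) v) ^ (-(k : ℝ)) := by
  rcases eq_or_ne v 0 with rfl | hv
  · rw [kernelFactor, detCols_snoc, dir_zero, inner_zero_right]; simp
  rw [kernelFactor_eq A hv]
  -- If a_N = 0, or if v lies on the line of a_N, the denominator is zero and the kernel factor is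
  -- zero by the convention for division.
  rcases eq_or_ne (lastCol A) 0 with hA | hA
  · rw [hA]; simp
  rcases (sine_nonneg (lastCol A) v).eq_or_lt with hs | hs
  · rw [← hs]; simp
  have hA' : 0 < ‖lastCol A‖ := norm_pos_iff.2 hA
  rw [ENNReal.ofReal_rpow_of_pos hs, ← ENNReal.ofReal_mul (by positivity)]
  refine ENNReal.ofReal_le_ofReal ?_
  rw [abs_div, abs_mul, abs_pow, abs_neg, abs_one, one_pow, one_mul,
    abs_of_pos (show 0 < (sine (lastCol A) v * ‖lastCol A‖) ^ (k + 1) by positivity),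
    Real.rpow_neg hs.le, Real.rpow_natCast, div_le_iff₀ (by positivity)]
  refine (abs_inner_cross_dir_le A hA hv).trans (le_of_eq ?_)
  field_simp
  ring

theorem measurable_kernelFactor :
    Measurable fun p : (Fin (k + 1) → Euc (k + 2)) × Euc (k + 2) => kernelFactor p.1 p.2 := by
  unfold kernelFactor
  simp_rw [detCols_snoc, norm_projection_eq_sqrt, lastCol]
  have h1 : Measurable fun p : (Fin (k + 1) → Euc (k + 2)) × Euc (k + 2) => cross p.1 :=
    continuous_cross.measurable.comp measurable_fst
  have h2 : Measurable fun p : (Fin (k + 1) → Euc (k + 2)) × Euc (k + 2) => dir p.2 :=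
    measurable_dir.comp measurable_snd
  fun_prop

end Cross

/-! ### The local energy estimate -/

section Energy

/-- A ball for the sup norm is a product, and the unused last coordinate contributes the length 2ρ
of an interval. Applied twice, this introduces the two auxiliary variables of the cone map. -/
theorem setLIntegral_closedBall_comp_init {n : ℕ} (u₀ : Fin (n + 1) → ℝ) {ρ : ℝ} (hρ : 0 ≤ ρ)
    {g : (Fin n → ℝ) → ℝ≥0∞} (hg : Measurable g) :
    ∫⁻ u in Metric.closedBall u₀ ρ, g (fun j => u j.castSucc) =
      ENNReal.ofReal (2 * ρ) * ∫⁻ z in Metric.closedBall (fun j => u₀ j.castSucc) ρ, g z := by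
  have hmp := volume_preserving_piFinSuccAbove (fun _ : Fin (n + 1) => ℝ) (Fin.last n)
  have hpre : Metric.closedBall u₀ ρ =
      MeasurableEquiv.piFinSuccAbove (fun _ : Fin (n + 1) => ℝ) (Fin.last n) ⁻¹'
        (Metric.closedBall (u₀ (Fin.last n)) ρ ×ˢ
          Metric.closedBall (fun j => u₀ j.castSucc) ρ) := by
    ext u
    simp only [closedBall_pi _ hρ, mem_preimage, mem_prod, mem_univ_pi, Fin.forall_fin_succ',
      MeasurableEquiv.piFinSuccAbove_apply, Fin.insertNthEquiv_symm_apply, Fin.removeNth_apply,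
      Fin.succAbove_last]
    exact and_comm
  have h1 : ∫⁻ u in Metric.closedBall u₀ ρ, g (fun j => u j.castSucc) =
      ∫⁻ p in Metric.closedBall (u₀ (Fin.last n)) ρ ×ˢ
          Metric.closedBall (fun j => u₀ j.castSucc) ρ, g p.2 := by
    have h := hmp.setLIntegral_comp_preimage (f := fun p : ℝ × (Fin n → ℝ) => g p.2)
      (s := Metric.closedBall (u₀ (Fin.last n)) ρ ×ˢ Metric.closedBall (fun j => u₀ j.castSucc) ρ)
      (Metric.isClosed_closedBall.measurableSet.prod Metric.isClosed_closedBall.measurableSet)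
      (hg.comp measurable_snd)
    rw [hpre]
    refine Eq.trans ?_ h
    refine setLIntegral_congr_fun ?_ fun u _ => ?_
    · exact (MeasurableEquiv.measurable _)
        (Metric.isClosed_closedBall.measurableSet.prod Metric.isClosed_closedBall.measurableSet)
    · congr 1
      ext j
      simp [MeasurableEquiv.piFinSuccAbove_apply, Fin.init]
  rw [h1, Measure.volume_eq_prod, ← Measure.prod_restrict]
  have h2 := lintegral_prod_mul (μ := volume.restrict (Metric.closedBall (u₀ (Fin.last n)) ρ))
    (ν := volume.restrict (Metric.closedBall (fun j => u₀ j.castSucc) ρ))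
    (f := fun _ => 1) (g := g) aemeasurable_const hg.aemeasurable
  simp only [one_mul, lintegral_const, Measure.restrict_apply MeasurableSet.univ, univ_inter,
    Real.volume_closedBall] at h2
  exact h2

variable {k : ℕ}

/-- The vectors `∂F/∂z₁, …, ∂F/∂z_k, F`. -/
def coneFrame (F : (Fin k → ℝ) → Euc (k + 2)) (z : Fin k → ℝ) : Fin (k + 1) → Euc (k + 2) :=
  Fin.snoc (α := fun _ => Euc (k + 2)) (fun j => fderiv ℝ F z (Pi.single j 1)) (F z)

/-- The first `k` of `k + 2` coordinates. -/
def headCoords (u : Fin (k + 2) → ℝ) : Fin k → ℝ := fun j => u j.castSucc.castSucc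

/-- The map `(z, t, τ) ↦ t F(z) + τ eᵢ`. -/
def coneMap (F : (Fin k → ℝ) → Euc (k + 2)) (i : Fin (k + 2)) (u : Fin (k + 2) → ℝ) :
    Fin (k + 2) → ℝ :=
  WithLp.ofLp (u (Fin.last k).castSucc • F (headCoords u) +
    u (Fin.last (k + 1)) • EuclideanSpace.single i (1 : ℝ))

theorem contDiff_headCoords : ContDiff ℝ ∞ (headCoords (k := k)) :=
  contDiff_pi.2 fun _ => contDiff_apply _ _ _

theorem contDiffOn_coneMap {F : (Fin k → ℝ) → Euc (k + 2)} {Ω : Set (Fin k → ℝ)}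
    (hF : ContDiffOn ℝ ∞ F Ω) (i : Fin (k + 2)) :
    ContDiffOn ℝ ∞ (coneMap F i) (headCoords ⁻¹' Ω) := by
  have h1 : ContDiffOn ℝ ∞ (fun u => F (headCoords u)) (headCoords ⁻¹' Ω) :=
    hF.comp contDiff_headCoords.contDiffOn fun u hu => hu
  have h2 : ∀ j : Fin (k + 2), ContDiff ℝ ∞ fun u : Fin (k + 2) → ℝ => u j :=
    fun j => contDiff_apply _ _ j
  exact (PiLp.contDiff_ofLp (p := 2)).comp_contDiffOn
    (((h2 _).contDiffOn.smul h1).add ((h2 _).contDiffOn.smul contDiffOn_const))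

/-- With t and τ the last two coordinates, the columns of the Jacobian matrix are t ∂F/∂z_j, F and
eᵢ. The factors t come out, and a determinant with last column eᵢ is a component of the cross
product up to sign. -/
theorem abs_det_fderiv_coneMap {F : (Fin k → ℝ) → Euc (k + 2)} (i : Fin (k + 2))
    {u : Fin (k + 2) → ℝ} (hF : DifferentiableAt ℝ F (headCoords u)) :
    |(fderiv ℝ (coneMap F i) u).det| =
      |u (Fin.last k).castSucc| ^ k * |cross (coneFrame F (headCoords u)) i| := by
  let π : (Fin (k + 2) → ℝ) →L[ℝ] (Fin k → ℝ) :=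
    ContinuousLinearMap.pi fun j => ContinuousLinearMap.proj j.castSucc.castSucc
  have hπ : HasFDerivAt headCoords π u := π.hasFDerivAt
  have hp : ∀ j : Fin (k + 2), HasFDerivAt (fun u : Fin (k + 2) → ℝ => u j)
      (ContinuousLinearMap.proj j : (Fin (k + 2) → ℝ) →L[ℝ] ℝ) u := fun j =>
    (ContinuousLinearMap.proj j : (Fin (k + 2) → ℝ) →L[ℝ] ℝ).hasFDerivAt
  have h1 := ((hp (Fin.last k).castSucc).smul (hF.hasFDerivAt.comp u hπ)).add
    ((hp (Fin.last (k + 1))).smul_const (EuclideanSpace.single i (1 : ℝ)))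
  have h2 := ((PiLp.continuousLinearEquiv 2 ℝ (fun _ : Fin (k + 2) => ℝ)).toContinuousLinearMap.hasFDerivAt).comp
    u h1
  have h3 : HasFDerivAt (coneMap F i) _ u := h2
  rw [h3.fderiv]
  set T := u (Fin.last k).castSucc with hT
  have hπc : ∀ j : Fin k, π (Pi.single j.castSucc.castSucc 1) = Pi.single j 1 := fun j => by
    ext a
    simp [π, Pi.single_apply]
  have hπ1 : π (Pi.single (Fin.last k).castSucc 1) = 0 := by
    ext a
    have : a.castSucc ≠ Fin.last k := (Fin.castSucc_lt_last a).ne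
    simp [π, this]
  have hπ2 : π (Pi.single (Fin.last (k + 1)) 1) = 0 := by
    ext a
    have : a.castSucc.castSucc ≠ Fin.last (k + 1) := (Fin.castSucc_lt_last a.castSucc).ne
    simp [π, this]
  have hl : (Fin.last k).castSucc ≠ Fin.last (k + 1) := (Fin.castSucc_lt_last _).ne
  have hdet : ∀ L : (Fin (k + 2) → ℝ) →L[ℝ] (Fin (k + 2) → ℝ),
      L.det = (Matrix.of fun r c => L (Pi.single c 1) r).det := fun L => by
    have : (Matrix.of fun r c => L (Pi.single c 1) r) =
        LinearMap.toMatrix' (L : (Fin (k + 2) → ℝ) →ₗ[ℝ] (Fin (k + 2) → ℝ)) := by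
      ext r c; rw [LinearMap.toMatrix'_apply]; rfl
    rw [this, LinearMap.det_toMatrix']
  rw [hdet]
  have hcols : (Matrix.of fun r c : Fin (k + 2) =>
      (Fin.snoc (α := fun _ => ℝ) (Fin.snoc (α := fun _ => ℝ) (fun _ : Fin k => T) 1) 1 : Fin (k + 2) → ℝ) c *
      (Matrix.of fun r c => (Fin.snoc (α := fun _ => Euc (k + 2)) (coneFrame F (headCoords u))
        (EuclideanSpace.single i (1 : ℝ)) : Fin (k + 2) → Euc (k + 2)) c r) r c).det =
      T ^ k * ((-1) ^ (k + 1) * cross (coneFrame F (headCoords u)) i) := by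
    rw [Matrix.det_mul_row]
    have := detCols_snoc (coneFrame F (headCoords u)) (EuclideanSpace.single i (1 : ℝ))
    rw [detCols] at this
    have hi : ⟪cross (coneFrame F (headCoords u)), EuclideanSpace.single i (1 : ℝ)⟫ =
        cross (coneFrame F (headCoords u)) i := by
      rw [EuclideanSpace.inner_single_right]; simp
    rw [this, Fin.prod_univ_castSucc, Fin.prod_univ_castSucc, hi]
    simp
  have h4 : |T| ^ k * |cross (coneFrame F (headCoords u)) i| =
      |T ^ k * ((-1) ^ (k + 1) * cross (coneFrame F (headCoords u)) i)| := by
    simp [abs_mul, abs_pow]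
  rw [h4, ← hcols]
  congr 2
  ext r c
  simp only [Matrix.of_apply]
  refine Fin.lastCases ?_ (fun c => ?_) c
  · simp [hπ2, hl]
  · refine Fin.lastCases ?_ (fun c => ?_) c
    · simp [hπ1, hl.symm, coneFrame]
    · have e1 : c.castSucc ≠ Fin.last k := (Fin.castSucc_lt_last c).ne
      have e2 : Fin.last (k + 1) ≠ c.castSucc.castSucc := (Fin.castSucc_lt_last c.castSucc).ne'
      simp [hπc, e1.symm, e2, coneFrame]

/-- The multiplicity bound controls only powers of the Jacobian above the first. This inequality
passes to such a power at the price of an additive constant. -/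
theorem le_one_add_rpow (x : ℝ≥0∞) {q : ℝ} (hq : 0 ≤ q) : x ≤ 1 + x ^ (1 + q) := by
  rcases le_total x 1 with h | h
  · exact h.trans le_self_add
  · calc x = x ^ (1 : ℝ) := (ENNReal.rpow_one x).symm
      _ ≤ x ^ (1 + q) := ENNReal.rpow_le_rpow_of_exponent_le h (by linarith)
      _ ≤ _ := le_add_self

theorem measurable_sine_prod {X : Type*} [MeasurableSpace X] {d : ℕ} {f : X → Euc d × Euc d}
    (hf : Measurable f) : Measurable fun z => sine (f z).1 (f z).2 :=
  Measurable.comp (g := fun p : Euc d × Euc d => GaussLink.sine p.1 p.2) measurable_sine hf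

theorem measurable_sine_comp {X : Type*} [MeasurableSpace X] {d : ℕ} {f : X → Euc d}
    (hf : Measurable f) (w : Euc d) : Measurable fun z => sine (f z) w :=
  measurable_sine_prod (f := fun z => (f z, w)) (hf.prodMk measurable_const)

/-- Projecting off W removes the summand τ e. Since w lies in W, the distance of p from W is at most
its distance ‖p‖ sin∠(p, w) from the line of w. The points T p + τ e stay in a bounded set, where
inserting the Gaussian factor costs only a constant. -/
theorem ofReal_sine_rpow_le {w e p : Euc (k + 2)} (hw : w ≠ 0) (he : ‖e‖ ≤ 1)
    (W : Submodule ℝ (Euc (k + 2))) (hwW : w ∈ W) (heW : e ∈ W) {M T τ s : ℝ} (hM1 : 1 ≤ M)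
    (hM : ‖p‖ ≤ M) (hT1 : 1 ≤ T) (hT2 : T ≤ 2) (hτ : |τ| ≤ 1) (hs : 0 ≤ s) :
    ENNReal.ofReal (sine p w) ^ (-s) ≤
      ENNReal.ofReal (2 * M) ^ s * ENNReal.ofReal (Real.exp ((2 * M + 1) ^ 2)) *
        (ENNReal.ofReal ‖Wᗮ.orthogonalProjectionOnto (T • p + τ • e)‖ ^ (-s) *
          ENNReal.ofReal (Real.exp (-1 * ‖T • p + τ • e‖ ^ 2))) := by
  have e3 : ‖Wᗮ.orthogonalProjectionOnto (T • p + τ • e)‖ ≤ 2 * M * sine p w := by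
    have h0 : Wᗮ.orthogonalProjectionOnto e = 0 :=
      W.orthogonalProjectionOnto_orthogonal_apply_eq_zero heW
    have h1 : ‖Wᗮ.orthogonalProjectionOnto p‖ ≤ ‖(ℝ ∙ w)ᗮ.orthogonalProjectionOnto p‖ := by
      have hle : Wᗮ ≤ (ℝ ∙ w)ᗮ := Submodule.orthogonal_le
        ((Submodule.span_singleton_le_iff_mem _ _).2 hwW)
      rw [← Submodule.orthogonalProjectionOnto_starProjection_of_le hle p]
      exact Wᗮ.norm_orthogonalProjectionOnto_apply_le _
    rw [norm_projection_eq hw] at h1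
    rw [map_add, map_smul, map_smul, h0, smul_zero, add_zero, norm_smul,
      Real.norm_of_nonneg (by linarith)]
    calc T * ‖Wᗮ.orthogonalProjectionOnto p‖ ≤ 2 * (sine p w * M) := by
          refine mul_le_mul hT2 (h1.trans ?_) (norm_nonneg _) (by norm_num)
          exact mul_le_mul_of_nonneg_left hM (sine_nonneg _ _)
      _ = _ := by ring
  have e4 : ‖T • p + τ • e‖ ≤ 2 * M + 1 := by
    refine norm_add_le_of_le ?_ ?_
    · rw [norm_smul, Real.norm_of_nonneg (by linarith)]
      exact mul_le_mul hT2 hM (norm_nonneg _) (by norm_num)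
    · rw [norm_smul, Real.norm_eq_abs]
      exact mul_le_one₀ hτ (norm_nonneg _) he
  have h2M : 0 < 2 * M := by linarith
  have f1 := rpow_neg_le_rpow_neg hs (ENNReal.ofReal_le_ofReal e3)
  rw [ENNReal.ofReal_mul h2M.le, ENNReal.mul_rpow_of_ne_top ENNReal.ofReal_ne_top
    ENNReal.ofReal_ne_top] at f1
  have f2 : ENNReal.ofReal (2 * M) ^ s * ENNReal.ofReal (2 * M) ^ (-s) = 1 := by
    rw [← ENNReal.rpow_add _ _ (by simpa using h2M) ENNReal.ofReal_ne_top,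
      add_neg_cancel, ENNReal.rpow_zero]
  have f3 : 1 ≤ ENNReal.ofReal (Real.exp ((2 * M + 1) ^ 2)) *
      ENNReal.ofReal (Real.exp (-1 * ‖T • p + τ • e‖ ^ 2)) := by
    rw [← ENNReal.ofReal_mul (Real.exp_pos _).le, ← Real.exp_add, ← ENNReal.ofReal_one]
    refine ENNReal.ofReal_le_ofReal (Real.one_le_exp ?_)
    have : ‖T • p + τ • e‖ ^ 2 ≤ (2 * M + 1) ^ 2 := by gcongr
    linarith
  calc ENNReal.ofReal (sine p w) ^ (-s)
      = ENNReal.ofReal (2 * M) ^ s * (ENNReal.ofReal (2 * M) ^ (-s) *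
          ENNReal.ofReal (sine p w) ^ (-s)) * 1 := by
        rw [← mul_assoc, f2, one_mul, mul_one]
    _ ≤ ENNReal.ofReal (2 * M) ^ s *
        ENNReal.ofReal ‖Wᗮ.orthogonalProjectionOnto (T • p + τ • e)‖ ^ (-s) *
          (ENNReal.ofReal (Real.exp ((2 * M + 1) ^ 2)) *
            ENNReal.ofReal (Real.exp (-1 * ‖T • p + τ • e‖ ^ 2))) :=
        mul_le_mul' (mul_le_mul' le_rfl f1) f3
    _ = _ := by ring

set_option maxHeartbeats 1000000 in
/-- For a smooth map `F` of `ℝᵏ` to `ℝᵏ⁺²`, the push-forward of the area of the direction map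
`F / ‖F‖` has locally bounded potentials of every order `s < k`. -/
theorem exists_setLIntegral_norm_cross_le (hk : 1 ≤ k) {F : (Fin k → ℝ) → Euc (k + 2)}
    {Ω : Set (Fin k → ℝ)} (hΩ : IsOpen Ω) (hF : ContDiffOn ℝ ∞ F Ω) {z₀ : Fin k → ℝ}
    (hz₀ : z₀ ∈ Ω) {s : ℝ} (hs0 : 0 ≤ s) (hs : s < k) :
    ∃ ρ > 0, Metric.closedBall z₀ ρ ⊆ Ω ∧ ∃ C : ℝ≥0, ∀ w : Euc (k + 2), w ≠ 0 →
      ∫⁻ z in Metric.closedBall z₀ ρ, ENNReal.ofReal ‖cross (coneFrame F z)‖ *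
        ENNReal.ofReal (sine (F z) w) ^ (-s) ≤ C := by
  have hk' : (1 : ℝ) ≤ k := by exact_mod_cast hk
  obtain ⟨R, hR0, hR⟩ := Metric.nhds_basis_closedBall.mem_iff.1 (hΩ.mem_nhds hz₀)
  set ρ := min (R / 2) (1 / 2) with hρ
  have hρ0 : 0 < ρ := by positivity
  have hρR : ρ < R := (min_le_left _ _).trans_lt (by linarith)
  have hρ1 : ρ ≤ 1 / 2 := min_le_right _ _
  have hsub : Metric.closedBall z₀ ρ ⊆ Ω :=
    (Metric.closedBall_subset_closedBall hρR.le).trans hR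
  refine ⟨ρ, hρ0, hsub, ?_⟩
  obtain ⟨M, hM1, hM⟩ : ∃ M ≥ (1 : ℝ), ∀ z ∈ Metric.closedBall z₀ ρ, ‖F z‖ ≤ M := by
    obtain ⟨M, hM⟩ := (isCompact_closedBall z₀ ρ).exists_bound_of_continuousOn
      (hF.continuousOn.mono hsub)
    exact ⟨max M 1, le_max_right _ _, fun z hz => (hM z hz).trans (le_max_left _ _)⟩
  -- This q is small enough that s(1 + q) is still less than k, the codimension of the plane W used
  -- below.
  set q : ℝ := (k - s) / (2 * k) with hq
  have hq0 : 0 < q := by have : 0 < k - s := by linarith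
                         positivity
  set s' := s * (1 + q) with hs'
  have hs'0 : 0 ≤ s' := by positivity
  have hs'k : s' < k := by
    have h1 : q * k = (k - s) / 2 := by rw [hq]; field_simp
    have h2 : s * q ≤ k * q := by gcongr
    rw [hs']; linarith
  -- F is controlled only on Ω; a globally measurable function agreeing with it on the ball is
  -- needed for Tonelli.
  obtain ⟨Ft, hFt, hFteq⟩ : ∃ Ft : (Fin k → ℝ) → Euc (k + 2), Measurable Ft ∧
      ∀ z ∈ Metric.closedBall z₀ ρ, Ft z = F z := by
    classical
    exact ⟨(Metric.closedBall z₀ ρ).piecewise F 0,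
      (hF.continuousOn.mono hsub).measurable_piecewise continuousOn_const
        Metric.isClosed_closedBall.measurableSet, fun z hz => piecewise_eq_of_mem _ _ _ hz⟩
  obtain ⟨B, hB, hBeq⟩ : ∃ B : (Fin k → ℝ) → Euc (k + 2), Measurable B ∧
      ∀ z ∈ Metric.closedBall z₀ ρ, B z = cross (coneFrame F z) := by
    refine ⟨fun z => cross (Fin.snoc (α := fun _ => Euc (k + 2))
      (fun j => fderiv ℝ F z (Pi.single j 1)) (Ft z)), ?_, fun z hz => ?_⟩
    · refine continuous_cross.measurable.comp (measurable_pi_lambda _ fun a => ?_)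
      refine Fin.lastCases ?_ (fun a => ?_) a
      · simpa using hFt
      · simpa using measurable_fderiv_apply_const ℝ F (Pi.single a 1)
    · simp only [coneFrame, hFteq z hz]
  have hBi : ∀ i, Measurable fun z => ENNReal.ofReal |B z i| := fun i =>
    ((EuclideanSpace.proj (𝕜 := ℝ) i).continuous.measurable.comp hB).abs.ennreal_ofReal
  have hSw : ∀ (w : Euc (k + 2)) (r : ℝ),
      Measurable fun z => ENNReal.ofReal (sine (Ft z) w) ^ r := fun w r =>
    (measurable_sine_comp hFt w).ennreal_ofReal.pow_const r
  -- The centre has t = 3/2 and τ = 0. As ρ ≤ 1/2, the ball has 1 ≤ t ≤ 2 and |τ| ≤ 1/2, and t ≥ 1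
  -- makes the Jacobian of the cone map at least the i-th component of the cross product.
  let u₀ : Fin (k + 2) → ℝ :=
    Fin.snoc (α := fun _ => ℝ) (Fin.snoc (α := fun _ => ℝ) z₀ (3 / 2)) 0
  have hu₀ : headCoords u₀ = z₀ := by ext j; simp [headCoords, u₀]
  have hhead : ∀ u v : Fin (k + 2) → ℝ, dist (headCoords u) (headCoords v) ≤ dist u v :=
    fun u v => (dist_pi_le_iff dist_nonneg).2 fun j => dist_le_pi_dist u v _
  have hball : ∀ r, ∀ u ∈ Metric.closedBall u₀ r, headCoords u ∈ Metric.closedBall z₀ r :=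
    fun r u hu => by
      rw [Metric.mem_closedBall, ← hu₀]; exact (hhead u u₀).trans hu
  obtain ⟨C₁, hC₁⟩ := exists_lintegral_projection_rpow_le (E := Euc (k + 2)) (l := 2) (j := k)
    (by rw [finrank_euclideanSpace_fin]; omega) (c := 1) one_pos hs'0 hs'k
  choose C₂ hC₂ using fun i => exists_setLIntegral_det_rpow_le
    (hΩ.preimage contDiff_headCoords.continuous) (contDiffOn_coneMap hF i) (z₀ := u₀) hρ0.le hρR
    (fun u hu => hR (hball R u hu)) hq0
  set D : ℝ≥0∞ := ENNReal.ofReal (2 * M) ^ s' * ENNReal.ofReal (Real.exp ((2 * M + 1) ^ 2)) with hD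
  have hDtop : D ≠ ⊤ := ENNReal.mul_ne_top
    (ENNReal.rpow_ne_top_of_nonneg hs'0 ENNReal.ofReal_ne_top) ENNReal.ofReal_ne_top
  have hρne : ENNReal.ofReal (2 * ρ) ≠ 0 := by simpa using hρ0
  have hmain : ∀ i, ∀ w : Euc (k + 2), w ≠ 0 →
      ENNReal.ofReal (2 * ρ) * (ENNReal.ofReal (2 * ρ) * ∫⁻ z in Metric.closedBall z₀ ρ,
        ENNReal.ofReal |B z i| ^ (1 + q) * ENNReal.ofReal (sine (Ft z) w) ^ (-s')) ≤
      D * (C₂ i * C₁) := by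
    intro i w hw
    -- In the cone coordinates the singularity at the direction w becomes a singularity along this
    -- plane, since moving along eᵢ does not change the distance to it.
    let W : Submodule ℝ (Euc (k + 2)) := Submodule.span ℝ {w, EuclideanSpace.single i (1 : ℝ)}
    have hW : Module.finrank ℝ W ≤ 2 := by
      classical
      have := finrank_span_finset_le_card (R := ℝ)
        ({w, EuclideanSpace.single i (1 : ℝ)} : Finset (Euc (k + 2)))
      simp only [Finset.coe_insert, Finset.coe_singleton] at this
      exact this.trans Finset.card_le_two
    have hwW : w ∈ W := Submodule.subset_span (by simp)
    have heW : EuclideanSpace.single i (1 : ℝ) ∈ W := Submodule.subset_span (by simp)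
    let h : (Fin (k + 2) → ℝ) → ℝ≥0∞ := fun p =>
      ENNReal.ofReal ‖Wᗮ.orthogonalProjectionOnto (WithLp.toLp 2 p)‖ ^ (-s') *
        ENNReal.ofReal (Real.exp (-1 * ‖(WithLp.toLp 2 p : Euc (k + 2))‖ ^ 2))
    have hh' : Measurable fun p : Euc (k + 2) =>
        ENNReal.ofReal ‖Wᗮ.orthogonalProjectionOnto p‖ ^ (-s') *
        ENNReal.ofReal (Real.exp (-1 * ‖p‖ ^ 2)) := by fun_prop
    have hh : Measurable h :=
      hh'.comp (PiLp.volume_preserving_toLp (Fin (k + 2))).measurable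
    have hhint : ∫⁻ p, h p ≤ C₁ := by
      refine le_trans (le_of_eq ?_) (hC₁ W hW)
      exact (PiLp.volume_preserving_toLp (Fin (k + 2))).lintegral_comp hh'
    have hg : Measurable fun z =>
        ENNReal.ofReal |B z i| ^ (1 + q) * ENNReal.ofReal (sine (Ft z) w) ^ (-s') :=
      ((hBi i).pow_const _).mul (hSw w _)
    have hg' : Measurable fun y : Fin (k + 1) → ℝ =>
        ENNReal.ofReal |B (fun j => y j.castSucc) i| ^ (1 + q) *
          ENNReal.ofReal (sine (Ft fun j => y j.castSucc) w) ^ (-s') :=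
      hg.comp (measurable_pi_lambda _ fun j => measurable_pi_apply _)
    have k1 := setLIntegral_closedBall_comp_init (fun j => u₀ j.castSucc) hρ0.le hg
    have k2 := setLIntegral_closedBall_comp_init u₀ hρ0.le hg'
    rw [k1] at k2
    have hz₀' : (fun j : Fin k => u₀ j.castSucc.castSucc) = z₀ := hu₀
    rw [hz₀'] at k2
    rw [← k2]
    calc ∫⁻ u in Metric.closedBall u₀ ρ, ENNReal.ofReal |B (headCoords u) i| ^ (1 + q) *
          ENNReal.ofReal (sine (Ft (headCoords u)) w) ^ (-s')
        ≤ ∫⁻ u in Metric.closedBall u₀ ρ,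
            D * (ENNReal.ofReal (|(fderiv ℝ (coneMap F i) u).det| ^ (1 + q)) *
              h (coneMap F i u)) := by
          refine setLIntegral_mono' Metric.isClosed_closedBall.measurableSet fun u hu => ?_
          have hzu := hball ρ u hu
          rw [hBeq _ hzu, hFteq _ hzu]
          have hT := (dist_le_pi_dist u u₀ (Fin.last k).castSucc).trans hu
          have hτ := (dist_le_pi_dist u u₀ (Fin.last (k + 1))).trans hu
          simp only [u₀, Fin.snoc_castSucc, Fin.snoc_last, Real.dist_eq, sub_zero] at hT hτ
          set T := u (Fin.last k).castSucc with hTdef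
          set τ := u (Fin.last (k + 1)) with hτdef
          rw [abs_le] at hT
          have hT1 : 1 ≤ T := by linarith
          have hT2 : T ≤ 2 := by linarith
          have hdet := abs_det_fderiv_coneMap i
            ((hF.contDiffAt (hΩ.mem_nhds (hsub hzu))).differentiableAt (by simp))
          rw [← hTdef] at hdet
          have e1 : |cross (coneFrame F (headCoords u)) i| ≤ |(fderiv ℝ (coneMap F i) u).det| := by
            rw [hdet, abs_of_pos (by linarith : 0 < T)]
            exact le_mul_of_one_le_left (abs_nonneg _) (one_le_pow₀ hT1)
          have e5 : ENNReal.ofReal (sine (F (headCoords u)) w) ^ (-s') ≤ D * h (coneMap F i u) :=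
            ofReal_sine_rpow_le hw (by simp) W hwW heW hM1 (hM _ hzu) hT1 hT2 (by linarith) hs'0
          rw [ENNReal.ofReal_rpow_of_nonneg (abs_nonneg _) (by linarith), mul_left_comm]
          refine mul_le_mul' (ENNReal.ofReal_le_ofReal ?_) e5
          exact Real.rpow_le_rpow (abs_nonneg _) e1 (by linarith)
      _ = D * ∫⁻ u in Metric.closedBall u₀ ρ,
            ENNReal.ofReal (|(fderiv ℝ (coneMap F i) u).det| ^ (1 + q)) * h (coneMap F i u) :=
          lintegral_const_mul' _ _ hDtop
      _ ≤ D * (C₂ i * C₁) := mul_le_mul' le_rfl ((hC₂ i h hh).trans (mul_le_mul' le_rfl hhint))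
  set V : ℝ≥0∞ := volume (Metric.closedBall z₀ ρ) with hV
  have hVtop : V ≠ ⊤ := measure_closedBall_lt_top.ne
  set a := ENNReal.ofReal (2 * ρ) with ha
  have hatop : a ≠ ⊤ := ENNReal.ofReal_ne_top
  have hfin : ∑ i, (V + a⁻¹ * (a⁻¹ * (D * (C₂ i * C₁)))) ≠ ⊤ := by
    refine ENNReal.sum_ne_top.2 fun i _ => ENNReal.add_ne_top.2 ⟨hVtop, ?_⟩
    have : a⁻¹ ≠ ⊤ := ENNReal.inv_ne_top.2 hρne
    exact ENNReal.mul_ne_top this (ENNReal.mul_ne_top this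
      (ENNReal.mul_ne_top hDtop (ENNReal.mul_ne_top (by simp) (by simp))))
  refine ⟨(∑ i, (V + a⁻¹ * (a⁻¹ * (D * (C₂ i * C₁))))).toNNReal, fun w hw => ?_⟩
  rw [ENNReal.coe_toNNReal hfin]
  calc ∫⁻ z in Metric.closedBall z₀ ρ, ENNReal.ofReal ‖cross (coneFrame F z)‖ *
        ENNReal.ofReal (sine (F z) w) ^ (-s)
      ≤ ∫⁻ z in Metric.closedBall z₀ ρ, ∑ i, (1 + ENNReal.ofReal |B z i| ^ (1 + q) *
          ENNReal.ofReal (sine (Ft z) w) ^ (-s')) := by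
        refine setLIntegral_mono' Metric.isClosed_closedBall.measurableSet fun z hz => ?_
        rw [← hBeq z hz, hFteq z hz]
        have h1 : ENNReal.ofReal ‖B z‖ ≤ ∑ i, ENNReal.ofReal |B z i| := by
          rw [← ENNReal.ofReal_sum_of_nonneg fun i _ => abs_nonneg _]
          refine ENNReal.ofReal_le_ofReal ?_
          have h2 : B z = ∑ i, B z i • EuclideanSpace.single i (1 : ℝ) := by
            have := (EuclideanSpace.basisFun (Fin (k + 2)) ℝ).sum_repr (B z)
            simpa using this.symm
          conv_lhs => rw [h2]
          refine (norm_sum_le _ _).trans (Finset.sum_le_sum fun i _ => ?_)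
          rw [norm_smul, PiLp.norm_single, norm_one, mul_one, Real.norm_eq_abs]
        refine (mul_le_mul' h1 le_rfl).trans ?_
        rw [Finset.sum_mul]
        refine Finset.sum_le_sum fun i _ => (le_one_add_rpow _ hq0.le).trans (le_of_eq ?_)
        rw [ENNReal.mul_rpow_of_nonneg _ _ (by linarith), ← ENNReal.rpow_mul, hs', neg_mul]
    _ = ∑ i, ∫⁻ z in Metric.closedBall z₀ ρ, (1 + ENNReal.ofReal |B z i| ^ (1 + q) *
          ENNReal.ofReal (sine (Ft z) w) ^ (-s')) :=
        lintegral_finsetSum _ fun i _ =>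
          measurable_const.add (((hBi i).pow_const _).mul (hSw w _))
    _ ≤ ∑ i, (V + a⁻¹ * (a⁻¹ * (D * (C₂ i * C₁)))) := by
        refine Finset.sum_le_sum fun i _ => ?_
        rw [lintegral_add_left measurable_const, setLIntegral_const, one_mul]
        refine add_le_add le_rfl ?_
        have hcancel : ∀ x : ℝ≥0∞, a⁻¹ * (a * x) = x := fun x => by
          rw [← mul_assoc, ENNReal.inv_mul_cancel hρne hatop, one_mul]
        have := mul_le_mul' (le_refl a⁻¹) (mul_le_mul' (le_refl a⁻¹) (hmain i w hw))
        rwa [hcancel, hcancel] at this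

end Energy

/-! ### Averages of products of kernel factors -/

section Averages

variable {Z : Type*} [MeasurableSpace Z] {k : ℕ} {μ ν : Measure Z}
  {A A' : Z → Fin (k + 1) → Euc (k + 2)} {φ φ' : Z → ℝ}

/-- The size of the weighted area element of the direction map of the last column. -/
def areaWeight (φ : Z → ℝ) (A : Z → Fin (k + 1) → Euc (k + 2)) (z : Z) : ℝ≥0∞ :=
  ENNReal.ofReal |φ z| * ENNReal.ofReal (‖cross (A z)‖ * (‖lastCol (A z)‖ ^ (k + 1))⁻¹)

omit [MeasurableSpace Z] in
theorem areaWeight_ne_top (φ : Z → ℝ) (A : Z → Fin (k + 1) → Euc (k + 2)) (z : Z) :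
    areaWeight φ A z ≠ ⊤ :=
  ENNReal.mul_ne_top ENNReal.ofReal_ne_top ENNReal.ofReal_ne_top

/-- The measure with density `areaWeight φ A`, pushed forward by the direction map, has bounded
potential of order `k - 1/2`. -/
def HasBoundedPotential (μ : Measure Z) (φ : Z → ℝ) (A : Z → Fin (k + 1) → Euc (k + 2)) : Prop :=
  ∃ C : ℝ≥0, ∀ w : Euc (k + 2), w ≠ 0 →
    ∫⁻ z, areaWeight φ A z * ENNReal.ofReal (sine (lastCol (A z)) w) ^ (-((k : ℝ) - 1 / 2)) ∂μ ≤ C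

theorem aemeasurable_areaWeight (hφ : AEMeasurable φ μ) (hA : AEMeasurable A μ) :
    AEMeasurable (areaWeight φ A) μ := by
  have h1 : AEMeasurable (fun z => cross (A z)) μ := continuous_cross.measurable.comp_aemeasurable hA
  have h2 : AEMeasurable (fun z => lastCol (A z)) μ :=
    (measurable_pi_apply (Fin.last k)).comp_aemeasurable hA
  exact (Measurable.ennreal_ofReal measurable_id).comp_aemeasurable
    (hφ.norm) |>.mul (h1.norm.mul (h2.norm.pow_const _).inv).ennreal_ofReal

/-- A negative power of a sine is at least 1, so the potential at any single w dominates the total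
area. -/
theorem HasBoundedPotential.lintegral_areaWeight_lt_top (hk : 1 ≤ k)
    (h : HasBoundedPotential μ φ A) : ∫⁻ z, areaWeight φ A z ∂μ < ⊤ := by
  obtain ⟨C, hC⟩ := h
  have hk' : (1 : ℝ) ≤ k := by exact_mod_cast hk
  refine lt_of_le_of_lt (le_trans (lintegral_mono fun z => ?_)
    (hC (EuclideanSpace.single 0 1) (by simp))) ENNReal.coe_lt_top
  refine le_mul_of_one_le_right zero_le ?_
  rw [ENNReal.rpow_neg, ENNReal.one_le_inv]
  exact ENNReal.rpow_le_one (by simpa using sine_le_one _ _) (by linarith)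

theorem aemeasurable_kernelFactor {X : Type*} [MeasurableSpace X] {τ : Measure X}
    {B : X → Fin (k + 1) → Euc (k + 2)} {v : X → Euc (k + 2)} (hB : AEMeasurable B τ)
    (hv : AEMeasurable v τ) : AEMeasurable (fun x => kernelFactor (B x) (v x)) τ := by
  have h := measurable_kernelFactor.comp_aemeasurable (hB.prodMk hv)
  simpa only [Function.comp_def] using h

theorem measurable_kernelFactor_comp {X : Type*} [MeasurableSpace X]
    {B : X → Fin (k + 1) → Euc (k + 2)} {v : X → Euc (k + 2)} (hB : Measurable B)
    (hv : Measurable v) : Measurable fun x => kernelFactor (B x) (v x) := by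
  have h := measurable_kernelFactor.comp (hB.prodMk hv)
  simpa only [Function.comp_def] using h

/-- Replacing φ and A by measurable versions changes them on a null set of Z that does not depend on
v, so the integral is unchanged for every v. Measurability is needed for this very function, since
the measurable structure on the Grassmannian is a quotient and not completed. -/
theorem stronglyMeasurable_integral_kernelFactor [SFinite μ] (hφ : AEMeasurable φ μ)
    (hA : AEMeasurable A μ) :
    StronglyMeasurable fun v => ∫ z, φ z * kernelFactor (A z) v ∂μ := by
  have h : ∀ v, ∫ z, φ z * kernelFactor (A z) v ∂μ =
      ∫ z, hφ.mk φ z * kernelFactor (hA.mk A z) v ∂μ := fun v => by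
    refine integral_congr_ae ?_
    filter_upwards [hφ.ae_eq_mk, hA.ae_eq_mk] with z h1 h2
    rw [h1, h2]
  simp_rw [h]
  refine StronglyMeasurable.integral_prod_right' (f := fun p : Euc (k + 2) × Z =>
    hφ.mk φ p.2 * kernelFactor (hA.mk A p.2) p.1) (Measurable.stronglyMeasurable ?_)
  exact (hφ.measurable_mk.comp measurable_snd).mul (measurable_kernelFactor_comp
    (hA.measurable_mk.comp measurable_snd) measurable_fst)

theorem measurableSet_integrable_kernelFactor [SFinite μ] (hφ : AEMeasurable φ μ)
    (hA : AEMeasurable A μ) :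
    MeasurableSet {v | Integrable (fun z => φ z * kernelFactor (A z) v) μ} := by
  have h : ∀ v, Integrable (fun z => φ z * kernelFactor (A z) v) μ ↔
      Integrable (fun z => hφ.mk φ z * kernelFactor (hA.mk A z) v) μ := fun v => by
    refine integrable_congr ?_
    filter_upwards [hφ.ae_eq_mk, hA.ae_eq_mk] with z h1 h2
    rw [h1, h2]
  simp_rw [h]
  refine measurableSet_integrable (f := fun v z => hφ.mk φ z * kernelFactor (hA.mk A z) v)
    (Measurable.stronglyMeasurable ?_)
  exact (hφ.measurable_mk.comp measurable_snd).mul (measurable_kernelFactor_comp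
    (hA.measurable_mk.comp measurable_snd) measurable_fst)

/-- Tonelli with v integrated innermost: the convolution estimate leaves a negative power of the
sine between the two last columns. The integral over the first variable is then bounded uniformly by
the potential, and the integral over the second is the finite total area. -/
theorem integrable_kernelFactor_mul_kernelFactor [SFinite μ] [SFinite ν] (hk : 1 ≤ k)
    (hφ : AEMeasurable φ μ) (hA : AEMeasurable A μ) (hA0 : ∀ᵐ z ∂μ, lastCol (A z) ≠ 0)
    (hE : HasBoundedPotential μ φ A) (hφ' : AEMeasurable φ' ν) (hA' : AEMeasurable A' ν)
    (hA0' : ∀ᵐ z ∂ν, lastCol (A' z) ≠ 0) (hE' : HasBoundedPotential ν φ' A') :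
    Integrable (fun p : (Z × Z) × Euc (k + 2) => (φ p.1.1 * kernelFactor (A p.1.1) p.2) *
      (φ' p.1.2 * kernelFactor (A' p.1.2) p.2)) ((μ.prod ν).prod (gaussMeasure (k + 2))) := by
  have q1 : Measure.QuasiMeasurePreserving (fun p : (Z × Z) × Euc (k + 2) => p.1.1)
      ((μ.prod ν).prod (gaussMeasure (k + 2))) μ :=
    Measure.quasiMeasurePreserving_fst.comp Measure.quasiMeasurePreserving_fst
  have q2 : Measure.QuasiMeasurePreserving (fun p : (Z × Z) × Euc (k + 2) => p.1.2)
      ((μ.prod ν).prod (gaussMeasure (k + 2))) ν :=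
    Measure.quasiMeasurePreserving_snd.comp Measure.quasiMeasurePreserving_fst
  have hm : AEMeasurable (fun p : (Z × Z) × Euc (k + 2) => (φ p.1.1 * kernelFactor (A p.1.1) p.2) *
      (φ' p.1.2 * kernelFactor (A' p.1.2) p.2)) ((μ.prod ν).prod (gaussMeasure (k + 2))) :=
    ((hφ.comp_quasiMeasurePreserving q1).mul (aemeasurable_kernelFactor
      (hA.comp_quasiMeasurePreserving q1) measurable_snd.aemeasurable)).mul
    ((hφ'.comp_quasiMeasurePreserving q2).mul (aemeasurable_kernelFactor
      (hA'.comp_quasiMeasurePreserving q2) measurable_snd.aemeasurable))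
  refine ⟨hm.aestronglyMeasurable, ?_⟩
  rw [HasFiniteIntegral, lintegral_prod _ hm.enorm]
  obtain ⟨C, hC⟩ := exists_lintegral_sine_mul_sine_le hk
  obtain ⟨D, hD⟩ := hE
  have hbound : ∀ᵐ p ∂(μ.prod ν), ∫⁻ v, ‖(φ p.1 * kernelFactor (A p.1) v) *
      (φ' p.2 * kernelFactor (A' p.2) v)‖ₑ ∂gaussMeasure (k + 2) ≤
      areaWeight φ' A' p.2 * (C * (areaWeight φ A p.1 *
        ENNReal.ofReal (sine (lastCol (A p.1)) (lastCol (A' p.2))) ^ (-((k : ℝ) - 1 / 2)))) := by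
    filter_upwards [Measure.quasiMeasurePreserving_fst.ae hA0,
      Measure.quasiMeasurePreserving_snd.ae hA0'] with p h1 h2
    calc ∫⁻ v, ‖(φ p.1 * kernelFactor (A p.1) v) *
          (φ' p.2 * kernelFactor (A' p.2) v)‖ₑ ∂gaussMeasure (k + 2)
        ≤ ∫⁻ v, areaWeight φ A p.1 * areaWeight φ' A' p.2 *
            (ENNReal.ofReal (sine (lastCol (A p.1)) v) ^ (-(k : ℝ)) *
              ENNReal.ofReal (sine (lastCol (A' p.2)) v) ^ (-(k : ℝ))) ∂gaussMeasure (k + 2) := by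
          refine lintegral_mono fun v => ?_
          rw [enorm_mul, enorm_mul, enorm_mul]
          simp only [Real.enorm_eq_ofReal_abs]
          refine (mul_le_mul' (mul_le_mul' le_rfl (ofReal_abs_kernelFactor_le _ v))
            (mul_le_mul' le_rfl (ofReal_abs_kernelFactor_le _ v))).trans (le_of_eq ?_)
          rw [areaWeight, areaWeight]
          ring
      _ = areaWeight φ A p.1 * areaWeight φ' A' p.2 *
            ∫⁻ v, ENNReal.ofReal (sine (lastCol (A p.1)) v) ^ (-(k : ℝ)) *
              ENNReal.ofReal (sine (lastCol (A' p.2)) v) ^ (-(k : ℝ)) ∂gaussMeasure (k + 2) :=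
          lintegral_const_mul' _ _
            (ENNReal.mul_ne_top (areaWeight_ne_top _ _ _) (areaWeight_ne_top _ _ _))
      _ ≤ areaWeight φ A p.1 * areaWeight φ' A' p.2 * (C * ENNReal.ofReal
            (sine (lastCol (A p.1)) (lastCol (A' p.2))) ^ (-((k : ℝ) - 1 / 2))) :=
          mul_le_mul' le_rfl (hC _ _ h1 h2)
      _ = _ := by ring
  have hlast : ∀ {τ : Measure Z} {B : Z → Fin (k + 1) → Euc (k + 2)}, AEMeasurable B τ →
      AEMeasurable (fun z => lastCol (B z)) τ := fun hB =>
    (measurable_pi_apply (Fin.last k)).comp_aemeasurable hB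
  have hm2 : AEMeasurable (fun p : Z × Z => areaWeight φ' A' p.2 * (C * (areaWeight φ A p.1 *
      ENNReal.ofReal (sine (lastCol (A p.1)) (lastCol (A' p.2))) ^ (-((k : ℝ) - 1 / 2)))))
      (μ.prod ν) := by
    have hs : AEMeasurable (fun p : Z × Z => sine (lastCol (A p.1)) (lastCol (A' p.2)))
        (μ.prod ν) := by
      have h := measurable_sine.comp_aemeasurable (((hlast hA).comp_quasiMeasurePreserving
          (Measure.quasiMeasurePreserving_fst (μ := μ) (ν := ν))).prodMk
        ((hlast hA').comp_quasiMeasurePreserving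
          (Measure.quasiMeasurePreserving_snd (μ := μ) (ν := ν))))
      simpa only [Function.comp_def] using h
    exact ((aemeasurable_areaWeight hφ' hA').comp_quasiMeasurePreserving
      Measure.quasiMeasurePreserving_snd).mul
      ((((aemeasurable_areaWeight hφ hA).comp_quasiMeasurePreserving
        Measure.quasiMeasurePreserving_fst).mul (hs.ennreal_ofReal.pow_const _)).const_mul _)
  refine (lintegral_mono_ae hbound).trans_lt ?_
  rw [lintegral_prod_symm _ hm2]
  have hbound2 : ∀ᵐ z' ∂ν, ∫⁻ z, areaWeight φ' A' z' * (C * (areaWeight φ A z *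
      ENNReal.ofReal (sine (lastCol (A z)) (lastCol (A' z'))) ^ (-((k : ℝ) - 1 / 2)))) ∂μ ≤
      areaWeight φ' A' z' * (C * D) := by
    filter_upwards [hA0'] with z' h2
    rw [lintegral_const_mul' _ _ (areaWeight_ne_top φ' A' z'),
      lintegral_const_mul' _ _ ENNReal.coe_ne_top]
    exact mul_le_mul' le_rfl (mul_le_mul' le_rfl (hD _ h2))
  refine (lintegral_mono_ae hbound2).trans_lt ?_
  rw [lintegral_mul_const' _ _ (ENNReal.mul_ne_top ENNReal.coe_ne_top ENNReal.coe_ne_top)]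
  exact ENNReal.mul_lt_top (hE'.lintegral_areaWeight_lt_top hk)
    (ENNReal.mul_lt_top ENNReal.coe_lt_top ENNReal.coe_lt_top)

omit [MeasurableSpace Z] in
theorem integral_kernelFactor_mul_kernelFactor (p : Z × Z) :
    ∫ v, (φ p.1 * kernelFactor (A p.1) v) * (φ' p.2 * kernelFactor (A' p.2) v)
      ∂gaussMeasure (k + 2) = φ p.1 * φ' p.2 * kernel (A p.1) (A' p.2) := by
  rw [integral_gaussMeasure, kernel, ← integral_const_mul]
  refine integral_congr_ae (ae_of_all _ fun v => ?_)
  ring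

theorem integrable_mul_kernel [SFinite μ] [SFinite ν]
    (hint : Integrable (fun p : (Z × Z) × Euc (k + 2) => (φ p.1.1 * kernelFactor (A p.1.1) p.2) *
      (φ' p.1.2 * kernelFactor (A' p.1.2) p.2)) ((μ.prod ν).prod (gaussMeasure (k + 2)))) :
    Integrable (fun p : Z × Z => φ p.1 * φ' p.2 * kernel (A p.1) (A' p.2)) (μ.prod ν) := by
  refine hint.integral_prod_left.congr (ae_of_all _ fun p => ?_)
  exact integral_kernelFactor_mul_kernelFactor p

theorem integrable_integral_mul_integral [SFinite μ] [SFinite ν]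
    (hint : Integrable (fun p : (Z × Z) × Euc (k + 2) => (φ p.1.1 * kernelFactor (A p.1.1) p.2) *
      (φ' p.1.2 * kernelFactor (A' p.1.2) p.2)) ((μ.prod ν).prod (gaussMeasure (k + 2)))) :
    Integrable (fun v => (∫ z, φ z * kernelFactor (A z) v ∂μ) *
      ∫ z, φ' z * kernelFactor (A' z) v ∂ν) (gaussMeasure (k + 2)) := by
  refine hint.integral_prod_right.congr (ae_of_all _ fun v => ?_)
  exact integral_prod_mul (fun z => φ z * kernelFactor (A z) v)
    (fun z => φ' z * kernelFactor (A' z) v)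

theorem integral_integral_mul_integral [SFinite μ] [SFinite ν]
    (hint : Integrable (fun p : (Z × Z) × Euc (k + 2) => (φ p.1.1 * kernelFactor (A p.1.1) p.2) *
      (φ' p.1.2 * kernelFactor (A' p.1.2) p.2)) ((μ.prod ν).prod (gaussMeasure (k + 2)))) :
    ∫ v, (∫ z, φ z * kernelFactor (A z) v ∂μ) * (∫ z, φ' z * kernelFactor (A' z) v ∂ν)
      ∂gaussMeasure (k + 2) =
      ∫ p, φ p.1 * φ' p.2 * kernel (A p.1) (A' p.2) ∂(μ.prod ν) := by
  have h1 := integral_prod _ hint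
  have h2 := integral_prod_symm _ hint
  rw [h1] at h2
  simp_rw [integral_kernelFactor_mul_kernelFactor] at h2
  rw [h2]
  refine integral_congr_ae (ae_of_all _ fun v => ?_)
  exact (integral_prod_mul (fun z => φ z * kernelFactor (A z) v)
    (fun z => φ' z * kernelFactor (A' z) v)).symm

/-- For almost every v the product f(z) f(z') is integrable over the square of the domain; its norm
has integral (∫|f|)², so f itself is integrable. -/
theorem ae_integrable_kernelFactor [SFinite μ] (hφ : AEMeasurable φ μ) (hA : AEMeasurable A μ)
    (hint : Integrable (fun p : (Z × Z) × Euc (k + 2) => (φ p.1.1 * kernelFactor (A p.1.1) p.2) *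
      (φ p.1.2 * kernelFactor (A p.1.2) p.2)) ((μ.prod μ).prod (gaussMeasure (k + 2)))) :
    ∀ᵐ v ∂gaussMeasure (k + 2), Integrable (fun z => φ z * kernelFactor (A z) v) μ := by
  filter_upwards [hint.prod_left_ae] with v hv
  have hm : AEMeasurable (fun z => φ z * kernelFactor (A z) v) μ :=
    hφ.mul (aemeasurable_kernelFactor hA aemeasurable_const)
  refine ⟨hm.aestronglyMeasurable, ?_⟩
  have h1 := hv.2
  rw [HasFiniteIntegral] at h1
  simp_rw [enorm_mul (φ _ * _)] at h1
  rw [lintegral_prod_mul hm.enorm hm.enorm] at h1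
  rw [HasFiniteIntegral]
  by_contra h
  rw [not_lt, top_le_iff] at h
  rw [h] at h1
  simp at h1

end Averages

/-! ### The energy estimate for a pair of parametrized submanifolds -/

section Pairs

theorem cross_smul {k : ℕ} (c : Fin (k + 1) → ℝ) (a : Fin (k + 1) → Euc (k + 2)) :
    cross (fun i => c i • a i) = (∏ i, c i) • cross a := by
  ext i
  simp only [cross, PiLp.smul_apply, smul_eq_mul]
  have := Matrix.det_mul_column (Fin.cons (α := fun _ => ℝ) 1 c : Fin (k + 2) → ℝ)
    (Matrix.of fun r j =>
      Fin.cons (α := fun _ => Euc (k + 2)) (EuclideanSpace.single i (1 : ℝ)) a r j)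
  rw [Fin.prod_univ_succ] at this
  simp only [Fin.cons_zero, Fin.cons_succ, one_mul] at this
  rw [← this]
  congr 1
  ext r j
  refine Fin.cases ?_ (fun r => ?_) r <;> simp

/-- The derivative of Y - X in the s-directions is -∂X/∂s, so the frame of the cone map and the
configuration vectors differ by signs only. -/
theorem norm_cross_eq_of_forall_eq_or_eq_neg {k : ℕ} {a b : Fin (k + 1) → Euc (k + 2)}
    (h : ∀ i, a i = b i ∨ a i = -b i) : ‖cross a‖ = ‖cross b‖ := by
  have h' : ∀ i, ∃ c : ℝ, |c| = 1 ∧ a i = c • b i := fun i => by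
    rcases h i with h | h
    · exact ⟨1, by simp, by simp [h]⟩
    · exact ⟨-1, by simp, by simp [h]⟩
  choose c hc hac using h'
  rw [show a = fun i => c i • b i from funext hac, cross_smul, norm_smul, Real.norm_eq_abs,
    Finset.abs_prod]
  simp [hc]

variable {m n : ℕ}

/-- The splitting of `ℝᵐ⁺ⁿ` as `ℝᵐ × ℝⁿ`. -/
def splitEquiv (m n : ℕ) : (Fin (m + n) → ℝ) ≃L[ℝ] Euc m × Euc n :=
  LinearEquiv.toContinuousLinearEquiv
    { toFun := fun u => (WithLp.toLp 2 fun i => u (Fin.castAdd n i),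
        WithLp.toLp 2 fun j => u (Fin.natAdd m j))
      invFun := fun z => Fin.append z.1 z.2
      map_add' := fun _ _ => rfl
      map_smul' := fun _ _ => rfl
      left_inv := fun u => by
        ext i
        refine Fin.addCases (fun i => ?_) (fun i => ?_) i <;> simp
      right_inv := fun z => by
        ext i <;> simp }

theorem splitEquiv_apply (u : Fin (m + n) → ℝ) :
    splitEquiv m n u = (WithLp.toLp 2 fun i => u (Fin.castAdd n i),
      WithLp.toLp 2 fun j => u (Fin.natAdd m j)) := rfl

theorem splitEquiv_single_castAdd (i : Fin m) :
    splitEquiv m n (Pi.single (Fin.castAdd n i) 1) = (EuclideanSpace.single i 1, 0) := by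
  rw [splitEquiv_apply]
  ext j
  · simp [Pi.single_apply]
  · have : Fin.natAdd m j ≠ Fin.castAdd n i := fun h => by
      have := congrArg Fin.val h; simp at this; omega
    simp [this]

theorem splitEquiv_single_natAdd (j : Fin n) :
    splitEquiv m n (Pi.single (Fin.natAdd m j) 1) = (0, EuclideanSpace.single j 1) := by
  rw [splitEquiv_apply]
  ext i
  · have : Fin.castAdd n i ≠ Fin.natAdd m j := fun h => by
      have := congrArg Fin.val h; simp at this; omega
    simp [this]
  · simp [Pi.single_apply]

theorem measurePreserving_splitEquiv (m n : ℕ) :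
    MeasurePreserving (splitEquiv m n) volume volume := by
  have h1 := volume_measurePreserving_piCongrLeft (fun _ : Fin m ⊕ Fin n => ℝ)
    finSumFinEquiv.symm
  have h2 := volume_measurePreserving_sumPiEquivProdPi (fun _ : Fin m ⊕ Fin n => ℝ)
  have h3 : MeasurePreserving (Prod.map (WithLp.toLp 2) (WithLp.toLp 2) :
      (Fin m → ℝ) × (Fin n → ℝ) → Euc m × Euc n) volume volume :=
    (PiLp.volume_preserving_toLp (Fin m)).prod (PiLp.volume_preserving_toLp (Fin n))
  have h4 := h3.comp (h2.comp h1)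
  convert h4 using 1
  funext u
  rw [splitEquiv_apply]
  have h5 : ∀ c, MeasurableEquiv.piCongrLeft (fun _ : Fin m ⊕ Fin n => ℝ) finSumFinEquiv.symm u c =
      u (finSumFinEquiv c) := fun c => by
    have := MeasurableEquiv.piCongrLeft_apply_apply (finSumFinEquiv (m := m) (n := n)).symm
      (β := fun _ => ℝ) u (finSumFinEquiv c)
    simpa using this
  ext i <;>
  simp [MeasurableEquiv.coe_sumPiEquivProdPi, Equiv.sumPiEquivProdPi, h5]

/-- The vectors `∂X/∂s₁, …, ∂X/∂s_m, ∂Y/∂t₁, …, ∂Y/∂t_n, Y - X`. -/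
def pairCols (X : Euc m → Euc (m + n + 2)) (Y : Euc n → Euc (m + n + 2)) (z : Euc m × Euc n) :
    Fin (m + n + 1) → Euc (m + n + 2) :=
  Fin.snoc (α := fun _ => Euc (m + n + 2))
    (Fin.append (fun i => fderiv ℝ X z.1 (EuclideanSpace.single i 1))
      (fun j => fderiv ℝ Y z.2 (EuclideanSpace.single j 1))) (Y z.2 - X z.1)

variable {X : Euc m → Euc (m + n + 2)} {Y : Euc n → Euc (m + n + 2)} {Ω₁ : Set (Euc m)}
  {Ω₂ : Set (Euc n)}

theorem lastCol_pairCols (z : Euc m × Euc n) : lastCol (pairCols X Y z) = Y z.2 - X z.1 := by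
  simp [lastCol, pairCols]

theorem norm_cross_coneFrame_eq {u : Fin (m + n) → ℝ}
    (hX : DifferentiableAt ℝ X (splitEquiv m n u).1)
    (hY : DifferentiableAt ℝ Y (splitEquiv m n u).2) :
    ‖cross (coneFrame (fun u => Y (splitEquiv m n u).2 - X (splitEquiv m n u).1) u)‖ =
      ‖cross (pairCols X Y (splitEquiv m n u))‖ := by
  have h1 : HasFDerivAt (fun u => Y (splitEquiv m n u).2 - X (splitEquiv m n u).1) _ u :=
    (hY.hasFDerivAt.comp u ((splitEquiv m n).hasFDerivAt.snd)).sub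
      (hX.hasFDerivAt.comp u ((splitEquiv m n).hasFDerivAt.fst))
  refine norm_cross_eq_of_forall_eq_or_eq_neg fun i => ?_
  refine Fin.lastCases ?_ (fun i => ?_) i
  · left; simp [coneFrame, pairCols]
  · simp only [coneFrame, pairCols, Fin.snoc_castSucc, h1.fderiv]
    refine Fin.addCases (fun i => ?_) (fun i => ?_) i
    · right
      simp [splitEquiv_single_castAdd]
    · left
      simp [splitEquiv_single_natAdd]

theorem continuousOn_pairCols (hΩ₁ : IsOpen Ω₁) (hΩ₂ : IsOpen Ω₂) (hX : ContDiffOn ℝ ∞ X Ω₁)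
    (hY : ContDiffOn ℝ ∞ Y Ω₂) : ContinuousOn (pairCols X Y) (Ω₁ ×ˢ Ω₂) := by
  have h1 : MapsTo Prod.fst (Ω₁ ×ˢ Ω₂) Ω₁ := fun z hz => hz.1
  have h2 : MapsTo Prod.snd (Ω₁ ×ˢ Ω₂) Ω₂ := fun z hz => hz.2
  refine continuousOn_pi.2 fun i => ?_
  refine Fin.lastCases ?_ (fun i => ?_) i
  · simp only [pairCols, Fin.snoc_last]
    exact (hY.continuousOn.comp continuousOn_snd h2).sub (hX.continuousOn.comp continuousOn_fst h1)
  · simp only [pairCols, Fin.snoc_castSucc]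
    refine Fin.addCases (fun i => ?_) (fun i => ?_) i
    · simp only [Fin.append_left]
      exact ((hX.continuousOn_fderiv_of_isOpen hΩ₁ (by simp)).comp continuousOn_fst h1).clm_apply
        continuousOn_const
    · simp only [Fin.append_right]
      exact ((hY.continuousOn_fderiv_of_isOpen hΩ₂ (by simp)).comp continuousOn_snd h2).clm_apply
        continuousOn_const

theorem exists_setLIntegral_pairCols_le (hk : 1 ≤ m + n) (hΩ₁ : IsOpen Ω₁) (hΩ₂ : IsOpen Ω₂)
    (hX : ContDiffOn ℝ ∞ X Ω₁) (hY : ContDiffOn ℝ ∞ Y Ω₂) {z₀ : Euc m × Euc n}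
    (hz₀ : z₀ ∈ Ω₁ ×ˢ Ω₂) {s : ℝ} (hs0 : 0 ≤ s) (hs : s < (m + n : ℕ)) :
    ∃ V ∈ 𝓝 z₀, MeasurableSet V ∧ V ⊆ Ω₁ ×ˢ Ω₂ ∧ ∃ C : ℝ≥0, ∀ w : Euc (m + n + 2), w ≠ 0 →
      ∫⁻ z in V, ENNReal.ofReal ‖cross (pairCols X Y z)‖ *
        ENNReal.ofReal (sine (lastCol (pairCols X Y z)) w) ^ (-s) ≤ C := by
  let e := splitEquiv m n
  have h1 : MapsTo (fun u => (e u).1) (e ⁻¹' (Ω₁ ×ˢ Ω₂)) Ω₁ := fun z hz => hz.1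
  have h2 : MapsTo (fun u => (e u).2) (e ⁻¹' (Ω₁ ×ˢ Ω₂)) Ω₂ := fun z hz => hz.2
  have hF : ContDiffOn ℝ ∞ (fun u => Y (e u).2 - X (e u).1) (e ⁻¹' (Ω₁ ×ˢ Ω₂)) :=
    (hY.comp e.contDiff.snd.contDiffOn h2).sub (hX.comp e.contDiff.fst.contDiffOn h1)
  obtain ⟨ρ, hρ, hsub, C, hC⟩ := exists_setLIntegral_norm_cross_le hk
    ((hΩ₁.prod hΩ₂).preimage e.continuous) hF (z₀ := e.symm z₀) (by simpa using hz₀) hs0 hs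
  have hpre : e ⁻¹' (e.symm ⁻¹' Metric.closedBall (e.symm z₀) ρ) =
      Metric.closedBall (e.symm z₀) ρ := by ext; simp
  have hV : MeasurableSet (e.symm ⁻¹' Metric.closedBall (e.symm z₀) ρ) :=
    (Metric.isClosed_closedBall.preimage e.symm.continuous).measurableSet
  refine ⟨e.symm ⁻¹' Metric.closedBall (e.symm z₀) ρ,
    e.symm.continuous.continuousAt.preimage_mem_nhds (Metric.closedBall_mem_nhds _ hρ), hV,
    fun z hz => by simpa using hsub hz, C, fun w hw => ?_⟩
  have h3 := (measurePreserving_splitEquiv m n).setLIntegral_comp_preimage_emb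
    e.toHomeomorph.measurableEmbedding (fun z => ENNReal.ofReal ‖cross (pairCols X Y z)‖ *
        ENNReal.ofReal (sine (lastCol (pairCols X Y z)) w) ^ (-s))
    (e.symm ⁻¹' Metric.closedBall (e.symm z₀) ρ)
  rw [← h3]
  refine le_trans (le_of_eq ?_) (hC w hw)
  have h4 : (splitEquiv m n) ⁻¹' (e.symm ⁻¹' Metric.closedBall (e.symm z₀) ρ) =
      Metric.closedBall (e.symm z₀) ρ := hpre
  rw [h4]
  refine setLIntegral_congr_fun Metric.isClosed_closedBall.measurableSet fun u hu => ?_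
  have hu' : e u ∈ Ω₁ ×ˢ Ω₂ := hsub hu
  simp only [lastCol_pairCols]
  rw [norm_cross_coneFrame_eq
    ((hX.contDiffAt (hΩ₁.mem_nhds hu'.1)).differentiableAt (by simp))
    ((hY.contDiffAt (hΩ₂.mem_nhds hu'.2)).differentiableAt (by simp))]

/-- The local estimate passes to the compact set K by a finite cover. On K the vector Y - X is
bounded away from zero, so the factor ‖a_N‖^(-N) of the area weight is bounded. -/
theorem hasBoundedPotential_pairCols (hk : 1 ≤ m + n) (hΩ₁ : IsOpen Ω₁) (hΩ₂ : IsOpen Ω₂)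
    (hX : ContDiffOn ℝ ∞ X Ω₁) (hY : ContDiffOn ℝ ∞ Y Ω₂)
    (hXY : ∀ z ∈ Ω₁ ×ˢ Ω₂, Y z.2 - X z.1 ≠ 0) {φ : Euc m × Euc n → ℝ}
    {K : Set (Euc m × Euc n)} (hK : IsCompact K) (hKΩ : K ⊆ Ω₁ ×ˢ Ω₂)
    (hφ : ∀ z ∈ Ω₁ ×ˢ Ω₂, |φ z| ≤ 1) (hφK : ∀ z ∈ Ω₁ ×ˢ Ω₂, z ∉ K → φ z = 0) :
    HasBoundedPotential (volume.restrict (Ω₁ ×ˢ Ω₂)) φ (pairCols X Y) := by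
  have hk' : (1 : ℝ) ≤ (m + n : ℕ) := by exact_mod_cast hk
  have hΩ : MeasurableSet (Ω₁ ×ˢ Ω₂) := (hΩ₁.prod hΩ₂).measurableSet
  obtain ⟨C, hC⟩ : ∃ C : ℝ≥0, ∀ w : Euc (m + n + 2), w ≠ 0 →
      ∫⁻ z in K, ENNReal.ofReal ‖cross (pairCols X Y z)‖ *
        ENNReal.ofReal (sine (lastCol (pairCols X Y z)) w) ^ (-(((m + n : ℕ) : ℝ) - 1 / 2)) ≤ C := by
    refine hK.induction_on (p := fun K => ∃ C : ℝ≥0, ∀ w : Euc (m + n + 2), w ≠ 0 →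
      ∫⁻ z in K, ENNReal.ofReal ‖cross (pairCols X Y z)‖ *
        ENNReal.ofReal (sine (lastCol (pairCols X Y z)) w) ^ (-(((m + n : ℕ) : ℝ) - 1 / 2)) ≤ C)
      ⟨0, fun w _ => by simp⟩ ?_ ?_ ?_
    · rintro S T hST ⟨C, hC⟩
      exact ⟨C, fun w hw => (lintegral_mono_set hST).trans (hC w hw)⟩
    · rintro S T ⟨C, hC⟩ ⟨D, hD⟩
      refine ⟨C + D, fun w hw => (lintegral_union_le _ _ _).trans ?_⟩
      rw [ENNReal.coe_add]
      exact add_le_add (hC w hw) (hD w hw)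
    · intro z hz
      obtain ⟨V, hV, -, -, hC⟩ := exists_setLIntegral_pairCols_le hk hΩ₁ hΩ₂ hX hY (hKΩ hz)
        (s := ((m + n : ℕ) : ℝ) - 1 / 2) (by linarith) (by linarith)
      exact ⟨V, mem_nhdsWithin_of_mem_nhds hV, hC⟩
  obtain ⟨B, hB⟩ : ∃ B : ℝ, ∀ z ∈ K, ‖(‖lastCol (pairCols X Y z)‖ ^ (m + n + 1))⁻¹‖ ≤ B := by
    refine hK.exists_bound_of_continuousOn (ContinuousOn.inv₀ ?_ fun z hz => ?_)
    · exact (((continuousOn_pi.1 (continuousOn_pairCols hΩ₁ hΩ₂ hX hY) (Fin.last _)).mono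
        hKΩ).norm.pow _)
    · rw [lastCol_pairCols]
      exact pow_ne_zero _ (norm_ne_zero_iff.2 (hXY z (hKΩ hz)))
  refine ⟨B.toNNReal * C, fun w hw => ?_⟩
  rw [ENNReal.coe_mul]
  calc ∫⁻ z in Ω₁ ×ˢ Ω₂, areaWeight φ (pairCols X Y) z * ENNReal.ofReal
          (sine (lastCol (pairCols X Y z)) w) ^ (-(((m + n : ℕ) : ℝ) - 1 / 2))
      ≤ ∫⁻ z in Ω₁ ×ˢ Ω₂, K.indicator (fun z => B.toNNReal *
          (ENNReal.ofReal ‖cross (pairCols X Y z)‖ *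
          ENNReal.ofReal (sine (lastCol (pairCols X Y z)) w) ^
            (-(((m + n : ℕ) : ℝ) - 1 / 2)))) z := by
        refine setLIntegral_mono' hΩ fun z hz => ?_
        by_cases hzK : z ∈ K
        · rw [indicator_of_mem hzK, ← mul_assoc]
          refine mul_le_mul' ?_ le_rfl
          rw [areaWeight, mul_comm ‖cross _‖, ENNReal.ofReal_mul (by positivity), ← mul_assoc]
          refine mul_le_mul' ?_ le_rfl
          calc ENNReal.ofReal |φ z| *
                ENNReal.ofReal (‖lastCol (pairCols X Y z)‖ ^ (m + n + 1))⁻¹ ≤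
              1 * ENNReal.ofReal B := by
                refine mul_le_mul' ?_ (ENNReal.ofReal_le_ofReal ((le_abs_self _).trans (hB z hzK)))
                rw [← ENNReal.ofReal_one]
                exact ENNReal.ofReal_le_ofReal (hφ z hz)
            _ = _ := one_mul _
        · rw [areaWeight, hφK z hz hzK]; simp
    _ ≤ ∫⁻ z, K.indicator (fun z => B.toNNReal *
          (ENNReal.ofReal ‖cross (pairCols X Y z)‖ *
          ENNReal.ofReal (sine (lastCol (pairCols X Y z)) w) ^
            (-(((m + n : ℕ) : ℝ) - 1 / 2)))) z := setLIntegral_le_lintegral _ _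
    _ = B.toNNReal * ∫⁻ z in K, (ENNReal.ofReal ‖cross (pairCols X Y z)‖ *
          ENNReal.ofReal (sine (lastCol (pairCols X Y z)) w) ^
            (-(((m + n : ℕ) : ℝ) - 1 / 2))) := by
        rw [lintegral_indicator hK.isClosed.measurableSet,
          lintegral_const_mul' _ _ ENNReal.coe_ne_top]
    _ ≤ _ := mul_le_mul' le_rfl (hC w hw)

/-- Where the cross product is nonzero and the sine vanishes, the integrand of the local estimate
with s = 1/2 is infinite. As its integral is finite, this happens only on a null set. -/
theorem ae_cross_eq_zero_or_sine_ne_zero (hk : 1 ≤ m + n) (hΩ₁ : IsOpen Ω₁) (hΩ₂ : IsOpen Ω₂)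
    (hX : ContDiffOn ℝ ∞ X Ω₁) (hY : ContDiffOn ℝ ∞ Y Ω₂) {w : Euc (m + n + 2)} (hw : w ≠ 0) :
    ∀ᵐ z ∂(volume.restrict (Ω₁ ×ˢ Ω₂)),
      cross (pairCols X Y z) = 0 ∨ sine (lastCol (pairCols X Y z)) w ≠ 0 := by
  have hk' : (1 : ℝ) ≤ (m + n : ℕ) := by exact_mod_cast hk
  have hΩ : MeasurableSet (Ω₁ ×ˢ Ω₂) := (hΩ₁.prod hΩ₂).measurableSet
  rw [ae_restrict_iff' hΩ, ae_iff]
  refine measure_null_of_locally_null _ fun z hz => ?_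
  simp only [mem_ofPred_eq, Classical.not_imp] at hz
  obtain ⟨V, hV, hVm, hVΩ, C, hC⟩ := exists_setLIntegral_pairCols_le hk hΩ₁ hΩ₂ hX hY hz.1
    (s := 1 / 2) (by norm_num) (by linarith)
  refine ⟨V ∩ {z | ¬(z ∈ Ω₁ ×ˢ Ω₂ → cross (pairCols X Y z) = 0 ∨
    sine (lastCol (pairCols X Y z)) w ≠ 0)}, inter_mem (mem_nhdsWithin_of_mem_nhds hV)
    self_mem_nhdsWithin, ?_⟩
  have hA : AEMeasurable (pairCols X Y) (volume.restrict V) :=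
    ((continuousOn_pairCols hΩ₁ hΩ₂ hX hY).mono hVΩ).aemeasurable hVm
  have hl : AEMeasurable (fun z => sine (lastCol (pairCols X Y z)) w) (volume.restrict V) := by
    have := (measurable_sine_comp (measurable_pi_apply (Fin.last (m + n))) w).comp_aemeasurable hA
    simpa only [Function.comp_def, lastCol] using this
  have h1 := ae_lt_top' ((continuous_cross.measurable.comp_aemeasurable hA).norm.ennreal_ofReal.mul
    (hl.ennreal_ofReal.pow_const (-(1 / 2)))) ((hC w hw).trans_lt ENNReal.coe_lt_top).ne
  rw [ae_restrict_iff' hVm, ae_iff] at h1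
  refine measure_mono_null (fun z hz => ?_) h1
  obtain ⟨hzV, hz2⟩ := hz
  simp only [mem_ofPred_eq, Classical.not_imp, not_or, not_not] at hz2 ⊢
  refine ⟨hzV, ?_⟩
  have h3 : ENNReal.ofReal ‖cross (pairCols X Y z)‖ ≠ 0 := by
    simpa using hz2.2.1
  simp only [Function.comp_def, Pi.mul_apply, hz2.2.2, ENNReal.ofReal_zero]
  rw [ENNReal.zero_rpow_of_neg (by norm_num), ENNReal.mul_top h3]
  simp

end Pairs

/-! ### Null sets of directions -/

section NullSets

/-- Lebesgue measure is identified with d-dimensional Hausdorff measure for the sup norm, and a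
linear isomorphism preserves Hausdorff dimension. -/
theorem volume_eq_zero_of_dimH_lt {d : ℕ} {S : Set (Euc d)} (h : dimH S < d) : volume S = 0 := by
  let e : Euc d ≃L[ℝ] (Fin d → ℝ) := PiLp.continuousLinearEquiv 2 ℝ fun _ => ℝ
  have h1 : volume (e '' S) = 0 := by
    have h2 : dimH (e '' S) < d := by rwa [ContinuousLinearEquiv.dimH_image]
    have h3 : (volume : Measure (Fin d → ℝ)) ≪ Measure.hausdorffMeasure ((d : ℝ≥0) : ℝ) := by
      have := hausdorffMeasure_pi_real (ι := Fin d)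
      rw [Fintype.card_fin] at this
      rw [NNReal.coe_natCast, this]
    exact measure_zero_of_dimH_lt h3 (by simpa using h2)
  have h2 := (PiLp.volume_preserving_ofLp (Fin d)).measure_preimage_equiv
    (f := (MeasurableEquiv.toLp 2 (Fin d → ℝ)).symm) (e '' S)
  have h3 : (MeasurableEquiv.toLp 2 (Fin d → ℝ)).symm ⁻¹' (e '' S) = S :=
    e.toEquiv.preimage_image S
  rw [← h3, h2, h1]

/-- The cone is a locally Lipschitz image of a subset of a space of dimension m + n + 1, one less
than the ambient dimension. It contains the nonzero directions along which points of the two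
submanifolds are projected together. -/
theorem volume_cone_eq_zero {m n : ℕ} {X : Euc m → Euc (m + n + 2)} {Y : Euc n → Euc (m + n + 2)}
    {Ω₁ : Set (Euc m)} {Ω₂ : Set (Euc n)} (hΩ₁ : IsOpen Ω₁) (hΩ₂ : IsOpen Ω₂)
    (hX : ContDiffOn ℝ ∞ X Ω₁) (hY : ContDiffOn ℝ ∞ Y Ω₂) :
    volume ((fun p : (Euc m × Euc n) × ℝ => p.2 • (X p.1.1 - Y p.1.2)) ''
      ((Ω₁ ×ˢ Ω₂) ×ˢ univ)) = 0 := by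
  refine volume_eq_zero_of_dimH_lt ?_
  have h1 : ∀ p ∈ (Ω₁ ×ˢ Ω₂) ×ˢ (univ : Set ℝ),
      ContDiffAt ℝ 1 (fun p : (Euc m × Euc n) × ℝ => p.2 • (X p.1.1 - Y p.1.2)) p := by
    rintro p ⟨⟨hp1, hp2⟩, -⟩
    have hX' := (hX.contDiffAt (hΩ₁.mem_nhds hp1)).of_le (m := 1) (by norm_cast)
    have hY' := (hY.contDiffAt (hΩ₂.mem_nhds hp2)).of_le (m := 1) (by norm_cast)
    exact contDiffAt_snd.smul ((hX'.comp p contDiffAt_fst.fst).sub (hY'.comp p contDiffAt_fst.snd))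
  calc dimH _ ≤ dimH ((Ω₁ ×ˢ Ω₂) ×ˢ (univ : Set ℝ)) := by
        refine dimH_image_le_of_locally_lipschitzOn fun p hp => ?_
        obtain ⟨K, t, ht, hK⟩ := (h1 p hp).exists_lipschitzOnWith
        exact ⟨K, t, mem_nhdsWithin_of_mem_nhds ht, hK⟩
    _ ≤ dimH (univ : Set ((Euc m × Euc n) × ℝ)) := dimH_mono (subset_univ _)
    _ = ((m + n + 1 : ℕ) : ℝ≥0∞) := by
        rw [Real.dimH_univ_eq_finrank]
        simp
    _ < _ := by exact_mod_cast Nat.lt_succ_self _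

end NullSets

/-! ### Gaussian directions are uniform on the sphere -/

section Directions

variable {k : ℕ}

open Classical in
/-- The direction of a vector as a point of the unit sphere. -/
def unitDir (v : Euc (k + 2)) : Metric.sphere (0 : Euc (k + 2)) 1 :=
  if h : v = 0 then ⟨EuclideanSpace.single 0 1, by simp⟩ else ⟨dir v, by simp [norm_dir h]⟩

theorem coe_unitDir {v : Euc (k + 2)} (hv : v ≠ 0) : (unitDir v : Euc (k + 2)) = dir v := by
  rw [unitDir, dif_neg hv]

theorem measurable_unitDir : Measurable (unitDir (k := k)) := by
  classical
  refine Measurable.subtype_mk (f := fun v : Euc (k + 2) => (unitDir v : Euc (k + 2)))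
    (h := fun v => (unitDir v).2) ?_
  have : (fun v : Euc (k + 2) => (unitDir v : Euc (k + 2))) =
      fun v => if v = 0 then EuclideanSpace.single 0 1 else dir v := by
    funext v
    by_cases h : v = 0 <;> simp [unitDir, h]
  rw [this]
  exact Measurable.ite (measurableSet_singleton 0) measurable_const measurable_dir

/-- The Gaussian density is radial, so in polar coordinates the push-forward is a constant multiple
of surface measure. Total mass 1 determines the constant. -/
theorem map_unitDir (k : ℕ) : (gaussMeasure (k + 2)).map unitDir =
    ((volume : Measure (Euc (k + 2))).toSphere univ)⁻¹ •
      (volume : Measure (Euc (k + 2))).toSphere := by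
  have hmp := (volume : Measure (Euc (k + 2))).measurePreserving_homeomorphUnitSphereProd
  set c : ℝ≥0∞ := ∫⁻ r : Ioi (0 : ℝ), ENNReal.ofReal
    ((2 * Real.pi) ^ (-((k + 2 : ℕ) : ℝ) / 2) * Real.exp (-(r : ℝ) ^ 2 / 2))
      ∂Measure.volumeIoiPow (Module.finrank ℝ (Euc (k + 2)) - 1) with hc
  have key : ∀ s : Set (Metric.sphere (0 : Euc (k + 2)) 1), MeasurableSet s →
      (gaussMeasure (k + 2)).map unitDir s =
        (volume : Measure (Euc (k + 2))).toSphere s * c := by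
    intro s hs
    have hs' := measurable_unitDir hs
    rw [Measure.map_apply measurable_unitDir hs, ← lintegral_indicator_one hs',
      lintegral_gaussMeasure (measurable_one.indicator hs'),
      ← setLIntegral_univ, ← compl_union_self ({0} : Set (Euc (k + 2)))]
    rw [lintegral_union (measurableSet_singleton _) disjoint_compl_left]
    simp only [lintegral_singleton, measure_singleton, mul_zero, add_zero]
    rw [← lintegral_subtype_comap (measurableSet_singleton (0 : Euc (k + 2))).compl]
    have hf : Measurable fun p : Metric.sphere (0 : Euc (k + 2)) 1 × Ioi (0 : ℝ) =>
        s.indicator 1 p.1 * ENNReal.ofReal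
          ((2 * Real.pi) ^ (-((k + 2 : ℕ) : ℝ) / 2) * Real.exp (-(p.2 : ℝ) ^ 2 / 2)) := by
      have h1 : Measurable fun p : Metric.sphere (0 : Euc (k + 2)) 1 × Ioi (0 : ℝ) =>
          s.indicator (1 : Metric.sphere (0 : Euc (k + 2)) 1 → ℝ≥0∞) p.1 := (measurable_one.indicator hs).comp measurable_fst
      fun_prop
    have h2 := hmp.lintegral_comp hf
    have hg : Measurable fun r : Ioi (0 : ℝ) => ENNReal.ofReal
        ((2 * Real.pi) ^ (-((k + 2 : ℕ) : ℝ) / 2) * Real.exp (-(r : ℝ) ^ 2 / 2)) := by fun_prop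
    have h5 := lintegral_prod_mul (μ := (volume : Measure (Euc (k + 2))).toSphere)
      (ν := Measure.volumeIoiPow (Module.finrank ℝ (Euc (k + 2)) - 1))
      (measurable_one.indicator hs).aemeasurable hg.aemeasurable
    rw [lintegral_indicator_one hs] at h5
    rw [h5] at h2
    rw [hc, ← h2]
    refine lintegral_congr fun x => ?_
    have hx : (x : Euc (k + 2)) ≠ 0 := x.2
    have h3 : unitDir (x : Euc (k + 2)) = (homeomorphUnitSphereProd (Euc (k + 2)) x).1 := by
      ext1
      rw [coe_unitDir hx, homeomorphUnitSphereProd_apply_fst_coe]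
      rfl
    have h4 : ((homeomorphUnitSphereProd (Euc (k + 2)) x).2 : ℝ) = ‖(x : Euc (k + 2))‖ :=
      homeomorphUnitSphereProd_apply_snd_coe _ _
    rw [h4, ← h3, gaussDensity]
    rfl
  have huniv : (volume : Measure (Euc (k + 2))).toSphere univ * c = 1 := by
    rw [← key univ MeasurableSet.univ, Measure.map_apply measurable_unitDir MeasurableSet.univ]
    simp
  have hc' : c = ((volume : Measure (Euc (k + 2))).toSphere univ)⁻¹ :=
    ENNReal.eq_inv_of_mul_eq_one_left (by rwa [mul_comm])
  ext s hs
  rw [key s hs, hc', mul_comm]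
  rfl

theorem hyperplaneMeasure_eq_map (k : ℕ) : hyperplaneMeasure k =
    (gaussMeasure (k + 2)).map (normalHyperplane k ∘ unitDir) := by
  rw [hyperplaneMeasure, ← map_unitDir, Measure.map_map (measurable_normalHyperplane k)
    measurable_unitDir]

theorem measurable_normalHyperplane_unitDir (k : ℕ) :
    Measurable (normalHyperplane k ∘ unitDir) :=
  (measurable_normalHyperplane k).comp measurable_unitDir

theorem ae_gaussMeasure_ne_zero (k : ℕ) : ∀ᵐ v ∂gaussMeasure (k + 2), v ≠ 0 :=
  (gaussMeasure_absolutelyContinuous _).ae_le (compl_mem_ae_iff.2 (measure_singleton _))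

theorem dir_dir {d : ℕ} (v : Euc d) : dir (dir v) = dir v := by
  rcases eq_or_ne v 0 with rfl | hv
  · rw [dir_zero, dir_zero]
  · rw [dir, norm_dir hv, inv_one, one_smul]

theorem kernelFactor_dir (A : Fin (k + 1) → Euc (k + 2)) {v : Euc (k + 2)} (hv : v ≠ 0) :
    kernelFactor A (dir v) = kernelFactor A v := by
  have hv' : ‖v‖⁻¹ ≠ 0 := inv_ne_zero (norm_ne_zero_iff.2 hv)
  have h1 : dir v ≠ 0 := smul_ne_zero hv' hv
  rw [kernelFactor_eq A hv, kernelFactor_eq A h1, dir_dir]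
  congr 3
  rw [sine, sine, dir, InnerProductGeometry.angle_smul_right_of_pos _ _ (by positivity)]

end Directions

/-! ### Volume forms of hyperplanes -/

section VolumeForm

variable {k : ℕ}

theorem sq_det_cons_eq_one {v : Euc (k + 2)} (hv : ‖v‖ = 1)
    (e : OrthonormalBasis (Fin (k + 1)) ℝ ((ℝ ∙ v)ᗮ : Submodule ℝ (Euc (k + 2)))) :
    ((EuclideanSpace.basisFun (Fin (k + 2)) ℝ).toBasis.det
      (Fin.cons (α := fun _ => Euc (k + 2)) v fun i => (e i : Euc (k + 2)))) ^ 2 = 1 := by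
  set f : Fin (k + 2) → Euc (k + 2) :=
    Fin.cons (α := fun _ => Euc (k + 2)) v fun i => (e i : Euc (k + 2)) with hf
  have hve : ∀ i, ⟪v, (e i : Euc (k + 2))⟫ = 0 := fun i =>
    (Submodule.mem_orthogonal_singleton_iff_inner_right.1 (e i).2)
  have hon : ∀ i j, ⟪f i, f j⟫ = if i = j then 1 else 0 := by
    intro i j
    refine Fin.cases ?_ (fun i => ?_) i <;> refine Fin.cases ?_ (fun j => ?_) j
    · simp [hf, hv]
    · simp [hf, hve, (Fin.succ_ne_zero j).symm]
    · simp [hf, real_inner_comm, hve, Fin.succ_ne_zero i]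
    · have := orthonormal_iff_ite.1 e.orthonormal i j
      rw [Submodule.coe_inner] at this
      simpa [hf] using this
  rw [Module.Basis.det_apply, sq]
  nth_rw 1 [← Matrix.det_transpose]
  rw [← Matrix.det_mul]
  convert Matrix.det_one (n := Fin (k + 2)) (R := ℝ) using 2
  ext i j
  rw [Matrix.mul_apply, Matrix.one_apply, ← hon i j]
  simp [PiLp.inner_apply, Module.Basis.toMatrix_apply, mul_comm]

theorem basisFun_det_cons (v : Euc (k + 2)) (w : Fin (k + 1) → Euc (k + 2)) :
    (EuclideanSpace.basisFun (Fin (k + 2)) ℝ).toBasis.det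
      (Fin.cons (α := fun _ => Euc (k + 2)) v w) = ⟪cross w, v⟫ := by
  rw [inner_cross, Module.Basis.det_apply, ← Matrix.det_transpose]
  congr 1

/-- Projection to v^⊥ subtracts multiples of v, which is itself a row of the determinant. -/
theorem inner_cross_projection {v : Euc (k + 2)} (hv : ‖v‖ = 1)
    (w : Fin (k + 1) → Euc (k + 2)) :
    ⟪cross fun i => ((ℝ ∙ v)ᗮ.orthogonalProjectionOnto (w i) : Euc (k + 2)), v⟫ =
      ⟪cross w, v⟫ := by
  rw [inner_cross, inner_cross]
  refine Matrix.det_eq_of_forall_row_eq_smul_add_const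
    (Fin.cons (α := fun _ => ℝ) 0 fun i => -⟪v, w i⟫) 0 (by simp) fun i j => ?_
  refine Fin.cases ?_ (fun i => ?_) i
  · simp
  · have h1 : ((ℝ ∙ v)ᗮ.orthogonalProjectionOnto (w i) : Euc (k + 2)) = w i - ⟪v, w i⟫ • v := by
      have := (ℝ ∙ v).starProjection_add_starProjection_orthogonal (w i)
      rw [Submodule.starProjection_unit_singleton ℝ hv] at this
      exact eq_sub_of_add_eq' this
    simp only [Matrix.of_apply, Fin.cons_succ, Fin.cons_zero, h1, PiLp.sub_apply, PiLp.smul_apply,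
      smul_eq_mul]
    ring

/-- A volume form of `v^⊥`, evaluated on projections, is up to sign the determinant with `v`
added. -/
theorem exists_volumeForm_projection_eq {v : Euc (k + 2)} (hv : ‖v‖ = 1)
    [Fact (Module.finrank ℝ ((ℝ ∙ v)ᗮ : Submodule ℝ (Euc (k + 2))) = k + 1)]
    (o : Orientation ℝ ((ℝ ∙ v)ᗮ : Submodule ℝ (Euc (k + 2))) (Fin (k + 1))) :
    ∃ σ : ℝ, σ ^ 2 = 1 ∧ ∀ w : Fin (k + 1) → Euc (k + 2),
      o.volumeForm (fun i => (ℝ ∙ v)ᗮ.orthogonalProjectionOnto (w i)) = σ * ⟪cross w, v⟫ := by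
  have hfr : Module.finrank ℝ ((ℝ ∙ v)ᗮ : Submodule ℝ (Euc (k + 2))) = k + 1 := Fact.out
  let e : OrthonormalBasis (Fin (k + 1)) ℝ ((ℝ ∙ v)ᗮ : Submodule ℝ (Euc (k + 2))) :=
    (stdOrthonormalBasis ℝ _).reindex (finCongr hfr)
  -- g is the ambient determinant with v in the first place, restricted to v^⊥. Both g and the
  -- volume form are top-degree alternating forms, hence multiples of the determinant in the
  -- orthonormal basis e, and each takes a value ±1 on e.
  let g := ((EuclideanSpace.basisFun (Fin (k + 2)) ℝ).toBasis.det.curryLeft v).compLinearMap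
    ((ℝ ∙ v)ᗮ : Submodule ℝ (Euc (k + 2))).subtype
  have hg : ∀ a, g a = (EuclideanSpace.basisFun (Fin (k + 2)) ℝ).toBasis.det
      (Fin.cons (α := fun _ => Euc (k + 2)) v fun i => (a i : Euc (k + 2))) := fun a => rfl
  have h1 := AlternatingMap.eq_smul_basis_det e.toBasis o.volumeForm
  have h2 := AlternatingMap.eq_smul_basis_det e.toBasis g
  have h3 : o.volumeForm e.toBasis ^ 2 = 1 := by
    rw [← sq_abs, OrthonormalBasis.coe_toBasis, o.abs_volumeForm_apply_of_orthonormal, one_pow]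
  have h4 : g e.toBasis ^ 2 = 1 := by
    rw [hg, OrthonormalBasis.coe_toBasis]
    exact sq_det_cons_eq_one hv e
  refine ⟨o.volumeForm e.toBasis * g e.toBasis, by rw [mul_pow, h3, h4, one_mul], fun w => ?_⟩
  rw [← inner_cross_projection hv w, ← basisFun_det_cons,
    ← hg fun i => (ℝ ∙ v)ᗮ.orthogonalProjectionOnto (w i)]
  set p := fun i => (ℝ ∙ v)ᗮ.orthogonalProjectionOnto (w i)
  have h5 : o.volumeForm p = o.volumeForm e.toBasis * e.toBasis.det p := by
    conv_lhs => rw [h1]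
    rfl
  have h6 : g p = g e.toBasis * e.toBasis.det p := by
    conv_lhs => rw [h2]
    rfl
  rw [h5, h6]
  linear_combination (-o.volumeForm e.toBasis * e.toBasis.det p) * h4

/-- The Gauss integrand has x - y in the first place, whereas A has y - x in the last. The cyclic
permutation, the change of sign and the position of v each contribute a sign depending on k only, so
a single σ serves for all arguments. -/
theorem exists_volumeForm_cons_projection_eq {v : Euc (k + 2)} (hv : ‖v‖ = 1)
    [Fact (Module.finrank ℝ ((ℝ ∙ v)ᗮ : Submodule ℝ (Euc (k + 2))) = k + 1)]
    (o : Orientation ℝ ((ℝ ∙ v)ᗮ : Submodule ℝ (Euc (k + 2))) (Fin (k + 1))) :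
    ∃ σ : ℝ, σ ^ 2 = 1 ∧ ∀ (p : Euc (k + 2)) (a : Fin k → Euc (k + 2)),
      o.volumeForm (Fin.cons (α := fun _ => ((ℝ ∙ v)ᗮ : Submodule ℝ (Euc (k + 2))))
        ((ℝ ∙ v)ᗮ.orthogonalProjectionOnto p)
          fun i => (ℝ ∙ v)ᗮ.orthogonalProjectionOnto (a i)) /
        ‖(ℝ ∙ v)ᗮ.orthogonalProjectionOnto p‖ ^ (k + 1) =
      σ * kernelFactor (Fin.snoc (α := fun _ => Euc (k + 2)) a (-p)) v := by
  obtain ⟨σ, hσ, h⟩ := exists_volumeForm_projection_eq hv o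
  refine ⟨-σ * ((-1) ^ (k + 1) * (-1) ^ k), by
    rw [mul_pow, mul_pow, neg_sq, hσ, ← pow_mul, ← pow_mul, mul_comm (k + 1), mul_comm k,
      pow_mul, pow_mul]; simp, fun p a => ?_⟩
  have hdir : dir v = v := by rw [dir, hv, inv_one, one_smul]
  have h1 : lastCol (Fin.snoc (α := fun _ => Euc (k + 2)) a (-p)) = -p := by simp [lastCol]
  have h2 : cross (Fin.snoc (α := fun _ => Euc (k + 2)) a (-p)) =
      -cross (Fin.snoc (α := fun _ => Euc (k + 2)) a p) := by
    have := cross_smul (Fin.snoc (α := fun _ => ℝ) (fun _ => 1) (-1))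
      (Fin.snoc (α := fun _ => Euc (k + 2)) a p)
    rw [Fin.prod_univ_castSucc] at this
    simp only [Fin.snoc_castSucc, Fin.snoc_last, Finset.prod_const_one, one_mul, neg_smul,
      one_smul] at this
    rw [← this]
    congr 1
    funext i
    refine Fin.lastCases ?_ (fun i => ?_) i <;> simp
  have h3 := h (Fin.snoc (α := fun _ => Euc (k + 2)) a p)
  have h4 := o.volumeForm.map_perm (Fin.cons (α := fun _ => ((ℝ ∙ v)ᗮ : Submodule ℝ (Euc (k + 2))))
        ((ℝ ∙ v)ᗮ.orthogonalProjectionOnto p)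
          fun i => (ℝ ∙ v)ᗮ.orthogonalProjectionOnto (a i)) (finRotate (k + 1))
  have h5 : (Fin.cons (α := fun _ => ((ℝ ∙ v)ᗮ : Submodule ℝ (Euc (k + 2))))
        ((ℝ ∙ v)ᗮ.orthogonalProjectionOnto p)
          fun i => (ℝ ∙ v)ᗮ.orthogonalProjectionOnto (a i)) ∘ finRotate (k + 1) =
      fun i => (ℝ ∙ v)ᗮ.orthogonalProjectionOnto
        (Fin.snoc (α := fun _ => Euc (k + 2)) a p i) := by
    have := Fin.snoc_eq_cons_rotate (α := ((ℝ ∙ v)ᗮ : Submodule ℝ (Euc (k + 2))))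
      (fun i => (ℝ ∙ v)ᗮ.orthogonalProjectionOnto (a i)) ((ℝ ∙ v)ᗮ.orthogonalProjectionOnto p)
    funext i
    refine (congrFun this i).symm.trans ?_
    refine Fin.lastCases ?_ (fun i => ?_) i <;> simp
  rw [h5, h3, sign_finRotate] at h4
  rw [kernelFactor, detCols_snoc, hdir, h1, h2, map_neg, norm_neg, inner_neg_left]
  rw [mul_div_assoc']
  congr 1
  rcases Nat.even_or_odd k with hk | hk
  · simp only [Nat.add_sub_cancel, hk.neg_one_pow, one_smul] at h4
    rw [hk.add_one.neg_one_pow, hk.neg_one_pow, ← h4]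
    ring
  · simp only [Nat.add_sub_cancel, hk.neg_one_pow, Units.neg_smul, one_smul] at h4
    rw [hk.add_one.neg_one_pow, hk.neg_one_pow]
    linear_combination h4

end VolumeForm

/-! ### Charts -/

section Charts

variable {m : ℕ} {M : Type*} [TopologicalSpace M] [ChartedSpace (Euc m) M]

theorem isOpen_coordDomain (P : ChartPartition m M) (i : P.ι) : IsOpen (coordDomain P i) :=
  (chartAt (Euc m) (P.center i)).open_target

theorem contDiffOn_coordMap [IsManifold (𝓡 m) ∞ M] (P : ChartPartition m M) (i : P.ι) {d : ℕ}
    {x : M → Euc d} (hx : ContMDiff (𝓡 m) 𝓘(ℝ, Euc d) ∞ x) :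
    ContDiffOn ℝ ∞ (coordMap P i x) (coordDomain P i) := by
  rw [← contMDiffOn_iff_contDiffOn]
  exact hx.comp_contMDiffOn contMDiffOn_chart_symm

theorem continuousOn_coordWeight (o : ManifoldOrientation m M) (P : ChartPartition m M) (i : P.ι) :
    ContinuousOn (coordWeight o P i) (coordDomain P i) := by
  have h := (chartAt (Euc m) (P.center i)).continuousOn_symm
  exact ((P.rho i).contMDiff.continuous.comp_continuousOn h).mul
    ((o.continuousOn_sign (P.center i)).comp h
      fun s hs => (chartAt (Euc m) (P.center i)).map_target hs)

theorem abs_coordWeight_le_one (o : ManifoldOrientation m M) (P : ChartPartition m M) (i : P.ι)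
    {s : Euc m} (hs : s ∈ coordDomain P i) : |coordWeight o P i s| ≤ 1 := by
  have h1 := o.sign_eq (P.center i) _ ((chartAt (Euc m) (P.center i)).map_target hs)
  have h2 : |o.sign (P.center i) ((chartAt (Euc m) (P.center i)).symm s)| = 1 := by
    rcases h1 with h | h <;> simp [h]
  rw [coordWeight, abs_mul, h2, mul_one, abs_of_nonneg (P.rho.nonneg i _)]
  exact P.rho.le_one i _

/-- The support of the partition function is closed in a compact space and lies in the chart domain,
so its image in coordinates is compact. -/
theorem exists_isCompact_coordWeight_eq_zero [CompactSpace M] (o : ManifoldOrientation m M)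
    (P : ChartPartition m M) (i : P.ι) :
    ∃ K ⊆ coordDomain P i, IsCompact K ∧ ∀ s ∈ coordDomain P i, s ∉ K → coordWeight o P i s = 0 := by
  set c := chartAt (Euc m) (P.center i) with hc
  have hsub : tsupport (P.rho i) ⊆ c.source := P.subordinate i
  refine ⟨c '' tsupport (P.rho i), ?_, ?_, fun s hs hsK => ?_⟩
  · rintro _ ⟨p, hp, rfl⟩
    exact c.map_source (hsub hp)
  · exact ((isClosed_tsupport _).isCompact).image_of_continuousOn (c.continuousOn.mono hsub)
  · by_contra h
    refine hsK ⟨c.symm s, subset_tsupport _ fun h0 => h ?_, c.right_inv hs⟩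
    rw [coordWeight, ← hc, h0, zero_mul]

theorem exists_mem_coordDomain (P : ChartPartition m M) (p : M) :
    ∃ i, ∃ s ∈ coordDomain P i, (chartAt (Euc m) (P.center i)).symm s = p := by
  obtain ⟨i, hi⟩ := P.rho.exists_pos_of_mem (mem_univ p)
  have hp : p ∈ (chartAt (Euc m) (P.center i)).source :=
    P.subordinate i (subset_tsupport _ hi.ne')
  exact ⟨i, _, (chartAt (Euc m) (P.center i)).map_source hp,
    (chartAt (Euc m) (P.center i)).left_inv hp⟩

end Charts

/-! ### The Gauss integrand of the projections as a kernel factor -/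

section Integrands

variable {m n : ℕ}
  {M₁ : Type*} [TopologicalSpace M₁] [ChartedSpace (Euc m) M₁]
  {M₂ : Type*} [TopologicalSpace M₂] [ChartedSpace (Euc n) M₂]
  {x : M₁ → Euc (m + n + 2)} {y : M₂ → Euc (m + n + 2)}

theorem configCols_eq_pairCols (P₁ : ChartPartition m M₁) (P₂ : ChartPartition n M₂) (i : P₁.ι)
    (j : P₂.ι) : configCols P₁ P₂ x y i j = pairCols (coordMap P₁ i x) (coordMap P₂ j y) := rfl

theorem coordDeriv_hyperplaneProj {m k : ℕ} {M : Type*} [TopologicalSpace M]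
    [ChartedSpace (Euc m) M] {x : M → Euc (k + 2)} (P : ChartPartition m M) (i : P.ι)
    (U : Hyperplane k) {s : Euc m} (hs : DifferentiableAt ℝ (coordMap P i x) s) :
    coordDeriv P i (hyperplaneProj U ∘ x) s = fun l => hyperplaneProj U (coordDeriv P i x s l) := by
  funext l
  have h1 : HasFDerivAt (coordMap P i (hyperplaneProj U ∘ x)) _ s :=
    U.1.orthogonalProjectionOnto.hasFDerivAt.comp s hs.hasFDerivAt
  rw [coordDeriv, h1.fderiv]
  rfl

/-- The product of the weights of two charts. -/
def pairWeight (o₁ : ManifoldOrientation m M₁) (P₁ : ChartPartition m M₁)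
    (o₂ : ManifoldOrientation n M₂) (P₂ : ChartPartition n M₂) (i : P₁.ι) (j : P₂.ι)
    (z : Euc m × Euc n) : ℝ :=
  coordWeight o₁ P₁ i z.1 * coordWeight o₂ P₂ j z.2

/-- Projection is linear, so it commutes with partial derivatives, and the identity for volume forms
applies pointwise. The sign σ is common to all charts and points, so it factors out of the whole
sum. -/
theorem exists_gaussIntegrand_eq [IsManifold (𝓡 m) ∞ M₁] [IsManifold (𝓡 n) ∞ M₂]
    (o₁ : ManifoldOrientation m M₁) (P₁ : ChartPartition m M₁)
    (o₂ : ManifoldOrientation n M₂) (P₂ : ChartPartition n M₂)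
    (hx : ContMDiff (𝓡 m) 𝓘(ℝ, Euc (m + n + 2)) ∞ x)
    (hy : ContMDiff (𝓡 n) 𝓘(ℝ, Euc (m + n + 2)) ∞ y)
    (v : Metric.sphere (0 : Euc (m + n + 2)) 1)
    (o : Orientation ℝ (normalHyperplane (m + n) v).1 (Fin (m + n + 1))) :
    ∃ σ : ℝ, σ ^ 2 = 1 ∧ ∀ i j, ∀ z ∈ coordDomain P₁ i ×ˢ coordDomain P₂ j,
      gaussIntegrand o₁ P₁ o₂ P₂ o (hyperplaneProj (normalHyperplane (m + n) v) ∘ x)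
        (hyperplaneProj (normalHyperplane (m + n) v) ∘ y) i j z =
      σ * (pairWeight o₁ P₁ o₂ P₂ i j z * kernelFactor (configCols P₁ P₂ x y i j z) v) := by
  have hfact : Fact (Module.finrank ℝ ((ℝ ∙ (v : Euc (m + n + 2)))ᗮ :
    Submodule ℝ (Euc (m + n + 2))) = m + n + 1) := ⟨(normalHyperplane (m + n) v).2⟩
  obtain ⟨σ, hσ, h⟩ := exists_volumeForm_cons_projection_eq (k := m + n) (v := (v : Euc (m + n + 2)))
    (by simp) o
  refine ⟨σ, hσ, fun i j z hz => ?_⟩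
  have hX := ((contDiffOn_coordMap P₁ i hx).contDiffAt
    ((isOpen_coordDomain P₁ i).mem_nhds hz.1)).differentiableAt (by simp)
  have hY := ((contDiffOn_coordMap P₂ j hy).contDiffAt
    ((isOpen_coordDomain P₂ j).mem_nhds hz.2)).differentiableAt (by simp)
  rw [gaussIntegrand, coordDeriv_hyperplaneProj P₁ i _ hX, coordDeriv_hyperplaneProj P₂ j _ hY,
    pairWeight, mul_left_comm σ]
  congr 1
  have h1 := h (coordMap P₁ i x z.1 - coordMap P₂ j y z.2)
    (Fin.append (coordDeriv P₁ i x z.1) (coordDeriv P₂ j y z.2))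
  rw [neg_sub] at h1
  refine Eq.trans ?_ h1
  have h2 : coordMap P₁ i (hyperplaneProj (normalHyperplane (m + n) v) ∘ x) z.1 -
      coordMap P₂ j (hyperplaneProj (normalHyperplane (m + n) v) ∘ y) z.2 =
      (ℝ ∙ (v : Euc (m + n + 2)))ᗮ.orthogonalProjectionOnto
        (coordMap P₁ i x z.1 - coordMap P₂ j y z.2) := by
    rw [map_sub]; rfl
  have h3 : Fin.append
      (fun l => hyperplaneProj (normalHyperplane (m + n) v) (coordDeriv P₁ i x z.1 l))
      (fun l => hyperplaneProj (normalHyperplane (m + n) v) (coordDeriv P₂ j y z.2 l)) =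
      fun l => (ℝ ∙ (v : Euc (m + n + 2)))ᗮ.orthogonalProjectionOnto
        (Fin.append (coordDeriv P₁ i x z.1) (coordDeriv P₂ j y z.2) l) := by
    funext l
    refine Fin.addCases (fun l => ?_) (fun l => ?_) l
    · simp only [Fin.append_left]; rfl
    · simp only [Fin.append_right]; rfl
  rw [h3]
  erw [h2]
  rfl

end Integrands

/-! ### The average of the squared linking number -/

section Average

theorem disjoint_range_hyperplaneProj_iff {m n : ℕ} {M₁ M₂ : Type*}
    {x : M₁ → Euc (m + n + 2)} {y : M₂ → Euc (m + n + 2)}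
    (v : Metric.sphere (0 : Euc (m + n + 2)) 1) :
    Disjoint (range (hyperplaneProj (normalHyperplane (m + n) v) ∘ x))
      (range (hyperplaneProj (normalHyperplane (m + n) v) ∘ y)) ↔
    ∀ p q, x p - y q ≠ ⟪(v : Euc (m + n + 2)), x p - y q⟫ • (v : Euc (m + n + 2)) := by
  rw [disjoint_range_iff]
  refine forall₂_congr fun p q => not_congr ?_
  have h1 : hyperplaneProj (normalHyperplane (m + n) v) (x p) =
      hyperplaneProj (normalHyperplane (m + n) v) (y q) ↔
      (ℝ ∙ (v : Euc (m + n + 2)))ᗮ.orthogonalProjectionOnto (x p - y q) = 0 := by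
    rw [map_sub, sub_eq_zero]
    rfl
  have hv : ‖(v : Euc (m + n + 2))‖ = 1 := by simp
  have h2 := (ℝ ∙ (v : Euc (m + n + 2))).starProjection_add_starProjection_orthogonal (x p - y q)
  rw [Submodule.starProjection_unit_singleton ℝ hv] at h2
  refine h1.trans ⟨fun h => ?_, fun h => ?_⟩
  · have h3 : (ℝ ∙ (v : Euc (m + n + 2)))ᗮ.starProjection (x p - y q) = 0 :=
      congrArg Subtype.val h
    rw [h3, add_zero] at h2
    exact h2.symm
  · have h3 : (ℝ ∙ (v : Euc (m + n + 2)))ᗮ.starProjection (x p - y q) = 0 := by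
      rw [← h] at h2
      exact add_eq_left.1 h2
    exact Subtype.ext h3

variable {m n : ℕ}
  {M₁ : Type*} [TopologicalSpace M₁] [ChartedSpace (Euc m) M₁]
  {M₂ : Type*} [TopologicalSpace M₂] [ChartedSpace (Euc n) M₂]
  (o₁ : ManifoldOrientation m M₁) (P₁ : ChartPartition m M₁)
  (o₂ : ManifoldOrientation n M₂) (P₂ : ChartPartition n M₂)
  {x : M₁ → Euc (m + n + 2)} {y : M₂ → Euc (m + n + 2)}

theorem measurableSet_pairDomain (i : P₁.ι) (j : P₂.ι) :
    MeasurableSet (coordDomain P₁ i ×ˢ coordDomain P₂ j) :=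
  ((isOpen_coordDomain P₁ i).prod (isOpen_coordDomain P₂ j)).measurableSet

theorem aemeasurable_pairWeight (i : P₁.ι) (j : P₂.ι) :
    AEMeasurable (pairWeight o₁ P₁ o₂ P₂ i j)
      (volume.restrict (coordDomain P₁ i ×ˢ coordDomain P₂ j)) := by
  refine ContinuousOn.aemeasurable ?_ (measurableSet_pairDomain P₁ P₂ i j)
  exact ((continuousOn_coordWeight o₁ P₁ i).comp continuousOn_fst fun z hz => hz.1).mul
    ((continuousOn_coordWeight o₂ P₂ j).comp continuousOn_snd fun z hz => hz.2)

theorem lastCol_configCols_ne_zero (hxy : Disjoint (range x) (range y)) (i : P₁.ι) (j : P₂.ι)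
    (z : Euc m × Euc n) : lastCol (configCols P₁ P₂ x y i j z) ≠ 0 := by
  rw [configCols_eq_pairCols, lastCol_pairCols, sub_ne_zero]
  intro h
  have h1 : coordMap P₂ j y z.2 ∈ range x := h ▸ mem_range_self _
  exact hxy.le_bot ⟨h1, mem_range_self _⟩

section Smooth

variable [IsManifold (𝓡 m) ∞ M₁] [IsManifold (𝓡 n) ∞ M₂]
  (hx : ContMDiff (𝓡 m) 𝓘(ℝ, Euc (m + n + 2)) ∞ x)
  (hy : ContMDiff (𝓡 n) 𝓘(ℝ, Euc (m + n + 2)) ∞ y)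

include hx hy

theorem aemeasurable_configCols (i : P₁.ι) (j : P₂.ι) :
    AEMeasurable (configCols P₁ P₂ x y i j)
      (volume.restrict (coordDomain P₁ i ×ˢ coordDomain P₂ j)) :=
  (continuousOn_pairCols (isOpen_coordDomain P₁ i) (isOpen_coordDomain P₂ j)
    (contDiffOn_coordMap P₁ i hx) (contDiffOn_coordMap P₂ j hy)).aemeasurable
    (measurableSet_pairDomain P₁ P₂ i j)

theorem hasBoundedPotential_configCols [CompactSpace M₁] [CompactSpace M₂] (hk : 1 ≤ m + n)
    (hxy : Disjoint (range x) (range y)) (i : P₁.ι) (j : P₂.ι) :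
    HasBoundedPotential (volume.restrict (coordDomain P₁ i ×ˢ coordDomain P₂ j))
      (pairWeight o₁ P₁ o₂ P₂ i j) (configCols P₁ P₂ x y i j) := by
  obtain ⟨K₁, hK₁s, hK₁, h₁⟩ := exists_isCompact_coordWeight_eq_zero o₁ P₁ i
  obtain ⟨K₂, hK₂s, hK₂, h₂⟩ := exists_isCompact_coordWeight_eq_zero o₂ P₂ j
  refine hasBoundedPotential_pairCols hk (isOpen_coordDomain P₁ i) (isOpen_coordDomain P₂ j)
    (contDiffOn_coordMap P₁ i hx) (contDiffOn_coordMap P₂ j hy) (fun z _ => ?_)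
    (hK₁.prod hK₂) (prod_mono hK₁s hK₂s) (fun z hz => ?_) (fun z hz hzK => ?_)
  · rw [← lastCol_pairCols]
    exact lastCol_configCols_ne_zero P₁ P₂ hxy i j z
  · rw [pairWeight, abs_mul]
    exact mul_le_one₀ (abs_coordWeight_le_one o₁ P₁ i hz.1) (abs_nonneg _)
      (abs_coordWeight_le_one o₂ P₂ j hz.2)
  · rw [mem_prod, not_and_or] at hzK
    rcases hzK with h | h
    · rw [pairWeight, h₁ _ hz.1 h, zero_mul]
    · rw [pairWeight, h₂ _ hz.2 h, mul_zero]

theorem integrable_config_kernelFactor [CompactSpace M₁] [CompactSpace M₂] (hk : 1 ≤ m + n)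
    (hxy : Disjoint (range x) (range y)) (i : P₁.ι) (j : P₂.ι) (i' : P₁.ι) (j' : P₂.ι) :
    Integrable (fun p : ((Euc m × Euc n) × (Euc m × Euc n)) × Euc (m + n + 2) =>
      (pairWeight o₁ P₁ o₂ P₂ i j p.1.1 * kernelFactor (configCols P₁ P₂ x y i j p.1.1) p.2) *
      (pairWeight o₁ P₁ o₂ P₂ i' j' p.1.2 * kernelFactor (configCols P₁ P₂ x y i' j' p.1.2) p.2))
      (((volume.restrict (coordDomain P₁ i ×ˢ coordDomain P₂ j)).prod
        (volume.restrict (coordDomain P₁ i' ×ˢ coordDomain P₂ j'))).prod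
          (gaussMeasure (m + n + 2))) :=
  integrable_kernelFactor_mul_kernelFactor hk (aemeasurable_pairWeight o₁ P₁ o₂ P₂ i j)
    (aemeasurable_configCols P₁ P₂ hx hy i j)
    (ae_of_all _ (lastCol_configCols_ne_zero P₁ P₂ hxy i j))
    (hasBoundedPotential_configCols o₁ P₁ o₂ P₂ hx hy hk hxy i j)
    (aemeasurable_pairWeight o₁ P₁ o₂ P₂ i' j') (aemeasurable_configCols P₁ P₂ hx hy i' j')
    (ae_of_all _ (lastCol_configCols_ne_zero P₁ P₂ hxy i' j'))
    (hasBoundedPotential_configCols o₁ P₁ o₂ P₂ hx hy hk hxy i' j')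

end Smooth

variable (x y) in
/-- The Gauss integral of the projections to `v^⊥` over a pair of charts, up to sign and
normalization. -/
def projectedIntegral (i : P₁.ι) (j : P₂.ι) (v : Euc (m + n + 2)) : ℝ :=
  ∫ z in coordDomain P₁ i ×ˢ coordDomain P₂ j,
    pairWeight o₁ P₁ o₂ P₂ i j z * kernelFactor (configCols P₁ P₂ x y i j z) v

variable (x y) in
/-- The square of the linking number of the projections to `v^⊥`. -/
def projectedLinkingSq (v : Euc (m + n + 2)) : ℝ :=
  1 / sphereVolume (m + n) ^ 2 * (∑ i, ∑ j, projectedIntegral o₁ P₁ o₂ P₂ x y i j v) ^ 2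

theorem projectedIntegral_unitDir (i : P₁.ι) (j : P₂.ι) {v : Euc (m + n + 2)} (hv : v ≠ 0) :
    projectedIntegral o₁ P₁ o₂ P₂ x y i j (unitDir v) =
      projectedIntegral o₁ P₁ o₂ P₂ x y i j v := by
  rw [projectedIntegral, projectedIntegral, coe_unitDir hv]
  simp_rw [kernelFactor_dir _ hv]

theorem restrict_configDomain (i : P₁.ι) (j : P₂.ι) (i' : P₁.ι) (j' : P₂.ι) :
    (volume.restrict (configDomain P₁ P₂ i j i' j') :
      Measure ((Euc m × Euc n) × (Euc m × Euc n))) =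
      (volume.restrict (coordDomain P₁ i ×ˢ coordDomain P₂ j)).prod
        (volume.restrict (coordDomain P₁ i' ×ˢ coordDomain P₂ j')) := by
  rw [Measure.prod_restrict]
  rfl

section Smooth

variable [IsManifold (𝓡 m) ∞ M₁] [IsManifold (𝓡 n) ∞ M₂]
  (hx : ContMDiff (𝓡 m) 𝓘(ℝ, Euc (m + n + 2)) ∞ x)
  (hy : ContMDiff (𝓡 n) 𝓘(ℝ, Euc (m + n + 2)) ∞ y)

include hx hy

/-- Both σ and (-1)^(m+1) disappear on squaring. The right side does not involve the orientation, so
orientations of the hyperplanes may be chosen arbitrarily, without any measurability in the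
hyperplane. -/
theorem gaussLinking_sq_eq (v : Metric.sphere (0 : Euc (m + n + 2)) 1)
    (o : Orientation ℝ (normalHyperplane (m + n) v).1 (Fin (m + n + 1))) :
    gaussLinking o₁ P₁ o₂ P₂ o (hyperplaneProj (normalHyperplane (m + n) v) ∘ x)
        (hyperplaneProj (normalHyperplane (m + n) v) ∘ y) ^ 2 =
      projectedLinkingSq o₁ P₁ o₂ P₂ x y v := by
  obtain ⟨σ, hσ, h⟩ := exists_gaussIntegrand_eq o₁ P₁ o₂ P₂ hx hy v o
  have h1 : ∀ i j, ∫ z in coordDomain P₁ i ×ˢ coordDomain P₂ j,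
      gaussIntegrand o₁ P₁ o₂ P₂ o (hyperplaneProj (normalHyperplane (m + n) v) ∘ x)
        (hyperplaneProj (normalHyperplane (m + n) v) ∘ y) i j z =
      σ * projectedIntegral o₁ P₁ o₂ P₂ x y i j v := fun i j => by
    rw [projectedIntegral, ← integral_const_mul]
    exact setIntegral_congr_fun (measurableSet_pairDomain P₁ P₂ i j) (h i j)
  rw [gaussLinking, projectedLinkingSq]
  simp_rw [h1, ← Finset.mul_sum]
  rw [mul_pow, mul_pow, hσ, one_mul, div_pow, ← pow_mul, mul_comm (m + 1), pow_mul]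
  simp

theorem integrableOn_gaussIntegrand_iff (v : Metric.sphere (0 : Euc (m + n + 2)) 1)
    (o : Orientation ℝ (normalHyperplane (m + n) v).1 (Fin (m + n + 1))) (i : P₁.ι) (j : P₂.ι) :
    IntegrableOn (gaussIntegrand o₁ P₁ o₂ P₂ o (hyperplaneProj (normalHyperplane (m + n) v) ∘ x)
        (hyperplaneProj (normalHyperplane (m + n) v) ∘ y) i j)
      (coordDomain P₁ i ×ˢ coordDomain P₂ j) ↔
    Integrable (fun z => pairWeight o₁ P₁ o₂ P₂ i j z *
      kernelFactor (configCols P₁ P₂ x y i j z) v)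
        (volume.restrict (coordDomain P₁ i ×ˢ coordDomain P₂ j)) := by
  obtain ⟨σ, hσ, h⟩ := exists_gaussIntegrand_eq o₁ P₁ o₂ P₂ hx hy v o
  have hσ0 : σ ≠ 0 := by rintro rfl; norm_num at hσ
  rw [integrableOn_congr_fun (h i j) (measurableSet_pairDomain P₁ P₂ i j), IntegrableOn]
  exact integrable_const_mul_iff (isUnit_iff_ne_zero.2 hσ0) _

theorem stronglyMeasurable_projectedLinkingSq :
    StronglyMeasurable (projectedLinkingSq o₁ P₁ o₂ P₂ x y) := by
  have h : ∀ i j, StronglyMeasurable (projectedIntegral o₁ P₁ o₂ P₂ x y i j) := fun i j =>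
    stronglyMeasurable_integral_kernelFactor (aemeasurable_pairWeight o₁ P₁ o₂ P₂ i j)
      (aemeasurable_configCols P₁ P₂ hx hy i j)
  unfold projectedLinkingSq
  refine StronglyMeasurable.const_mul (StronglyMeasurable.pow ?_ 2) _
  exact Finset.stronglyMeasurable_fun_sum _ fun i _ =>
    Finset.stronglyMeasurable_fun_sum _ fun j _ => h i j

/-- In the quotient σ-algebra, measurability is tested after composition with `normalHyperplane`,
where the function becomes `projectedLinkingSq`. -/
theorem measurable_gaussLinking_sq
    (oU : ∀ U : Hyperplane (m + n), Orientation ℝ U.1 (Fin (m + n + 1))) :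
    Measurable fun U => gaussLinking o₁ P₁ o₂ P₂ (oU U) (hyperplaneProj U ∘ x)
      (hyperplaneProj U ∘ y) ^ 2 := by
  intro s hs
  change MeasurableSet ((normalHyperplane (m + n)) ⁻¹' _)
  have h : (normalHyperplane (m + n)) ⁻¹' ((fun U => gaussLinking o₁ P₁ o₂ P₂ (oU U)
      (hyperplaneProj U ∘ x) (hyperplaneProj U ∘ y) ^ 2) ⁻¹' s) =
      (fun v : Metric.sphere (0 : Euc (m + n + 2)) 1 =>
        projectedLinkingSq o₁ P₁ o₂ P₂ x y v) ⁻¹' s := by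
    ext v
    simp only [mem_preimage]
    rw [gaussLinking_sq_eq o₁ P₁ o₂ P₂ hx hy v (oU _)]
  rw [h]
  exact ((stronglyMeasurable_projectedLinkingSq o₁ P₁ o₂ P₂ hx hy).measurable.comp
    measurable_subtype_coe) hs

variable [CompactSpace M₁] [CompactSpace M₂] (hk : 1 ≤ m + n) (hxy : Disjoint (range x) (range y))

include hk hxy

theorem integrableOn_configIntegrand (i : P₁.ι) (j : P₂.ι) (i' : P₁.ι) (j' : P₂.ι) :
    IntegrableOn (configIntegrand o₁ P₁ o₂ P₂ x y i j i' j') (configDomain P₁ P₂ i j i' j') := by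
  rw [IntegrableOn, restrict_configDomain]
  exact integrable_mul_kernel (integrable_config_kernelFactor o₁ P₁ o₂ P₂ hx hy hk hxy i j i' j')

theorem integrable_projectedIntegral_mul (i : P₁.ι) (j : P₂.ι) (i' : P₁.ι) (j' : P₂.ι) :
    Integrable (fun v => projectedIntegral o₁ P₁ o₂ P₂ x y i j v *
      projectedIntegral o₁ P₁ o₂ P₂ x y i' j' v) (gaussMeasure (m + n + 2)) :=
  integrable_integral_mul_integral
    (integrable_config_kernelFactor o₁ P₁ o₂ P₂ hx hy hk hxy i j i' j')

theorem integral_projectedIntegral_mul (i : P₁.ι) (j : P₂.ι) (i' : P₁.ι) (j' : P₂.ι) :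
    ∫ v, projectedIntegral o₁ P₁ o₂ P₂ x y i j v * projectedIntegral o₁ P₁ o₂ P₂ x y i' j' v
      ∂gaussMeasure (m + n + 2) =
    ∫ z in configDomain P₁ P₂ i j i' j', configIntegrand o₁ P₁ o₂ P₂ x y i j i' j' z := by
  rw [restrict_configDomain]
  exact integral_integral_mul_integral
    (integrable_config_kernelFactor o₁ P₁ o₂ P₂ hx hy hk hxy i j i' j')

omit hx hy hk hxy [IsManifold (𝓡 m) ∞ M₁] [IsManifold (𝓡 n) ∞ M₂] [CompactSpace M₁]
  [CompactSpace M₂] in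
theorem projectedLinkingSq_eq_sum (v : Euc (m + n + 2)) :
    projectedLinkingSq o₁ P₁ o₂ P₂ x y v = 1 / sphereVolume (m + n) ^ 2 *
      ∑ i, ∑ j, ∑ i', ∑ j', projectedIntegral o₁ P₁ o₂ P₂ x y i j v *
        projectedIntegral o₁ P₁ o₂ P₂ x y i' j' v := by
  rw [projectedLinkingSq]
  congr 1
  rw [sq]
  simp_rw [Finset.sum_mul, Finset.mul_sum]

theorem integrable_projectedLinkingSq :
    Integrable (projectedLinkingSq o₁ P₁ o₂ P₂ x y) (gaussMeasure (m + n + 2)) := by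
  rw [funext (projectedLinkingSq_eq_sum o₁ P₁ o₂ P₂ (x := x) (y := y))]
  exact (integrable_finsetSum _ fun i _ => integrable_finsetSum _ fun j _ =>
    integrable_finsetSum _ fun i' _ => integrable_finsetSum _ fun j' _ =>
      integrable_projectedIntegral_mul o₁ P₁ o₂ P₂ hx hy hk hxy i j i' j').const_mul _

theorem integral_projectedLinkingSq :
    ∫ v, projectedLinkingSq o₁ P₁ o₂ P₂ x y v ∂gaussMeasure (m + n + 2) =
      1 / sphereVolume (m + n) ^ 2 * ∑ i, ∑ j, ∑ i', ∑ j',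
        ∫ z in configDomain P₁ P₂ i j i' j', configIntegrand o₁ P₁ o₂ P₂ x y i j i' j' z := by
  have h := integrable_projectedIntegral_mul o₁ P₁ o₂ P₂ hx hy hk hxy
  rw [funext (projectedLinkingSq_eq_sum o₁ P₁ o₂ P₂ (x := x) (y := y)), integral_const_mul]
  congr 1
  rw [integral_finsetSum _ fun i _ => integrable_finsetSum _ fun j _ =>
    integrable_finsetSum _ fun i' _ => integrable_finsetSum _ fun j' _ => h i j i' j']
  refine Finset.sum_congr rfl fun i _ => ?_
  rw [integral_finsetSum _ fun j _ =>
    integrable_finsetSum _ fun i' _ => integrable_finsetSum _ fun j' _ => h i j i' j']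
  refine Finset.sum_congr rfl fun j _ => ?_
  rw [integral_finsetSum _ fun i' _ => integrable_finsetSum _ fun j' _ => h i j i' j']
  refine Finset.sum_congr rfl fun i' _ => ?_
  rw [integral_finsetSum _ fun j' _ => h i j i' j']
  exact Finset.sum_congr rfl fun j' _ =>
    integral_projectedIntegral_mul o₁ P₁ o₂ P₂ hx hy hk hxy i j i' j'

omit hk hxy [CompactSpace M₁] [CompactSpace M₂] in
theorem ae_gaussLinking_sq_eq
    (oU : ∀ U : Hyperplane (m + n), Orientation ℝ U.1 (Fin (m + n + 1))) :
    ∀ᵐ v ∂gaussMeasure (m + n + 2), projectedLinkingSq o₁ P₁ o₂ P₂ x y v =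
      gaussLinking o₁ P₁ o₂ P₂ (oU (normalHyperplane (m + n) (unitDir v)))
        (hyperplaneProj (normalHyperplane (m + n) (unitDir v)) ∘ x)
        (hyperplaneProj (normalHyperplane (m + n) (unitDir v)) ∘ y) ^ 2 := by
  filter_upwards [ae_gaussMeasure_ne_zero (m + n)] with v hv
  rw [gaussLinking_sq_eq o₁ P₁ o₂ P₂ hx hy (unitDir v) (oU _), projectedLinkingSq,
    projectedLinkingSq]
  simp_rw [projectedIntegral_unitDir o₁ P₁ o₂ P₂ _ _ hv]

theorem integrable_gaussLinking_sq
    (oU : ∀ U : Hyperplane (m + n), Orientation ℝ U.1 (Fin (m + n + 1))) :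
    Integrable (fun U => gaussLinking o₁ P₁ o₂ P₂ (oU U) (hyperplaneProj U ∘ x)
      (hyperplaneProj U ∘ y) ^ 2) (hyperplaneMeasure (m + n)) := by
  rw [hyperplaneMeasure_eq_map]
  exact (integrable_map_measure
    (measurable_gaussLinking_sq o₁ P₁ o₂ P₂ hx hy oU).aestronglyMeasurable
    (measurable_normalHyperplane_unitDir _).aemeasurable).2
    ((integrable_projectedLinkingSq o₁ P₁ o₂ P₂ hx hy hk hxy).congr
      (ae_gaussLinking_sq_eq o₁ P₁ o₂ P₂ hx hy oU))

theorem integral_gaussLinking_sq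
    (oU : ∀ U : Hyperplane (m + n), Orientation ℝ U.1 (Fin (m + n + 1))) :
    ∫ U, gaussLinking o₁ P₁ o₂ P₂ (oU U) (hyperplaneProj U ∘ x) (hyperplaneProj U ∘ y) ^ 2
        ∂(hyperplaneMeasure (m + n)) =
      1 / sphereVolume (m + n) ^ 2 * ∑ i, ∑ j, ∑ i', ∑ j',
        ∫ z in configDomain P₁ P₂ i j i' j', configIntegrand o₁ P₁ o₂ P₂ x y i j i' j' z := by
  rw [hyperplaneMeasure_eq_map, ← integral_projectedLinkingSq o₁ P₁ o₂ P₂ hx hy hk hxy]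
  exact (integral_map (measurable_normalHyperplane_unitDir _).aemeasurable
    (measurable_gaussLinking_sq o₁ P₁ o₂ P₂ hx hy oU).aestronglyMeasurable).trans
    (integral_congr_ae (ae_gaussLinking_sq_eq o₁ P₁ o₂ P₂ hx hy oU)).symm

-- For each fixed second point the pole w is the last column there, and the exceptional first points
-- are null by `ae_cross_eq_zero_or_sine_ne_zero`; Tonelli does the rest. A vanishing cross product
-- makes the first kernel factor zero for all v.
omit [CompactSpace M₁] [CompactSpace M₂] in
theorem ae_linearIndependent_or_kernelFactor_mul_eq_zero (i : P₁.ι) (j : P₂.ι) (i' : P₁.ι)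
    (j' : P₂.ι) :
    ∀ᵐ z ∂(volume.restrict (configDomain P₁ P₂ i j i' j')),
      LinearIndependent ℝ ![lastCol (configCols P₁ P₂ x y i j z.1),
        lastCol (configCols P₁ P₂ x y i' j' z.2)] ∨
      ∀ v, kernelFactor (configCols P₁ P₂ x y i j z.1) v *
        kernelFactor (configCols P₁ P₂ x y i' j' z.2) v = 0 := by
  classical
  have hA := aemeasurable_configCols P₁ P₂ hx hy i j
  have hA' := aemeasurable_configCols P₁ P₂ hx hy i' j'
  have hlast : Measurable fun B : Fin (m + n + 1) → Euc (m + n + 2) => lastCol B :=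
    measurable_pi_apply (Fin.last _)
  -- The indicator of the exceptional set, as a measurable function of the cross product and the
  -- sine: since these are only almost everywhere measurable, the null set is detected by an
  -- integral.
  let g : Euc (m + n + 2) × ℝ → ℝ≥0∞ := ({p | p.1 = 0 ∨ p.2 ≠ 0}ᶜ).indicator 1
  have hg : Measurable g := measurable_one.indicator (((measurable_fst
    (measurableSet_singleton 0)).union (measurable_snd (measurableSet_singleton 0).compl)).compl)
  have hg0 : ∀ p, g p = 0 ↔ (p.1 = 0 ∨ p.2 ≠ 0) := fun p => by
    simp only [g, indicator_apply_eq_zero, mem_compl_iff, mem_ofPred_eq, Pi.one_apply, one_ne_zero,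
      imp_false, not_not]
  have hs : AEMeasurable (fun z : (Euc m × Euc n) × (Euc m × Euc n) =>
      sine (lastCol (configCols P₁ P₂ x y i j z.1)) (lastCol (configCols P₁ P₂ x y i' j' z.2)))
      (volume.restrict (configDomain P₁ P₂ i j i' j')) := by
    rw [restrict_configDomain]
    have := measurable_sine.comp_aemeasurable
      (((hlast.comp_aemeasurable hA).comp_quasiMeasurePreserving
        (Measure.quasiMeasurePreserving_fst (ν := volume.restrict
          (coordDomain P₁ i' ×ˢ coordDomain P₂ j')))).prodMk
      ((hlast.comp_aemeasurable hA').comp_quasiMeasurePreserving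
        (Measure.quasiMeasurePreserving_snd (μ := volume.restrict
          (coordDomain P₁ i ×ˢ coordDomain P₂ j)))))
    simpa only [Function.comp_def] using this
  have hc : AEMeasurable (fun z : (Euc m × Euc n) × (Euc m × Euc n) =>
      cross (configCols P₁ P₂ x y i j z.1)) (volume.restrict (configDomain P₁ P₂ i j i' j')) := by
    rw [restrict_configDomain]
    exact (continuous_cross.measurable.comp_aemeasurable hA).comp_quasiMeasurePreserving
        (Measure.quasiMeasurePreserving_fst (ν := volume.restrict
          (coordDomain P₁ i' ×ˢ coordDomain P₂ j')))
  have hm := hg.comp_aemeasurable (hc.prodMk hs)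
  have key : ∀ᵐ z ∂(volume.restrict (configDomain P₁ P₂ i j i' j')),
      g (cross (configCols P₁ P₂ x y i j z.1), sine (lastCol (configCols P₁ P₂ x y i j z.1))
        (lastCol (configCols P₁ P₂ x y i' j' z.2))) = 0 := by
    rw [restrict_configDomain] at hm ⊢
    refine (lintegral_eq_zero_iff' hm).1 ?_
    rw [lintegral_prod_symm _ hm]
    refine (lintegral_congr fun z' => ?_).trans lintegral_zero
    refine (lintegral_congr_ae ?_).trans lintegral_zero
    filter_upwards [ae_cross_eq_zero_or_sine_ne_zero hk (isOpen_coordDomain P₁ i)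
      (isOpen_coordDomain P₂ j) (contDiffOn_coordMap P₁ i hx) (contDiffOn_coordMap P₂ j hy)
      (lastCol_configCols_ne_zero P₁ P₂ hxy i' j' z')] with z hz
    exact (hg0 _).2 hz
  filter_upwards [key] with z hz
  rcases (hg0 _).1 hz with h | h
  · right
    intro v
    have h' : cross (configCols P₁ P₂ x y i j z.1) = 0 := h
    rw [kernelFactor, detCols_snoc, h', inner_zero_left, mul_zero, zero_div, zero_mul]
  · left
    exact linearIndependent_of_sine_ne_zero (lastCol_configCols_ne_zero P₁ P₂ hxy _ _ _)
      (lastCol_configCols_ne_zero P₁ P₂ hxy _ _ _) h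

-- The bad directions are the projection, along the compact space M₁ × M₂, of a closed set.
omit hk hxy [IsManifold (𝓡 m) ∞ M₁] [IsManifold (𝓡 n) ∞ M₂] in
theorem isOpen_disjoint_hyperplaneProj :
    IsOpen {v : Metric.sphere (0 : Euc (m + n + 2)) 1 |
      Disjoint (range (hyperplaneProj (normalHyperplane (m + n) v) ∘ x))
        (range (hyperplaneProj (normalHyperplane (m + n) v) ∘ y))} := by
  have h : {v : Metric.sphere (0 : Euc (m + n + 2)) 1 |
      Disjoint (range (hyperplaneProj (normalHyperplane (m + n) v) ∘ x))
        (range (hyperplaneProj (normalHyperplane (m + n) v) ∘ y))} =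
      (Prod.snd '' {p : (M₁ × M₂) × Metric.sphere (0 : Euc (m + n + 2)) 1 | x p.1.1 - y p.1.2 =
        ⟪(p.2 : Euc (m + n + 2)), x p.1.1 - y p.1.2⟫ • (p.2 : Euc (m + n + 2))})ᶜ := by
    ext v
    rw [mem_ofPred_eq, disjoint_range_hyperplaneProj_iff]
    simp
  rw [h, isOpen_compl_iff]
  refine isClosedMap_snd_of_compactSpace _ (isClosed_eq ?_ ?_)
  all_goals
    have := hx.continuous
    have := hy.continuous
    fun_prop

-- If two points have the same projection along v, then v is a multiple of their difference, hence
-- in one of finitely many null cones.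
include P₁ P₂ in
omit hk [CompactSpace M₁] [CompactSpace M₂] in
theorem ae_disjoint_hyperplaneProj :
    ∀ᵐ v ∂gaussMeasure (m + n + 2),
      Disjoint (range (hyperplaneProj (normalHyperplane (m + n) (unitDir v)) ∘ x))
        (range (hyperplaneProj (normalHyperplane (m + n) (unitDir v)) ∘ y)) := by
  have h1 : ∀ i j, ∀ᵐ v ∂gaussMeasure (m + n + 2),
      v ∉ (fun p : (Euc m × Euc n) × ℝ => p.2 • (coordMap P₁ i x p.1.1 - coordMap P₂ j y p.1.2)) ''
      ((coordDomain P₁ i ×ˢ coordDomain P₂ j) ×ˢ univ) := fun i j =>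
    (gaussMeasure_absolutelyContinuous _).ae_le (measure_eq_zero_iff_ae_notMem.1
      (volume_cone_eq_zero (isOpen_coordDomain P₁ i) (isOpen_coordDomain P₂ j)
        (contDiffOn_coordMap P₁ i hx) (contDiffOn_coordMap P₂ j hy)))
  filter_upwards [ae_gaussMeasure_ne_zero (m + n),
    ae_all_iff.2 fun i => ae_all_iff.2 fun j => h1 i j] with v hv h
  rw [disjoint_range_hyperplaneProj_iff, coe_unitDir hv]
  intro p q hpq
  set t := ⟪dir v, x p - y q⟫ with ht
  have ht0 : t ≠ 0 := by
    intro h0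
    rw [h0, zero_smul, sub_eq_zero] at hpq
    exact hxy.le_bot ⟨mem_range_self p, hpq ▸ mem_range_self q⟩
  obtain ⟨i, s, hs, hp⟩ := exists_mem_coordDomain P₁ p
  obtain ⟨j, s', hs', hq⟩ := exists_mem_coordDomain P₂ q
  refine h i j ⟨((s, s'), ‖v‖ / t), ⟨⟨hs, hs'⟩, mem_univ _⟩, ?_⟩
  simp only [coordMap, Function.comp_apply, hp, hq]
  rw [hpq, smul_smul, div_mul_cancel₀ _ ht0, norm_smul_dir]

theorem ae_disjoint_and_integrableOn
    (oU : ∀ U : Hyperplane (m + n), Orientation ℝ U.1 (Fin (m + n + 1))) :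
    ∀ᵐ U ∂(hyperplaneMeasure (m + n)),
      Disjoint (range (hyperplaneProj U ∘ x)) (range (hyperplaneProj U ∘ y)) ∧
      ∀ i j, IntegrableOn
        (gaussIntegrand o₁ P₁ o₂ P₂ (oU U) (hyperplaneProj U ∘ x) (hyperplaneProj U ∘ y) i j)
        (coordDomain P₁ i ×ˢ coordDomain P₂ j) := by
  -- Measurability of the set of good hyperplanes allows an almost-everywhere statement to be
  -- carried through the push-forward from Gaussian vectors.
  have hmeas : MeasurableSet {U | Disjoint (range (hyperplaneProj U ∘ x))
      (range (hyperplaneProj U ∘ y)) ∧ ∀ i j, IntegrableOn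
        (gaussIntegrand o₁ P₁ o₂ P₂ (oU U) (hyperplaneProj U ∘ x) (hyperplaneProj U ∘ y) i j)
        (coordDomain P₁ i ×ˢ coordDomain P₂ j)} := by
    change MeasurableSet ((normalHyperplane (m + n)) ⁻¹' _)
    have h : (normalHyperplane (m + n)) ⁻¹' {U | Disjoint (range (hyperplaneProj U ∘ x))
      (range (hyperplaneProj U ∘ y)) ∧ ∀ i j, IntegrableOn
        (gaussIntegrand o₁ P₁ o₂ P₂ (oU U) (hyperplaneProj U ∘ x) (hyperplaneProj U ∘ y) i j)
        (coordDomain P₁ i ×ˢ coordDomain P₂ j)} =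
      {v | Disjoint (range (hyperplaneProj (normalHyperplane (m + n) v) ∘ x))
        (range (hyperplaneProj (normalHyperplane (m + n) v) ∘ y))} ∩
      ⋂ i, ⋂ j, (fun v : Metric.sphere (0 : Euc (m + n + 2)) 1 => (v : Euc (m + n + 2))) ⁻¹'
        {v | Integrable (fun z => pairWeight o₁ P₁ o₂ P₂ i j z *
          kernelFactor (configCols P₁ P₂ x y i j z) v)
          (volume.restrict (coordDomain P₁ i ×ˢ coordDomain P₂ j))} := by
      ext v
      simp only [mem_preimage, mem_ofPred_eq, mem_inter_iff, mem_iInter]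
      refine and_congr_right fun _ => forall₂_congr fun i j => ?_
      exact integrableOn_gaussIntegrand_iff o₁ P₁ o₂ P₂ hx hy v (oU _) i j
    rw [h]
    refine (isOpen_disjoint_hyperplaneProj hx hy).measurableSet.inter
      (MeasurableSet.iInter fun i => MeasurableSet.iInter fun j => measurable_subtype_coe ?_)
    exact measurableSet_integrable_kernelFactor (aemeasurable_pairWeight o₁ P₁ o₂ P₂ i j)
      (aemeasurable_configCols P₁ P₂ hx hy i j)
  rw [hyperplaneMeasure_eq_map]
  refine (ae_map_iff (measurable_normalHyperplane_unitDir _).aemeasurable hmeas).2 ?_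
  have h1 : ∀ i j, ∀ᵐ v ∂gaussMeasure (m + n + 2),
      Integrable (fun z => pairWeight o₁ P₁ o₂ P₂ i j z *
          kernelFactor (configCols P₁ P₂ x y i j z) v)
        (volume.restrict (coordDomain P₁ i ×ˢ coordDomain P₂ j)) := fun i j =>
    ae_integrable_kernelFactor (aemeasurable_pairWeight o₁ P₁ o₂ P₂ i j)
      (aemeasurable_configCols P₁ P₂ hx hy i j)
      (integrable_config_kernelFactor o₁ P₁ o₂ P₂ hx hy hk hxy i j i j)
  filter_upwards [ae_gaussMeasure_ne_zero (m + n), ae_disjoint_hyperplaneProj P₁ P₂ hx hy hxy,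
    ae_all_iff.2 fun i => ae_all_iff.2 fun j => h1 i j] with v hv h2 h3
  refine ⟨h2, fun i j => ?_⟩
  refine (integrableOn_gaussIntegrand_iff o₁ P₁ o₂ P₂ hx hy (unitDir v) (oU _) i j).2 ?_
  rw [coe_unitDir hv]
  simp_rw [kernelFactor_dir _ hv]
  exact h3 i j

end Smooth

end Average

/-! ### The moment integrals -/

section Moments

variable {k : ℕ}

theorem ofReal_inv_pow_le (x : ℝ) (l : ℕ) (hx : 0 ≤ x) :
    ENNReal.ofReal ((x ^ l)⁻¹) ≤ ENNReal.ofReal x ^ (-(l : ℝ)) := by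
  rw [ENNReal.rpow_neg, ENNReal.rpow_natCast, ← ENNReal.ofReal_pow hx]
  rcases (pow_nonneg hx l).eq_or_lt' with h | h
  · simp [h]
  · rw [ENNReal.ofReal_inv_of_pos h]

theorem integrable_inv_sine_pow_mul (hk : 1 ≤ k) {q q' : Euc (k + 2)} (hq : q ≠ 0) (hq' : q' ≠ 0)
    (h : sine q q' ≠ 0) :
    Integrable (fun v => (sine q v ^ k)⁻¹ * (sine q' v ^ k)⁻¹) (gaussMeasure (k + 2)) := by
  have hm : ∀ p : Euc (k + 2), Measurable fun v => (sine p v ^ k)⁻¹ := fun p => by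
    simp_rw [sine_comm p]
    exact ((measurable_sine_comp measurable_id p).pow_const k).inv
  refine ⟨((hm q).mul (hm q')).aestronglyMeasurable, ?_⟩
  obtain ⟨C, hC⟩ := exists_lintegral_sine_mul_sine_le hk
  refine lt_of_le_of_lt (le_trans (lintegral_mono fun v => ?_) (hC q q' hq hq')) ?_
  · have h1 := inv_nonneg.2 (pow_nonneg (sine_nonneg q v) k)
    have h2 := inv_nonneg.2 (pow_nonneg (sine_nonneg q' v) k)
    rw [Real.enorm_of_nonneg (mul_nonneg h1 h2), ENNReal.ofReal_mul h1]
    exact mul_le_mul' (ofReal_inv_pow_le _ k (sine_nonneg _ _))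
      (ofReal_inv_pow_le _ k (sine_nonneg _ _))
  · refine ENNReal.mul_lt_top ENNReal.coe_lt_top (lt_top_iff_ne_top.2 ?_)
    have h0 : 0 < sine q q' := (sine_nonneg _ _).lt_of_ne' h
    exact ENNReal.rpow_ne_top_of_ne_zero (by simpa using h0) ENNReal.ofReal_ne_top

/-- The kernel converges absolutely. -/
theorem integrable_kernelFactor_mul_gaussDensity (hk : 1 ≤ k)
    {A A' : Fin (k + 1) → Euc (k + 2)} (h : LinearIndependent ℝ ![lastCol A, lastCol A']) :
    Integrable fun v => kernelFactor A v * kernelFactor A' v * gaussDensity v := by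
  rw [← integrable_gaussMeasure_iff fun v => kernelFactor A v * kernelFactor A' v]
  have hq : lastCol A ≠ 0 := h.ne_zero 0
  have hq' : lastCol A' ≠ 0 := h.ne_zero 1
  obtain ⟨C, hC⟩ := exists_lintegral_sine_mul_sine_le hk
  refine ⟨((measurable_kernelFactor_comp measurable_const measurable_id).mul
    (measurable_kernelFactor_comp measurable_const measurable_id)).aestronglyMeasurable, ?_⟩
  have hfin : C * ENNReal.ofReal (sine (lastCol A) (lastCol A')) ^ (-((k : ℝ) - 1 / 2)) < ⊤ :=
    ENNReal.mul_lt_top ENNReal.coe_lt_top (lt_top_iff_ne_top.2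
      (ENNReal.rpow_ne_top_of_ne_zero (by simpa using sine_pos_of_linearIndependent h)
        ENNReal.ofReal_ne_top))
  have hc : ENNReal.ofReal (‖cross A‖ * (‖lastCol A‖ ^ (k + 1))⁻¹) *
      ENNReal.ofReal (‖cross A'‖ * (‖lastCol A'‖ ^ (k + 1))⁻¹) ≠ ⊤ :=
    ENNReal.mul_ne_top ENNReal.ofReal_ne_top ENNReal.ofReal_ne_top
  refine lt_of_le_of_lt (b := ENNReal.ofReal (‖cross A‖ * (‖lastCol A‖ ^ (k + 1))⁻¹) *
      ENNReal.ofReal (‖cross A'‖ * (‖lastCol A'‖ ^ (k + 1))⁻¹) * _) ?_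
    (ENNReal.mul_lt_top (lt_top_iff_ne_top.2 hc) ((hC _ _ hq hq').trans_lt hfin))
  rw [← lintegral_const_mul' _ _ hc]
  refine lintegral_mono fun v => ?_
  rw [enorm_mul, Real.enorm_eq_ofReal_abs, Real.enorm_eq_ofReal_abs]
  refine (mul_le_mul' (ofReal_abs_kernelFactor_le A v) (ofReal_abs_kernelFactor_le A' v)).trans
    (le_of_eq ?_)
  ring

variable {α β : ℝ}

/-- The unit vector `(α, β, 0, …, 0)`. -/
def axis (α β : ℝ) : Euc (k + 2) :=
  α • EuclideanSpace.single 0 1 + β • EuclideanSpace.single 1 1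

theorem inner_axis (v : Euc (k + 2)) : ⟪axis α β, v⟫ = α * v 0 + β * v 1 := by
  simp [axis, inner_add_left, inner_smul_left, EuclideanSpace.inner_single_left]

theorem norm_axis (hab : α ^ 2 + β ^ 2 = 1) : ‖(axis α β : Euc (k + 2))‖ = 1 := by
  rw [← sq_eq_sq₀ (norm_nonneg _) zero_le_one, ← real_inner_self_eq_norm_sq, inner_axis, one_pow,
    ← hab]
  simp [axis]
  ring

theorem quadForm_eq (hab : α ^ 2 + β ^ 2 = 1) (v : Euc (k + 2)) :
    quadForm α β v = ‖v‖ ^ 2 - (α * v 0 + β * v 1) ^ 2 := by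
  rw [EuclideanSpace.norm_sq_eq, Fin.sum_univ_succ, Fin.sum_univ_succ, quadForm]
  simp only [Real.norm_eq_abs, sq_abs, Fin.succ_zero_eq_one]
  linear_combination ((v 0) ^ 2 + (v 1) ^ 2) * hab

/-- The form is the squared distance of v from the line of (α, β, 0, …, 0). The form with -α belongs
to (-α, β, 0, …, 0), which up to sign is the coordinate vector of q'. -/
theorem quadForm_eq_sq (hab : α ^ 2 + β ^ 2 = 1) (v : Euc (k + 2)) :
    quadForm α β v = (‖v‖ * sine (axis α β) v) ^ 2 := by
  have h := sine_sq_mul (axis α β) v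
  rw [norm_axis hab, inner_axis] at h
  rw [quadForm_eq hab]
  linear_combination -h

theorem sine_axis_axis_ne_zero (hab : α ^ 2 + β ^ 2 = 1) (hα : α ≠ 0) (hβ : β ≠ 0) :
    sine (axis α β : Euc (k + 2)) (axis (-α) β) ≠ 0 := by
  intro h0
  have h := sine_sq_mul (axis α β : Euc (k + 2)) (axis (-α) β)
  rw [h0, norm_axis hab, norm_axis (by simpa using hab), inner_axis] at h
  have h1 : (α * β) ^ 2 = 0 := by
    simp [axis] at h
    linear_combination (-1 / 4) * h + (1 / 4 : ℝ) * (α ^ 2 + β ^ 2 + 1) * hab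
  exact mul_ne_zero hα hβ (pow_eq_zero_iff two_ne_zero |>.1 h1)

theorem sq_rpow_half (x : ℝ) (hx : 0 ≤ x) (l : ℕ) : (x ^ 2) ^ (((l : ℝ) + 1) / 2) = x ^ (l + 1) := by
  rw [← Real.rpow_natCast x 2, ← Real.rpow_mul hx, ← Real.rpow_natCast]
  congr 1
  push_cast
  ring

theorem momentWeight_eq (hab : α ^ 2 + β ^ 2 = 1) (v : Euc (k + 2)) :
    momentWeight α β v = ‖v‖ ^ (2 * k) / ((‖v‖ * sine (axis α β) v) ^ (k + 1) *
      (‖v‖ * sine (axis (-α) β) v) ^ (k + 1)) * gaussDensity v := by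
  have hab' : (-α) ^ 2 + β ^ 2 = 1 := by simpa using hab
  rw [momentWeight, quadForm_eq_sq hab, quadForm_eq_sq hab',
    sq_rpow_half _ (mul_nonneg (norm_nonneg _) (sine_nonneg _ _)),
    sq_rpow_half _ (mul_nonneg (norm_nonneg _) (sine_nonneg _ _))]

theorem measurable_momentWeight : Measurable (momentWeight α β : Euc (k + 2) → ℝ) := by
  have h : ∀ a : ℝ, Measurable (quadForm a β : Euc (k + 2) → ℝ) := fun a => by
    unfold quadForm; fun_prop
  have h1 := h α
  have h2 := h (-α)
  have h3 := (continuous_gaussDensity (d := k + 2)).measurable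
  unfold momentWeight
  fun_prop

theorem momentWeight_congr (hab : α ^ 2 + β ^ 2 = 1) {v w : Euc (k + 2)} (hn : ‖v‖ = ‖w‖)
    (h0 : v 0 = w 0) (h1 : v 1 = w 1) : momentWeight α β v = momentWeight α β w := by
  have hab' : (-α) ^ 2 + β ^ 2 = 1 := by simpa using hab
  simp only [momentWeight, quadForm_eq hab, quadForm_eq hab', gaussDensity, hn, h0, h1]

/-- The weight is singular of order k + 1 on each of the two lines. A numerator vanishing to first
order on both lowers the orders to k, where the convolution estimate applies. -/
theorem abs_momentWeight_mul_le (hab : α ^ 2 + β ^ 2 = 1) {v : Euc (k + 2)} {t C : ℝ}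
    (hC : 0 ≤ C) (ht : |t| ≤ C * (√(quadForm α β v) * √(quadForm (-α) β v))) :
    |momentWeight α β v * t| ≤
      C * (((sine (axis α β) v ^ k)⁻¹ * (sine (axis (-α) β) v ^ k)⁻¹) * gaussDensity v) := by
  have hab' : (-α) ^ 2 + β ^ 2 = 1 := by simpa using hab
  have hS := sine_nonneg (axis α β) v
  have hS' := sine_nonneg (axis (-α) β) v
  rw [quadForm_eq_sq hab, quadForm_eq_sq hab', Real.sqrt_sq (by positivity),
    Real.sqrt_sq (by positivity)] at ht
  rw [momentWeight_eq hab, abs_mul]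
  have hγ := gaussDensity_pos v
  rw [abs_of_nonneg (by positivity)]
  set S := sine (axis α β) v
  set S' := sine (axis (-α) β) v
  have hr : 0 ≤ C * (((S ^ k)⁻¹ * (S' ^ k)⁻¹) * gaussDensity v) := by positivity
  rcases (norm_nonneg v).eq_or_lt' with hv | hv
  · simpa [hv] using hr
  rcases hS.eq_or_lt' with h | h
  · simpa [h] using hr
  rcases hS'.eq_or_lt' with h' | h'
  · simpa [h'] using hr
  calc ‖v‖ ^ (2 * k) / ((‖v‖ * S) ^ (k + 1) * (‖v‖ * S') ^ (k + 1)) * gaussDensity v * |t|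
      ≤ ‖v‖ ^ (2 * k) / ((‖v‖ * S) ^ (k + 1) * (‖v‖ * S') ^ (k + 1)) * gaussDensity v *
          (C * (‖v‖ * S * (‖v‖ * S'))) := by gcongr
    _ = C * (((S ^ k)⁻¹ * (S' ^ k)⁻¹) * gaussDensity v) := by
        field_simp
        ring

theorem integrable_momentWeight_mul (hk : 1 ≤ k) (hab : α ^ 2 + β ^ 2 = 1) (hα : α ≠ 0)
    (hβ : β ≠ 0) {f : Euc (k + 2) → ℝ} (hf : Measurable f) {C : ℝ} (hC : 0 ≤ C)
    (h : ∀ v, |f v| ≤ C * (√(quadForm α β v) * √(quadForm (-α) β v))) :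
    Integrable fun v => momentWeight α β v * f v := by
  have hab' : (-α) ^ 2 + β ^ 2 = 1 := by simpa using hab
  have hne : ∀ {a b : ℝ}, a ^ 2 + b ^ 2 = 1 → (axis a b : Euc (k + 2)) ≠ 0 := fun hab h0 => by
    have := norm_axis (k := k) hab
    rw [h0, norm_zero] at this
    exact zero_ne_one this
  have h1 := ((integrable_gaussMeasure_iff _).1 (integrable_inv_sine_pow_mul hk (hne hab)
    (hne hab') (sine_axis_axis_ne_zero hab hα hβ))).const_mul C
  refine h1.mono' (measurable_momentWeight.mul hf).aestronglyMeasurable (ae_of_all _ fun v => ?_)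
  exact abs_momentWeight_mul_le hab hC (h v)

theorem quadForm_nonneg (v : Euc (k + 2)) : 0 ≤ quadForm α β v := by
  unfold quadForm; positivity

theorem abs_linear_le_sqrt_quadForm (v : Euc (k + 2)) :
    |β * v 0 - α * v 1| ≤ √(quadForm α β v) := by
  refine Real.abs_le_sqrt ?_
  rw [quadForm]
  exact le_add_of_nonneg_right (Finset.sum_nonneg fun j _ => sq_nonneg _)

theorem abs_apply_le_sqrt_quadForm (v : Euc (k + 2)) (j : Fin k) :
    |v j.succ.succ| ≤ √(quadForm α β v) := by
  refine Real.abs_le_sqrt ?_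
  rw [quadForm]
  refine le_add_of_nonneg_of_le (sq_nonneg _) ?_
  exact Finset.single_le_sum (f := fun j : Fin k => v j.succ.succ ^ 2)
    (fun j _ => sq_nonneg _) (Finset.mem_univ j)

/-- The reflection in the `i`-th coordinate. -/
def coordReflection (i : Fin (k + 2)) : Euc (k + 2) ≃ₗᵢ[ℝ] Euc (k + 2) :=
  LinearIsometryEquiv.piLpCongrRight 2 fun j =>
    if j = i then LinearIsometryEquiv.neg ℝ else LinearIsometryEquiv.refl ℝ ℝ

theorem coordReflection_apply_self (i : Fin (k + 2)) (v : Euc (k + 2)) :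
    coordReflection i v i = -v i := by
  simp [coordReflection]

theorem coordReflection_apply_of_ne {i j : Fin (k + 2)} (h : j ≠ i) (v : Euc (k + 2)) :
    coordReflection i v j = v j := by
  simp [coordReflection, h]

/-- The interchange of two coordinates. -/
def coordSwap (i j : Fin (k + 2)) : Euc (k + 2) ≃ₗᵢ[ℝ] Euc (k + 2) :=
  LinearIsometryEquiv.piLpCongrLeft 2 ℝ ℝ (Equiv.swap i j)

theorem coordSwap_apply (i j l : Fin (k + 2)) (v : Euc (k + 2)) :
    coordSwap i j v l = v (Equiv.swap i j l) := by
  simp [coordSwap, LinearIsometryEquiv.piLpCongrLeft_apply, Equiv.piCongrLeft'_apply]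

/-- The weight depends only on ‖v‖, v 0 and v 1, so isometries fixing the first two coordinates
preserve it. Reflections then annihilate the odd moments, and interchanges identify the remaining
diagonal ones. -/
theorem integral_momentWeight_mul_comp (hab : α ^ 2 + β ^ 2 = 1)
    (e : Euc (k + 2) ≃ₗᵢ[ℝ] Euc (k + 2)) (h0 : ∀ v, e v 0 = v 0) (h1 : ∀ v, e v 1 = v 1)
    (f : Euc (k + 2) → ℝ) :
    ∫ v, momentWeight α β v * f (e v) = ∫ v, momentWeight α β v * f v := by
  rw [← e.measurePreserving.integral_comp e.toHomeomorph.measurableEmbedding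
    fun v => momentWeight α β v * f v]
  refine integral_congr_ae (ae_of_all _ fun v => ?_)
  simp only [momentWeight_congr hab (e.norm_map v) (h0 v) (h1 v)]

theorem zero_ne_succ_succ (j : Fin k) : (0 : Fin (k + 2)) ≠ j.succ.succ :=
  (Fin.succ_ne_zero _).symm

theorem one_ne_succ_succ (j : Fin k) : (1 : Fin (k + 2)) ≠ j.succ.succ := fun h =>
  Fin.succ_ne_zero j (Fin.succ_injective _ (Fin.succ_zero_eq_one.trans h)).symm

theorem integral_momentWeight_mul_eq_zero (hab : α ^ 2 + β ^ 2 = 1) (j : Fin k)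
    {f : Euc (k + 2) → ℝ} (hf : ∀ v, f (coordReflection j.succ.succ v) = -f v) :
    ∫ v, momentWeight α β v * f v = 0 := by
  have h := integral_momentWeight_mul_comp hab (coordReflection j.succ.succ)
    (coordReflection_apply_of_ne (zero_ne_succ_succ j))
    (coordReflection_apply_of_ne (one_ne_succ_succ j)) f
  simp_rw [hf, mul_neg, integral_neg] at h
  linarith

theorem moment_succ_succ_eq (hab : α ^ 2 + β ^ 2 = 1) (j l : Fin k) :
    moment α β j.succ.succ = moment α β l.succ.succ := by
  have h0 := zero_ne_succ_succ (k := k)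
  have h1 := one_ne_succ_succ (k := k)
  have h := integral_momentWeight_mul_comp hab (coordSwap j.succ.succ l.succ.succ)
    (fun v => by rw [coordSwap_apply, Equiv.swap_apply_of_ne_of_ne (h0 j) (h0 l)])
    (fun v => by rw [coordSwap_apply, Equiv.swap_apply_of_ne_of_ne (h1 j) (h1 l)])
    (fun v => v l.succ.succ ^ 2)
  simp_rw [coordSwap_apply, Equiv.swap_apply_right] at h
  exact h

theorem integrable_momentWeight_mul_sq (hk : 1 ≤ k) (hab : α ^ 2 + β ^ 2 = 1) (hα : α ≠ 0)
    (hβ : β ≠ 0) (j l : Fin k) :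
    Integrable fun v : Euc (k + 2) =>
      momentWeight α β v * (v j.succ.succ * v l.succ.succ) := by
  refine integrable_momentWeight_mul hk hab hα hβ (by fun_prop) zero_le_one fun v => ?_
  rw [one_mul, abs_mul]
  exact mul_le_mul (abs_apply_le_sqrt_quadForm v j) (abs_apply_le_sqrt_quadForm v l)
    (abs_nonneg _) (Real.sqrt_nonneg _)

theorem integral_momentWeight_mul_mul (hab : α ^ 2 + β ^ 2 = 1) (i j l : Fin k) :
    ∫ v : Euc (k + 2), momentWeight α β v * (v j.succ.succ * v l.succ.succ) =
      if j = l then moment α β i.succ.succ else 0 := by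
  split_ifs with h
  · subst h
    rw [moment_succ_succ_eq hab i j, moment]
    simp_rw [sq]
  · refine integral_momentWeight_mul_eq_zero hab j fun v => ?_
    have hl : l.succ.succ ≠ j.succ.succ := fun h' =>
      h (Fin.succ_injective _ (Fin.succ_injective _ h')).symm
    rw [coordReflection_apply_self, coordReflection_apply_of_ne hl, neg_mul]

/-! ### Truncation -/

theorem measurable_quadForm : Measurable (quadForm α β : Euc (k + 2) → ℝ) := by
  unfold quadForm; fun_prop

theorem measurableSet_truncRegion (ε : ℝ) : MeasurableSet (truncRegion k α β ε) :=
  (measurableSet_le (by fun_prop) measurable_quadForm).inter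
    (measurableSet_le (by fun_prop) measurable_quadForm)

/-- On the region the product of the two distances is at least ε‖v‖², so the integrand is at most
ε^(-(k+1)) times the Gaussian density. -/
theorem integrableOn_truncRegion (hab : α ^ 2 + β ^ 2 = 1) {ε : ℝ} (hε : 0 < ε)
    (i : Fin (k + 2)) :
    IntegrableOn (fun v => momentWeight α β v * v i ^ 2) (truncRegion k α β ε) := by
  have hab' : (-α) ^ 2 + β ^ 2 = 1 := by simpa using hab
  have h1 := ((integrable_gaussDensity (k + 2)).const_mul (ε ^ (k + 1))⁻¹).integrableOn
    (s := truncRegion k α β ε)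
  refine h1.mono' (measurable_momentWeight.mul (by fun_prop)).aestronglyMeasurable ?_
  rw [ae_restrict_iff' (measurableSet_truncRegion ε)]
  refine ae_of_all _ fun v hv => ?_
  have hγ := gaussDensity_pos v
  have hQ : ∀ {a : ℝ}, a ^ 2 + β ^ 2 = 1 → 0 ≤ ‖v‖ * sine (axis a β) v := fun _ =>
    mul_nonneg (norm_nonneg _) (sine_nonneg _ _)
  obtain ⟨h2, h3⟩ := hv
  rw [quadForm_eq_sq hab] at h2
  rw [quadForm_eq_sq hab'] at h3
  rw [momentWeight_eq hab, Real.norm_eq_abs, abs_mul, abs_of_nonneg (sq_nonneg (v i)),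
    abs_of_nonneg (mul_nonneg (div_nonneg (by positivity)
      (mul_nonneg (pow_nonneg (hQ hab) _) (pow_nonneg (hQ hab') _))) hγ.le)]
  set s := ‖v‖ * sine (axis α β) v with hs
  set s' := ‖v‖ * sine (axis (-α) β) v with hs'
  have hs0 := hQ hab
  have hs0' := hQ hab'
  have hvi : v i ^ 2 ≤ ‖v‖ ^ 2 := by
    rw [← sq_abs, ← Real.norm_eq_abs]
    exact pow_le_pow_left₀ (norm_nonneg _) (PiLp.norm_apply_le v i) 2
  rcases eq_or_ne v 0 with rfl | hv0
  · have : (0 : Euc (k + 2)) i = 0 := rfl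
    rw [this]
    have : 0 ≤ (ε ^ (k + 1))⁻¹ * gaussDensity (0 : Euc (k + 2)) := by positivity
    simpa using this
  have hN : 0 < ‖v‖ := norm_pos_iff.2 hv0
  have h4 : ε * ‖v‖ ^ 2 ≤ s * s' := by
    refine le_of_sq_le_sq ?_ (mul_nonneg hs0 hs0')
    calc (ε * ‖v‖ ^ 2) ^ 2 = (ε * ‖v‖ ^ 2) * (ε * ‖v‖ ^ 2) := sq _
      _ ≤ s ^ 2 * s' ^ 2 := mul_le_mul h2 h3 (by positivity) (by positivity)
      _ = (s * s') ^ 2 := by ring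
  have h5 : 0 < s * s' := lt_of_lt_of_le (by positivity) h4
  calc ‖v‖ ^ (2 * k) / (s ^ (k + 1) * s' ^ (k + 1)) * gaussDensity v * v i ^ 2
      ≤ ‖v‖ ^ (2 * k) / (ε * ‖v‖ ^ 2) ^ (k + 1) * gaussDensity v * ‖v‖ ^ 2 := by
        rw [← mul_pow]
        gcongr
    _ = (ε ^ (k + 1))⁻¹ * gaussDensity v := by
        field_simp
        ring

theorem tendsto_truncMoment (hab : α ^ 2 + β ^ 2 = 1) {X Y : ℝ} (hint : Integrable fun v : Euc (k + 2) =>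
      momentWeight α β v * (v 0 ^ 2 * X + v 1 ^ 2 * Y)) :
    Tendsto (fun ε : ℝ => truncMoment (k := k) ε α β 0 * X + truncMoment (k := k) ε α β 1 * Y)
      (𝓝[>] 0) (𝓝 (pairMoment k α β X Y)) := by
  have h1 : ∀ᶠ ε : ℝ in 𝓝[>] 0,
      ∫ v, (truncRegion k α β ε).indicator (fun v : Euc (k + 2) =>
        momentWeight α β v * (v 0 ^ 2 * X + v 1 ^ 2 * Y)) v =
      truncMoment (k := k) ε α β 0 * X + truncMoment (k := k) ε α β 1 * Y := by
    filter_upwards [self_mem_nhdsWithin] with ε hε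
    rw [integral_indicator (measurableSet_truncRegion ε), truncMoment, truncMoment,
      ← integral_mul_const, ← integral_mul_const, ← integral_add
      ((integrableOn_truncRegion hab hε 0).mul_const X)
      ((integrableOn_truncRegion hab hε 1).mul_const Y)]
    refine integral_congr_ae (ae_of_all _ fun v => ?_)
    ring
  refine Tendsto.congr' h1 ?_
  refine tendsto_integral_filter_of_dominated_convergence
    (fun v : Euc (k + 2) => ‖momentWeight α β v * (v 0 ^ 2 * X + v 1 ^ 2 * Y)‖)
    (Eventually.of_forall fun ε =>
      hint.aestronglyMeasurable.indicator (measurableSet_truncRegion ε))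
    (Eventually.of_forall fun ε => ae_of_all _ fun v => norm_indicator_le_norm_self _ _)
    hint.norm (ae_of_all _ fun v => ?_)
  classical
  -- On the two singular lines the weight is 0 by the convention for division. Any other v lies in
  -- the truncated region once ε is small, so the truncated integrands converge pointwise
  -- everywhere, dominated by the combined integrand.
  rcases (quadForm_nonneg (α := α) (β := β) v).eq_or_lt' with h | h
  · have h0 : momentWeight α β v = 0 := by
      rw [momentWeight, h, Real.zero_rpow (by positivity)]
      simp
    simp [indicator_apply, h0]
  rcases (quadForm_nonneg (α := -α) (β := β) v).eq_or_lt' with h' | h'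
  · have h0 : momentWeight α β v = 0 := by
      rw [momentWeight, h', Real.zero_rpow (by positivity)]
      simp
    simp [indicator_apply, h0]
  have h2 : Tendsto (fun ε : ℝ => ε * ‖v‖ ^ 2) (𝓝[>] 0) (𝓝 0) := by
    have : Tendsto (fun ε : ℝ => ε * ‖v‖ ^ 2) (𝓝 0) (𝓝 (0 * ‖v‖ ^ 2)) :=
      (continuous_id.mul continuous_const).tendsto 0
    rw [zero_mul] at this
    exact this.mono_left nhdsWithin_le_nhds
  refine tendsto_const_nhds.congr' ?_
  filter_upwards [h2.eventually_le_const h, h2.eventually_le_const h'] with ε h3 h4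
  rw [indicator_of_mem (show v ∈ truncRegion k α β ε from ⟨h3, h4⟩)]

end Moments

/-! ### The form of the kernel -/

section Decomposition

variable {k : ℕ}

theorem sq_det_of_orthonormal {d : ℕ} {f : Fin d → Euc d}
    (hf : ∀ i j, ⟪f i, f j⟫ = if i = j then (1 : ℝ) else 0) :
    (Matrix.of fun r c => f r c).det ^ 2 = 1 := by
  rw [sq]
  nth_rw 2 [← Matrix.det_transpose]
  rw [← Matrix.det_mul]
  convert Matrix.det_one (n := Fin d) (R := ℝ) using 2
  ext i j
  rw [Matrix.mul_apply, Matrix.one_apply, ← hf i j]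
  simp [PiLp.inner_apply, mul_comm]

/-- The cross product of all basis vectors but bᵢ is ±bᵢ, and the sign occurs twice. -/
theorem crossPairing_succAbove (b : OrthonormalBasis (Fin (k + 2)) ℝ (Euc (k + 2)))
    (i : Fin (k + 2)) (A A' : Fin (k + 1) → Euc (k + 2)) :
    crossPairing (fun j => b (i.succAbove j)) A A' = ⟪b i, cross A⟫ * ⟪b i, cross A'⟫ := by
  set c : Fin (k + 1) → Euc (k + 2) := fun j => b (i.succAbove j)
  have hb := orthonormal_iff_ite.1 b.orthonormal
  have h1 : cross c = ⟪b i, cross c⟫ • b i := by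
    rw [← b.sum_repr' (cross c), Fin.sum_univ_succAbove _ i]
    have : ∀ j, ⟪b (i.succAbove j), cross c⟫ = 0 := fun j => by
      rw [real_inner_comm]; exact inner_cross_self c j
    simp [this, inner_smul_right]
  have h2 : ⟪b i, cross c⟫ ^ 2 = 1 := by
    rw [real_inner_comm, inner_cross]
    refine sq_det_of_orthonormal fun r s => ?_
    refine Fin.cases ?_ (fun r => ?_) r <;> refine Fin.cases ?_ (fun s => ?_) s <;>
      simp [c, hb, Fin.succ_ne_zero, (Fin.succ_ne_zero _).symm, Fin.succAbove_ne,
        Fin.ne_succAbove]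
  rw [crossPairing, h1, inner_smul_left, inner_smul_left]
  simp only [conj_trivial]
  linear_combination (⟪b i, cross A⟫ * ⟪b i, cross A'⟫) * h2

theorem sine_neg_left {d : ℕ} (w v : Euc d) : sine (-w) v = sine w v := by
  rw [sine, sine, InnerProductGeometry.angle_neg_left, Real.sin_pi_sub]

theorem sine_dir_left {d : ℕ} {w : Euc d} (hw : w ≠ 0) (v : Euc d) : sine (dir w) v = sine w v := by
  have : 0 < ‖w‖⁻¹ := inv_pos.2 (norm_pos_iff.2 hw)
  rw [sine, sine, dir, InnerProductGeometry.angle_smul_left_of_pos _ _ this]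

/-- Two unit vectors in terms of the directions of their sum and difference. -/
theorem dir_add_dir_sub {d : ℕ} {u u' : Euc d} (hu : ‖u‖ = 1) (hu' : ‖u'‖ = 1)
    (h : LinearIndependent ℝ ![u, u']) {e₀ e₁ : Euc d} (h0 : e₀ = dir (u + u'))
    (h1 : e₁ = dir (u - u')) :
    ⟪e₀, u⟫ ^ 2 + ⟪e₁, u⟫ ^ 2 = 1 ∧ ⟪e₀, u⟫ ≠ 0 ∧ ⟪e₁, u⟫ ≠ 0 ∧
      u = ⟪e₀, u⟫ • e₀ + ⟪e₁, u⟫ • e₁ ∧ u' = ⟪e₀, u⟫ • e₀ - ⟪e₁, u⟫ • e₁ := by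
  rw [LinearIndependent.pair_iff] at h
  have hp : u + u' ≠ 0 := fun h' => by simpa using (h 1 1 (by simpa using h')).1
  have hm : u - u' ≠ 0 := fun h' => by
    simpa using (h 1 (-1) (by simpa [sub_eq_add_neg] using h')).1
  have hp' := norm_ne_zero_iff.2 hp
  have hm' := norm_ne_zero_iff.2 hm
  have e0 : ⟪e₀, u⟫ = ‖u + u'‖ / 2 := by
    have h2 : ‖u + u'‖ ^ 2 = 2 * ⟪u + u', u⟫ := by
      rw [norm_add_sq_real, hu, hu', inner_add_left, real_inner_self_eq_norm_sq, hu,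
        real_inner_comm u']
      ring
    rw [h0, dir, inner_smul_left, conj_trivial]
    field_simp
    linarith
  have e1 : ⟪e₁, u⟫ = ‖u - u'‖ / 2 := by
    have h2 : ‖u - u'‖ ^ 2 = 2 * ⟪u - u', u⟫ := by
      rw [norm_sub_sq_real, hu, hu', inner_sub_left, real_inner_self_eq_norm_sq, hu,
        real_inner_comm u']
      ring
    rw [h1, dir, inner_smul_left, conj_trivial]
    field_simp
    linarith
  have s0 : ⟪e₀, u⟫ • e₀ = (1 / 2 : ℝ) • (u + u') := by
    rw [e0, h0, dir, smul_smul]; congr 1; field_simp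
  have s1 : ⟪e₁, u⟫ • e₁ = (1 / 2 : ℝ) • (u - u') := by
    rw [e1, h1, dir, smul_smul]; congr 1; field_simp
  refine ⟨?_, ?_, ?_, ?_, ?_⟩
  · have := parallelogram_law_with_norm ℝ u u'
    rw [hu, hu'] at this
    rw [e0, e1]
    linarith
  · rw [e0]; positivity
  · rw [e1]; positivity
  · rw [s0, s1, ← smul_add]; module
  · rw [s0, s1, ← smul_sub]; module

variable {A A' : Fin (k + 1) → Euc (k + 2)} {α β : ℝ}
  {b : OrthonormalBasis (Fin (k + 2)) ℝ (Euc (k + 2))}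

theorem repr_symm_axis : b.repr.symm (axis α β) = α • b 0 + β • b 1 := by
  rw [axis, map_add, map_smul, map_smul, b.repr_symm_single, b.repr_symm_single]

theorem sine_repr_symm (w v : Euc (k + 2)) : sine (b.repr.symm w) (b.repr.symm v) = sine w v := by
  rw [sine, sine]
  congr 1
  exact b.repr.symm.toLinearIsometry.angle_map w v

theorem inner_repr_symm (w v : Euc (k + 2)) :
    ⟪w, b.repr.symm v⟫ = v 0 * ⟪b 0, w⟫ + v 1 * ⟪b 1, w⟫ +
      ∑ j : Fin k, v j.succ.succ * ⟪b j.succ.succ, w⟫ := by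
  rw [← b.sum_repr_symm, inner_sum, Fin.sum_univ_succ, Fin.sum_univ_succ]
  simp only [inner_smul_right, real_inner_comm w, Fin.succ_zero_eq_one]
  exact (add_assoc _ _ _).symm

/-- In the coordinates of b the two sines become those with the axes (α, β) and (-α, β). The sign
(-1)^(k+1) occurs twice, and normalizing v in both determinants gives the factor ‖v‖^(-2) contained
in the weight. -/
theorem kernelFactor_mul_repr_symm (hab : α ^ 2 + β ^ 2 = 1) (hq : lastCol A ≠ 0)
    (hq' : lastCol A' ≠ 0) (hu : dir (lastCol A) = α • b 0 + β • b 1)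
    (hu' : dir (lastCol A') = α • b 0 - β • b 1) (v : Euc (k + 2)) :
    kernelFactor A (b.repr.symm v) * kernelFactor A' (b.repr.symm v) *
        gaussDensity (b.repr.symm v) * (‖lastCol A‖ ^ (k + 1) * ‖lastCol A'‖ ^ (k + 1)) =
      momentWeight α β v * (⟪cross A, b.repr.symm v⟫ * ⟪cross A', b.repr.symm v⟫) := by
  rcases eq_or_ne v 0 with rfl | hv
  · simp [kernelFactor, detCols_snoc, dir_zero]
  have hw : b.repr.symm v ≠ 0 := by simpa using hv
  have hs : sine (lastCol A) (b.repr.symm v) = sine (axis α β) v := by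
    rw [← sine_dir_left hq, hu, ← repr_symm_axis, sine_repr_symm]
  have hs' : sine (lastCol A') (b.repr.symm v) = sine (axis (-α) β) v := by
    rw [← sine_dir_left hq', hu', ← sine_neg_left, neg_sub, sub_eq_neg_add, ← neg_smul,
      ← repr_symm_axis, sine_repr_symm]
  have hγ : gaussDensity (b.repr.symm v) = gaussDensity v := by
    rw [gaussDensity, gaussDensity, LinearIsometryEquiv.norm_map]
  rw [kernelFactor_eq A hw, kernelFactor_eq A' hw, hs, hs', hγ, momentWeight_eq hab, dir,
    inner_smul_right, inner_smul_right, LinearIsometryEquiv.norm_map]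
  have hn : ‖v‖ ≠ 0 := norm_ne_zero_iff.2 hv
  have hn1 : ‖lastCol A‖ ≠ 0 := norm_ne_zero_iff.2 hq
  have hn2 : ‖lastCol A'‖ ≠ 0 := norm_ne_zero_iff.2 hq'
  set S := sine (axis α β) v
  set S' := sine (axis (-α) β) v
  have hsgn : ((-1 : ℝ) ^ (k + 1)) ^ 2 = 1 := by rw [← pow_mul, mul_comm, pow_mul]; simp
  rcases eq_or_ne S 0 with h | h
  · simp [h]
  rcases eq_or_ne S' 0 with h' | h'
  · simp [h']
  field_simp
  rw [hsgn]
  ring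

/-- Orthogonality to a_N forces the part of the cross product in the plane of b 0 and b 1 to be a
multiple of (β, -α). -/
theorem exists_inner_repr_symm_eq (hab : α ^ 2 + β ^ 2 = 1)
    (hu : dir (lastCol A) = α • b 0 + β • b 1) :
    ∃ τ : ℝ, ⟪b 0, cross A⟫ = β * τ ∧ ⟪b 1, cross A⟫ = -α * τ := by
  have h0 : α * ⟪b 0, cross A⟫ + β * ⟪b 1, cross A⟫ = 0 := by
    have h1 : ⟪cross A, lastCol A⟫ = 0 := inner_cross_self A _
    have h2 : ⟪dir (lastCol A), cross A⟫ = 0 := by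
      rw [dir, inner_smul_left, real_inner_comm, h1, mul_zero]
    rw [hu, inner_add_left, inner_smul_left, inner_smul_left] at h2
    exact h2
  refine ⟨β * ⟪b 0, cross A⟫ - α * ⟪b 1, cross A⟫, ?_, ?_⟩
  · linear_combination (-⟪b 0, cross A⟫) * hab + α * h0
  · linear_combination (-⟪b 1, cross A⟫) * hab + β * h0

/-- The numerator equals T (β v₀ - α v₁)(β v₀ + α v₁), with one factor vanishing on each singular
line. The two squares taken separately do not have this zero. -/
theorem integrable_pairMoment (hk : 1 ≤ k) (hab : α ^ 2 + β ^ 2 = 1) (hα : α ≠ 0) (hβ : β ≠ 0)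
    (T : ℝ) : Integrable fun v : Euc (k + 2) =>
      momentWeight α β v * (v 0 ^ 2 * (β ^ 2 * T) + v 1 ^ 2 * (-α ^ 2 * T)) := by
  refine integrable_momentWeight_mul hk hab hα hβ (by fun_prop) (abs_nonneg T) fun v => ?_
  have h1 := abs_linear_le_sqrt_quadForm (α := α) (β := β) v
  have h2 := abs_linear_le_sqrt_quadForm (α := -α) (β := β) v
  have h3 : v 0 ^ 2 * (β ^ 2 * T) + v 1 ^ 2 * (-α ^ 2 * T) =
      T * ((β * v 0 - α * v 1) * (β * v 0 - -α * v 1)) := by ring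
  rw [h3, abs_mul, abs_mul]
  exact mul_le_mul_of_nonneg_left (mul_le_mul h1 h2 (abs_nonneg _) (Real.sqrt_nonneg _))
    (abs_nonneg _)

theorem integrable_momentWeight_mul_linear (hk : 1 ≤ k) (hab : α ^ 2 + β ^ 2 = 1) (hα : α ≠ 0)
    (hβ : β ≠ 0) (T T' : ℝ) (j : Fin k) : Integrable fun v : Euc (k + 2) =>
      momentWeight α β v *
        ((T * (β * v 0 - α * v 1) + T' * (β * v 0 + α * v 1)) * v j.succ.succ) := by
  have h1 : Integrable fun v : Euc (k + 2) =>
      momentWeight α β v * ((β * v 0 - α * v 1) * v j.succ.succ) := by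
    refine integrable_momentWeight_mul hk hab hα hβ (by fun_prop) zero_le_one fun v => ?_
    rw [one_mul, abs_mul]
    exact mul_le_mul (abs_linear_le_sqrt_quadForm v) (abs_apply_le_sqrt_quadForm v j)
      (abs_nonneg _) (Real.sqrt_nonneg _)
  have h2 : Integrable fun v : Euc (k + 2) =>
      momentWeight α β v * ((β * v 0 + α * v 1) * v j.succ.succ) := by
    refine integrable_momentWeight_mul hk hab hα hβ (by fun_prop) zero_le_one fun v => ?_
    have h3 := abs_linear_le_sqrt_quadForm (α := -α) (β := β) v
    rw [neg_mul, sub_neg_eq_add] at h3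
    rw [one_mul, abs_mul, mul_comm]
    exact mul_le_mul (abs_apply_le_sqrt_quadForm v j) h3 (abs_nonneg _) (Real.sqrt_nonneg _)
  refine ((h1.const_mul T).add (h2.const_mul T')).congr (ae_of_all _ fun v => ?_)
  simp only [Pi.add_apply]
  ring

/-- The numerator is the product of τ(β v₀ - α v₁) + Σ c_j v_j and -τ'(β v₀ + α v₁) + Σ c'_l v_l,
the sums being over the last k coordinates. The first terms multiply to the pair integrand, with no
v₀v₁ term. The mixed products are odd in some v_j, and of the products v_j v_l only the squares
survive. The terms are grouped so that each is integrable by itself. -/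
theorem kernel_mul_norm_pow_eq (hk : 1 ≤ k) (hab : α ^ 2 + β ^ 2 = 1) (hα : α ≠ 0) (hβ : β ≠ 0)
    (hq : lastCol A ≠ 0) (hq' : lastCol A' ≠ 0) (hu : dir (lastCol A) = α • b 0 + β • b 1)
    (hu' : dir (lastCol A') = α • b 0 - β • b 1) (i : Fin k) :
    kernel A A' * (‖lastCol A‖ ^ (k + 1) * ‖lastCol A'‖ ^ (k + 1)) =
      pairMoment k α β (⟪b 0, cross A⟫ * ⟪b 0, cross A'⟫) (⟪b 1, cross A⟫ * ⟪b 1, cross A'⟫) +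
        moment α β i.succ.succ * restPairing b A A' := by
  obtain ⟨τ, hτ0, hτ1⟩ := exists_inner_repr_symm_eq hab hu
  obtain ⟨τ', hτ0', hτ1'⟩ := exists_inner_repr_symm_eq (α := α) (β := -β) (A := A') (by simpa using hab)
    (by rw [hu', neg_smul, sub_eq_add_neg])
  set c : Fin k → ℝ := fun j => ⟪b j.succ.succ, cross A⟫ with hc
  set c' : Fin k → ℝ := fun j => ⟪b j.succ.succ, cross A'⟫ with hc'
  have hl : ∀ v : Euc (k + 2), ⟪cross A, b.repr.symm v⟫ * ⟪cross A', b.repr.symm v⟫ =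
      (v 0 ^ 2 * (β ^ 2 * (-(τ * τ'))) + v 1 ^ 2 * (-α ^ 2 * (-(τ * τ')))) +
      ∑ j, ((τ * c' j) * (β * v 0 - α * v 1) + (-τ' * c j) * (β * v 0 + α * v 1)) * v j.succ.succ +
      ∑ j, ∑ l, (c j * c' l) * (v j.succ.succ * v l.succ.succ) := fun v => by
    rw [inner_repr_symm, inner_repr_symm, hτ0, hτ1, hτ0', hτ1']
    have e1 : ∑ j, ((τ * c' j) * (β * v 0 - α * v 1) + (-τ' * c j) * (β * v 0 + α * v 1)) *
        v j.succ.succ = τ * (β * v 0 - α * v 1) * ∑ j, v j.succ.succ * c' j -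
          τ' * (β * v 0 + α * v 1) * ∑ j, v j.succ.succ * c j := by
      rw [Finset.mul_sum, Finset.mul_sum, ← Finset.sum_sub_distrib]
      exact Finset.sum_congr rfl fun j _ => by ring
    have e2 : ∑ j, ∑ l, (c j * c' l) * (v j.succ.succ * v l.succ.succ) =
        (∑ j, v j.succ.succ * c j) * ∑ j, v j.succ.succ * c' j := by
      rw [Finset.sum_mul_sum]
      exact Finset.sum_congr rfl fun j _ => Finset.sum_congr rfl fun l _ => by ring
    rw [e1, e2]
    ring
  have i0 := integrable_pairMoment (k := k) hk hab hα hβ (-(τ * τ'))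
  have i1 := fun j => integrable_momentWeight_mul_linear hk hab hα hβ (τ * c' j) (-τ' * c j) j
  have i2 := fun j l => (integrable_momentWeight_mul_sq hk hab hα hβ j l).const_mul (c j * c' l)
  have z1 : ∀ j, ∫ v : Euc (k + 2), momentWeight α β v * (((τ * c' j) * (β * v 0 - α * v 1) +
      (-τ' * c j) * (β * v 0 + α * v 1)) * v j.succ.succ) = 0 := fun j => by
    refine integral_momentWeight_mul_eq_zero hab j fun v => ?_
    rw [coordReflection_apply_self, coordReflection_apply_of_ne (zero_ne_succ_succ j),
      coordReflection_apply_of_ne (one_ne_succ_succ j)]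
    ring
  calc kernel A A' * (‖lastCol A‖ ^ (k + 1) * ‖lastCol A'‖ ^ (k + 1))
      = ∫ v, momentWeight α β v * (⟪cross A, b.repr.symm v⟫ * ⟪cross A', b.repr.symm v⟫) := by
        rw [kernel, ← integral_mul_const, ← b.repr.symm.measurePreserving.integral_comp
          b.repr.symm.toHomeomorph.measurableEmbedding]
        exact integral_congr_ae (ae_of_all _ (kernelFactor_mul_repr_symm hab hq hq' hu hu'))
    _ = ∫ v : Euc (k + 2), (momentWeight α β v *
            (v 0 ^ 2 * (β ^ 2 * (-(τ * τ'))) + v 1 ^ 2 * (-α ^ 2 * (-(τ * τ')))) +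
          ∑ j, momentWeight α β v * (((τ * c' j) * (β * v 0 - α * v 1) +
            (-τ' * c j) * (β * v 0 + α * v 1)) * v j.succ.succ) +
          ∑ j, ∑ l, (c j * c' l) * (momentWeight α β v * (v j.succ.succ * v l.succ.succ))) := by
        refine integral_congr_ae (ae_of_all _ fun v => ?_)
        simp only [hl, mul_add, Finset.mul_sum]
        congr 1
        exact Finset.sum_congr rfl fun j _ => Finset.sum_congr rfl fun l _ => by ring
    _ = pairMoment k α β (β ^ 2 * (-(τ * τ'))) (-α ^ 2 * (-(τ * τ'))) + 0 +
          ∑ j, ∑ l, (c j * c' l) * if j = l then moment α β i.succ.succ else 0 := by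
        refine (integral_add (i0.add (integrable_finsetSum Finset.univ fun j _ => i1 j))
          (integrable_finsetSum Finset.univ fun j _ =>
            integrable_finsetSum Finset.univ fun l _ => i2 j l)).trans ?_
        refine (congrArg (· + _) (integral_add i0
          (integrable_finsetSum Finset.univ fun j _ => i1 j))).trans ?_
        rw [integral_finsetSum _ fun j _ => i1 j,
          integral_finsetSum _ fun j _ => integrable_finsetSum _ fun l _ => i2 j l]
        congr 1
        · rw [Finset.sum_eq_zero fun j _ => z1 j]
          rfl
        · refine Finset.sum_congr rfl fun j _ => ?_
          rw [integral_finsetSum _ fun l _ => i2 j l]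
          refine Finset.sum_congr rfl fun l _ => ?_
          rw [integral_const_mul, integral_momentWeight_mul_mul hab i]
    _ = _ := by
        rw [add_zero, restPairing, Finset.mul_sum]
        congr 1
        · rw [hτ0, hτ1, hτ0', hτ1']
          congr 1 <;> ring
        · refine Finset.sum_congr rfl fun j _ => ?_
          simp only [mul_ite, mul_zero, Finset.sum_ite_eq, Finset.mem_univ, if_true]
          ring

theorem kernel_decomposition (hk : 1 ≤ k)
    (h : LinearIndependent ℝ ![lastCol A, lastCol A'])
    (hb0 : b 0 = dir (dir (lastCol A) + dir (lastCol A')))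
    (hb1 : b 1 = dir (dir (lastCol A) - dir (lastCol A')))
    (hα : α = ⟪b 0, dir (lastCol A)⟫) (hβ : β = ⟪b 1, dir (lastCol A)⟫) :
    Integrable (fun v => kernelFactor A v * kernelFactor A' v * gaussDensity v) ∧
    (∀ j : Fin k,
      Integrable (fun v : Euc (k + 2) => momentWeight α β v * v j.succ.succ ^ 2) ∧
      moment α β j.succ.succ = moment (k := k) α β 2) ∧
    Integrable (fun v : Euc (k + 2) => momentWeight α β v *
      (v 0 ^ 2 * crossPairing (fun j => b (Fin.succAbove 0 j)) A A' +
        v 1 ^ 2 * crossPairing (fun j => b (Fin.succAbove 1 j)) A A')) ∧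
    kernel A A' * ‖lastCol A‖ ^ (k + 1) * ‖lastCol A'‖ ^ (k + 1) =
      pairMoment k α β (crossPairing (fun j => b (Fin.succAbove 0 j)) A A')
          (crossPairing (fun j => b (Fin.succAbove 1 j)) A A') +
        moment (k := k) α β 2 * restPairing b A A' ∧
    (∀ ε > 0, ∀ i : Fin (k + 2),
      IntegrableOn (fun v => momentWeight α β v * v i ^ 2) (truncRegion k α β ε)) ∧
    Tendsto (fun ε : ℝ =>
        truncMoment (k := k) ε α β 0 * crossPairing (fun j => b (Fin.succAbove 0 j)) A A' +
        truncMoment (k := k) ε α β 1 * crossPairing (fun j => b (Fin.succAbove 1 j)) A A' +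
        moment (k := k) α β 2 * restPairing b A A')
      (𝓝[>] 0) (𝓝 (kernel A A' * ‖lastCol A‖ ^ (k + 1) * ‖lastCol A'‖ ^ (k + 1))) := by
  have hq : lastCol A ≠ 0 := h.ne_zero 0
  have hq' : lastCol A' ≠ 0 := h.ne_zero 1
  have hdir : LinearIndependent ℝ ![dir (lastCol A), dir (lastCol A')] := by
    have := (LinearIndependent.pair_iff.1 h)
    rw [LinearIndependent.pair_iff]
    intro s t hst
    rw [dir, dir, smul_smul, smul_smul] at hst
    obtain ⟨h1, h2⟩ := this _ _ hst
    simpa [hq, hq'] using And.intro h1 h2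
  obtain ⟨hab, hα0, hβ0, hu, hu'⟩ := dir_add_dir_sub (norm_dir hq) (norm_dir hq') hdir hb0 hb1
  rw [← hα, ← hβ] at hab hu hu'
  rw [← hα] at hα0
  rw [← hβ] at hβ0
  -- The numeral 2 in `Fin (k + 2)` is reduced modulo k + 2; it denotes the third coordinate because
  -- k ≥ 1.
  have h2 : (2 : Fin (k + 2)) = (⟨0, hk⟩ : Fin k).succ.succ := by
    refine Fin.ext ?_
    change 2 % (k + 1 + 1) = 0 + 1 + 1
    exact Nat.mod_eq_of_lt (by omega)
  rw [crossPairing_succAbove, crossPairing_succAbove, h2]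
  have hint : Integrable fun v : Euc (k + 2) => momentWeight α β v *
      (v 0 ^ 2 * (⟪b 0, cross A⟫ * ⟪b 0, cross A'⟫) +
        v 1 ^ 2 * (⟪b 1, cross A⟫ * ⟪b 1, cross A'⟫)) := by
    obtain ⟨τ, hτ0, hτ1⟩ := exists_inner_repr_symm_eq hab hu
    obtain ⟨τ', hτ0', hτ1'⟩ := exists_inner_repr_symm_eq (α := α) (β := -β) (A := A')
      (by simpa using hab) (by rw [hu', neg_smul, sub_eq_add_neg])
    refine (integrable_pairMoment (k := k) hk hab hα0 hβ0 (-(τ * τ'))).congr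
      (ae_of_all _ fun v => ?_)
    rw [hτ0, hτ1, hτ0', hτ1']
    ring
  have hkernel := kernel_mul_norm_pow_eq hk hab hα0 hβ0 hq hq' hu hu' ⟨0, hk⟩
  rw [← mul_assoc] at hkernel
  refine ⟨integrable_kernelFactor_mul_gaussDensity hk h, fun j => ⟨?_, moment_succ_succ_eq hab _ _⟩,
    hint, hkernel, fun ε hε i => integrableOn_truncRegion hab hε i, ?_⟩
  · simp_rw [sq]
    exact integrable_momentWeight_mul_sq hk hab hα0 hβ0 j j
  · rw [hkernel]
    exact (tendsto_truncMoment hab hint).add tendsto_const_nhds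

end Decomposition

end GaussLink

end

theorem mainTheorem9 (m n : ℕ) (hmn : Even (m + n)) (hpos : 0 < m + n)
    {M₁ : Type*} [TopologicalSpace M₁] [CompactSpace M₁]
    [ChartedSpace (GaussLink.Euc m) M₁] [IsManifold (𝓡 m) ∞ M₁]
    {M₂ : Type*} [TopologicalSpace M₂] [CompactSpace M₂]
    [ChartedSpace (GaussLink.Euc n) M₂] [IsManifold (𝓡 n) ∞ M₂]
    (o₁ : GaussLink.ManifoldOrientation m M₁) (P₁ : GaussLink.ChartPartition m M₁)
    (o₂ : GaussLink.ManifoldOrientation n M₂) (P₂ : GaussLink.ChartPartition n M₂)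
    (x : M₁ → GaussLink.Euc (m + n + 2))
    (hx : Manifold.IsSmoothEmbedding (𝓡 m) 𝓘(ℝ, GaussLink.Euc (m + n + 2)) ∞ x)
    (y : M₂ → GaussLink.Euc (m + n + 2))
    (hy : Manifold.IsSmoothEmbedding (𝓡 n) 𝓘(ℝ, GaussLink.Euc (m + n + 2)) ∞ y)
    (hxy : Disjoint (Set.range x) (Set.range y))
    (oU : ∀ U : GaussLink.Hyperplane (m + n), Orientation ℝ U.1 (Fin (m + n + 1))) :
    -- for almost every hyperplane, the linking number of the projections is defined
    (∀ᵐ U ∂(GaussLink.hyperplaneMeasure (m + n)),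
      Disjoint (Set.range (GaussLink.hyperplaneProj U ∘ x))
        (Set.range (GaussLink.hyperplaneProj U ∘ y)) ∧
      ∀ i j, IntegrableOn
        (GaussLink.gaussIntegrand o₁ P₁ o₂ P₂ (oU U)
          (GaussLink.hyperplaneProj U ∘ x) (GaussLink.hyperplaneProj U ∘ y) i j)
        (GaussLink.coordDomain P₁ i ×ˢ GaussLink.coordDomain P₂ j)) ∧
    -- the average of its square is finite, the configuration space integral converges absolutely,
    -- and the two agree
    Integrable (fun U => GaussLink.gaussLinking o₁ P₁ o₂ P₂ (oU U)
        (GaussLink.hyperplaneProj U ∘ x) (GaussLink.hyperplaneProj U ∘ y) ^ 2)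
      (GaussLink.hyperplaneMeasure (m + n)) ∧
    (∀ i j i' j', IntegrableOn (GaussLink.configIntegrand o₁ P₁ o₂ P₂ x y i j i' j')
      (GaussLink.configDomain P₁ P₂ i j i' j')) ∧
    ∫ U, GaussLink.gaussLinking o₁ P₁ o₂ P₂ (oU U)
        (GaussLink.hyperplaneProj U ∘ x) (GaussLink.hyperplaneProj U ∘ y) ^ 2
        ∂(GaussLink.hyperplaneMeasure (m + n)) =
      1 / GaussLink.sphereVolume (m + n) ^ 2 *
        ∑ i, ∑ j, ∑ i', ∑ j', ∫ z in GaussLink.configDomain P₁ P₂ i j i' j',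
          GaussLink.configIntegrand o₁ P₁ o₂ P₂ x y i j i' j' z ∧
    -- for almost all pairs of configurations, the difference vectors are linearly independent or
    -- the integrand of the kernel vanishes identically
    (∀ i j i' j', ∀ᵐ z ∂(volume.restrict (GaussLink.configDomain P₁ P₂ i j i' j')),
      LinearIndependent ℝ ![GaussLink.lastCol (GaussLink.configCols P₁ P₂ x y i j z.1),
        GaussLink.lastCol (GaussLink.configCols P₁ P₂ x y i' j' z.2)] ∨
      ∀ v, GaussLink.kernelFactor (GaussLink.configCols P₁ P₂ x y i j z.1) v *
        GaussLink.kernelFactor (GaussLink.configCols P₁ P₂ x y i' j' z.2) v = 0) ∧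
    -- the form of the kernel
    (∀ A A' : Fin (m + n + 1) → GaussLink.Euc (m + n + 2),
      LinearIndependent ℝ ![GaussLink.lastCol A, GaussLink.lastCol A'] →
      ∀ b : OrthonormalBasis (Fin (m + n + 2)) ℝ (GaussLink.Euc (m + n + 2)),
      b 0 = GaussLink.dir (GaussLink.dir (GaussLink.lastCol A)
        + GaussLink.dir (GaussLink.lastCol A')) →
      b 1 = GaussLink.dir (GaussLink.dir (GaussLink.lastCol A)
        - GaussLink.dir (GaussLink.lastCol A')) →
      ∀ α β : ℝ, α = ⟪b 0, GaussLink.dir (GaussLink.lastCol A)⟫ →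
      β = ⟪b 1, GaussLink.dir (GaussLink.lastCol A)⟫ →
      -- the kernel and `I₃₃(α, β) = … = I_{N+1,N+1}(α, β)` converge absolutely
      Integrable (fun v => GaussLink.kernelFactor A v * GaussLink.kernelFactor A' v *
        GaussLink.gaussDensity v) ∧
      (∀ j : Fin (m + n),
        Integrable (fun v : GaussLink.Euc (m + n + 2) =>
          GaussLink.momentWeight α β v * v j.succ.succ ^ 2) ∧
        GaussLink.moment α β j.succ.succ = GaussLink.moment (k := m + n) α β 2) ∧
      -- the decomposition, with the first two terms combined in one convergent integral
      Integrable (fun v : GaussLink.Euc (m + n + 2) => GaussLink.momentWeight α β v *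
        (v 0 ^ 2 * GaussLink.crossPairing (fun j => b (Fin.succAbove 0 j)) A A' +
          v 1 ^ 2 * GaussLink.crossPairing (fun j => b (Fin.succAbove 1 j)) A A')) ∧
      GaussLink.kernel A A' *
          ‖GaussLink.lastCol A‖ ^ (m + n + 1) * ‖GaussLink.lastCol A'‖ ^ (m + n + 1) =
        GaussLink.pairMoment (m + n) α β
            (GaussLink.crossPairing (fun j => b (Fin.succAbove 0 j)) A A')
            (GaussLink.crossPairing (fun j => b (Fin.succAbove 1 j)) A A') +
          GaussLink.moment (k := m + n) α β 2 * GaussLink.restPairing b A A' ∧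
      -- the decomposition, with `I₁₁` and `I₂₂` separate and regularized by truncation
      (∀ ε > 0, ∀ i : Fin (m + n + 2),
        IntegrableOn (fun v => GaussLink.momentWeight α β v * v i ^ 2)
          (GaussLink.truncRegion (m + n) α β ε)) ∧
      Tendsto (fun ε : ℝ =>
          GaussLink.truncMoment (k := m + n) ε α β 0 *
            GaussLink.crossPairing (fun j => b (Fin.succAbove 0 j)) A A' +
          GaussLink.truncMoment (k := m + n) ε α β 1 *
            GaussLink.crossPairing (fun j => b (Fin.succAbove 1 j)) A A' +
          GaussLink.moment (k := m + n) α β 2 * GaussLink.restPairing b A A')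
        (𝓝[>] 0)
        (𝓝 (GaussLink.kernel A A' *
          ‖GaussLink.lastCol A‖ ^ (m + n + 1) * ‖GaussLink.lastCol A'‖ ^ (m + n + 1)))) := by
  have hk : 1 ≤ m + n := hpos
  have hx' := hx.contMDiff
  have hy' := hy.contMDiff
  exact ⟨GaussLink.ae_disjoint_and_integrableOn o₁ P₁ o₂ P₂ hx' hy' hk hxy oU,
    GaussLink.integrable_gaussLinking_sq o₁ P₁ o₂ P₂ hx' hy' hk hxy oU,
    GaussLink.integrableOn_configIntegrand o₁ P₁ o₂ P₂ hx' hy' hk hxy,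
    GaussLink.integral_gaussLinking_sq o₁ P₁ o₂ P₂ hx' hy' hk hxy oU,
    GaussLink.ae_linearIndependent_or_kernelFactor_mul_eq_zero P₁ P₂ hx' hy' hk hxy,
    fun _ _ h _ hb0 hb1 _ _ hα hβ => GaussLink.kernel_decomposition hk h hb0 hb1 hα hβ⟩
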